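/- Let $X$ be a complex Banach space and let $-A$ be the generator of a sectorially bounded holomorphic $C_0$-semigroup $(e^{-tA})_{t\ge 0}$ on $X$; that is, for some $\theta\in(0,\pi/2]$ the semigroup extends holomorphically to the sector $\Sigma_\theta=\{\lambda\in\mathbb C\setminus\{0\}:|\arg\lambda|<\theta\}$, and the extension is bounded and strongly continuous on $\overline{\Sigma_\xi}$ for every $0<\xi<\theta$. For $\beta\ge 0$ let $A^\beta$ be the fractional power of $A$ (defined by the extended Hille–Phillips functional calculus) and put $$M_\beta:=\sup_{t>0}\|t^\beta A^\beta e^{-tA}\|.$$ Then for all $\alpha\in[0,1]$, $t>0$ and $n\in\mathbb N=\{1,2,\dots\}$, $$\left\|\left(1+\tfrac{t}{n}A\right)^{-n}x-e^{-tA}x\right\|\le M_{2-\alpha}\,r_{\alpha,n}\,t^\alpha\|A^\alpha x\|,\qquad x\in\operatorname{dom}(A^\alpha),$$ where $$r_{\alpha,n}=\frac1{2n}+\frac{1-2\alpha}{12n^2}\ \text{ for }\alpha\in[0,1/2),\qquad r_{\alpha,n}=\frac1{2n}\ \text{ for }\alpha\in[1/2,1].$$ Moreover, there is an absolute constant $C>0$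 (independent of $X$, $A$, $\alpha$, $t$, $n$ and $x$) such that for all such $X$ and $A$ and all $\alpha\in[0,1]$, $t>0$ and $n\in\mathbb N$, $$\left\|\left(1+\tfrac{t}{n}A\right)^{-n}x-e^{-tA}x-\frac{t^2}{2n}A^2e^{-tA}x\right\|\le C\,\bigl(M_{3-\alpha}+M_{4-\alpha}\bigr)\frac{t^\alpha}{n^2}\|A^\alpha x\|,\qquad x\in\operatorname{dom}(A^\alpha).$$ -/

import Mathlib

open Set Filter Topology MeasureTheory

universe u

noncomputable section

/-- A `C₀`-semigroup `(T(t))_{t ≥ 0}` of bounded linear operators on a complex normed space `X`.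
Only the values `T t` with `t ≥ 0` carry information. -/
structure C0Semigroup (X : Type u) [NormedAddCommGroup X] [NormedSpace ℂ X] where
  /-- the operator `T(t) = e^{-tA}` -/
  toFun : ℝ → X →L[ℂ] X
  map_zero : toFun 0 = 1
  map_add : ∀ s t : ℝ, 0 ≤ s → 0 ≤ t → toFun (s + t) = toFun s * toFun t
  strongCont : ∀ x : X, ContinuousOn (fun t => toFun t x) (Ici 0)

namespace C0Semigroup

variable {X : Type u} [NormedAddCommGroup X] [NormedSpace ℂ X]

/-- `y = lim_{h → 0+} (x - T(h) x) / h`. -/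
def HasNegDeriv (T : C0Semigroup X) (x y : X) : Prop :=
  Tendsto (fun h : ℝ => ((h : ℂ)⁻¹) • (x - T.toFun h x)) (𝓝[>] 0) (𝓝 y)

theorem HasNegDeriv.unique {T : C0Semigroup X} {x y y' : X} (h : T.HasNegDeriv x y)
    (h' : T.HasNegDeriv x y') : y = y' :=
  tendsto_nhds_unique h h'

theorem HasNegDeriv.add {T : C0Semigroup X} {x x' y y' : X} (h : T.HasNegDeriv x y)
    (h' : T.HasNegDeriv x' y') : T.HasNegDeriv (x + x') (y + y') := by
  have := Tendsto.add h h'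
  refine this.congr fun t => ?_
  rw [← smul_add, _root_.map_add]
  congr 1
  abel

theorem HasNegDeriv.smul {T : C0Semigroup X} {x y : X} (c : ℂ) (h : T.HasNegDeriv x y) :
    T.HasNegDeriv (c • x) (c • y) := by
  have := Tendsto.const_smul h c
  refine this.congr fun t => ?_
  rw [smul_comm, map_smul, smul_sub]

theorem hasNegDeriv_zero (T : C0Semigroup X) : T.HasNegDeriv 0 0 := by
  simp [HasNegDeriv]

/-- The operator `A` such that `-A` is the generator of the semigroup `T`:
`dom A` is the set of all `x` for which `lim_{h → 0+} (x - T(h) x) / h` exists, and `A x` is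
this limit. -/
def negGenerator (T : C0Semigroup X) : X →ₗ.[ℂ] X where
  domain :=
    { carrier := {x | ∃ y, T.HasNegDeriv x y}
      zero_mem' := ⟨0, T.hasNegDeriv_zero⟩
      add_mem' := fun ⟨y, hy⟩ ⟨y', hy'⟩ => ⟨y + y', hy.add hy'⟩
      smul_mem' := fun c _ ⟨y, hy⟩ => ⟨c • y, hy.smul c⟩ }
  toFun :=
    { toFun := fun x => x.2.choose
      map_add' := fun x y =>
        HasNegDeriv.unique (x + y).2.choose_spec (x.2.choose_spec.add y.2.choose_spec)
      map_smul' := fun c x =>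
        HasNegDeriv.unique (c • x).2.choose_spec (x.2.choose_spec.smul c) }

end C0Semigroup

/-- The open sector `Σ_θ = {z ≠ 0 : |arg z| < θ}`. -/
def openSector (θ : ℝ) : Set ℂ := {z | z ≠ 0 ∧ |z.arg| < θ}

namespace C0Semigroup

variable {X : Type u} [NormedAddCommGroup X] [NormedSpace ℂ X]

/-- `T` is a sectorially bounded holomorphic `C₀`-semigroup: for some `θ ∈ (0, π/2]` it extends
to a holomorphic function on `Σ_θ` which is bounded and strongly continuous on the closure of
`Σ_ξ` for every `0 < ξ < θ`. -/
def IsSectoriallyBoundedHolomorphic (T : C0Semigroup X) : Prop :=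
  ∃ θ : ℝ, 0 < θ ∧ θ ≤ Real.pi / 2 ∧ ∃ S : ℂ → X →L[ℂ] X,
    (∀ t : ℝ, 0 ≤ t → S (t : ℂ) = T.toFun t) ∧
    DifferentiableOn ℂ S (openSector θ) ∧
    ∀ ξ : ℝ, 0 < ξ → ξ < θ →
      (∃ K : ℝ, ∀ z ∈ closure (openSector ξ), ‖S z‖ ≤ K) ∧
      ∀ x : X, ContinuousOn (fun z => S z x) (closure (openSector ξ))

end C0Semigroup

/-- `g` is the Laplace transform on the open right half-plane of the bounded complex Borel measure
`φ · μ` on `[0, ∞)`. Here `μ` is a finite positive measure and `φ` is a complex `μ`-integrable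
density; by polar decomposition every bounded complex measure on `[0, ∞)` has this form. -/
def IsLaplaceTransformOf (μ : Measure ℝ) (φ : ℝ → ℂ) (g : ℂ → ℂ) : Prop :=
  IsFiniteMeasure μ ∧ μ (Iio 0) = 0 ∧ Integrable φ μ ∧
    ∀ z : ℂ, 0 < z.re → g z = ∫ s, φ s * Complex.exp (-(s * z)) ∂μ

namespace C0Semigroup

variable {X : Type u} [NormedAddCommGroup X] [NormedSpace ℂ X]

/-- Hille-Phillips functional calculus: `g` is the Laplace transform of a bounded complex measure
`ν` on `[0, ∞)` and `y = g(A) x = ∫ T(s) x ν(ds)`. -/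
def HillePhillips (T : C0Semigroup X) (g : ℂ → ℂ) (x y : X) : Prop :=
  ∃ (μ : Measure ℝ) (φ : ℝ → ℂ), IsLaplaceTransformOf μ φ g ∧ y = ∫ s, φ s • T.toFun s x ∂μ

/-- Extended Hille-Phillips functional calculus with regularizer `e`: `x ∈ dom f(A)` and
`y = f(A) x`, where `f(A) = e(A)⁻¹ (e f)(A)`. That is, `e(A) y = (e f)(A) x`. -/
def ExtHillePhillips (T : C0Semigroup X) (e f : ℂ → ℂ) (x y : X) : Prop :=
  ∃ w : X, T.HillePhillips e y w ∧ T.HillePhillips (fun z => e z * f z) x w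

/-- Graph of the fractional power `A ^ β`, `β ≥ 0`, where `-A` generates the bounded semigroup `T`:
`x ∈ dom (A ^ β)` and `y = A ^ β x`. It is the value of the extended Hille-Phillips calculus at
`z ^ β`, with the regularizer `(1 + z) ^ (-β)`. -/
def IsFracPow (T : C0Semigroup X) (β : ℝ) (x y : X) : Prop :=
  T.ExtHillePhillips (fun z => (1 + z) ^ (-(β : ℂ))) (fun z => z ^ (β : ℂ)) x y

/-- `M_β = sup_{t > 0} ‖t ^ β A ^ β T(t)‖`; `B` below is the bounded operator `A ^ β T(t)`. -/
def smoothingConst (T : C0Semigroup X) (β : ℝ) : ℝ :=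
  sSup {r : ℝ | ∃ t : ℝ, 0 < t ∧ ∃ B : X →L[ℂ] X,
    (∀ x : X, T.IsFracPow β (T.toFun t x) (B x)) ∧ r = ‖((t ^ β : ℝ) : ℂ) • B‖}

/-- `R` is the bounded everywhere defined inverse of `1 + c A`. -/
def IsInvOneAdd (A : X →ₗ.[ℂ] X) (c : ℝ) (R : X →L[ℂ] X) : Prop :=
  (∀ x : X, ∃ h : R x ∈ A.domain, R x + (c : ℂ) • A ⟨R x, h⟩ = x) ∧
    ∀ x : A.domain, R ((x : X) + (c : ℂ) • A x) = x

/-- `x ∈ dom (A ^ 2)` and `y = A ^ 2 x = A (A x)`. -/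
def IsSquareOf (A : X →ₗ.[ℂ] X) (x y : X) : Prop :=
  ∃ (h : x ∈ A.domain) (h' : A ⟨x, h⟩ ∈ A.domain), y = A ⟨A ⟨x, h⟩, h'⟩

end C0Semigroup

/-- The rate `r_{α,n}`. -/
def eulerRate (α : ℝ) (n : ℕ) : ℝ :=
  if α < 1 / 2 then 1 / (2 * (n : ℝ)) + (1 - 2 * α) / (12 * (n : ℝ) ^ 2) else 1 / (2 * (n : ℝ))

end

/-! Euler's approximation is an average of the semigroup: `(1 + (t/n)A)⁻ⁿ x` is the mean of
`T(ts/n)x` when `s` follows the Gamma law with shape `n`. Under this law `s/n` has mean `1`,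
variance `1/n` and third central moment `2/n²`. In the second-order Taylor formula at `1` for `u(s)
= T(ts)x` the linear term therefore averages to zero, and the error is the mean of the remainder.
Since `u⁽ᵏ⁾(s) = (-t)ᵏ Aᵏ T(ts) x` has norm at most `M_{k-α} t^α s^(α-k) ‖A^α x‖`, the remainder is
dominated by `M_{2-α} t^α ‖A^α x‖ g(s)` for any scalar `g` with `g(1) = g'(1) = 0` and `g''(s) ≥
s^(α-2)` (`IsTaylorRemainder.norm_le`).

The rate comes from choosing `g`. By weighted AM-GM, `s^(α-2)` lies below the convex combination of
`s⁻²` and `s^(-3/2)`, or of `s^(-3/2)` and `s⁻¹`, whose weights reproduce the exponent. The three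
corresponding remainders involve `log s`, `√s` and `s log s`. Their Gamma means reduce to harmonic
numbers and a ratio of Gamma values, and are bounded by `1/(2n) + 1/(12n²)`, `1/(2n)` and `1/(2n)`.
For the second estimate the expansion goes to fourth order: the variance term is the correction
`t²/(2n) A²T(t)x`, the third moment yields the `M_{3-α}` term, and the fourth-order remainder yields
the `M_{4-α}` term.

The other half of the work is operator-theoretic. Uniqueness of Laplace transforms makes the
Hille-Phillips calculus well defined and multiplicative. Gamma laws and the binomial series put
`(1+z)^(-β)` and `(z/(1+z))^β` into it. The analytic bound `‖tAT(t)‖ ≤ C` makes every `M_β` a finite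
supremum, and injectivity of resolvent powers identifies `A^(k-α)T(t)A^αx` with `AᵏT(t)x`. -/

noncomputable section

/-! ### Complex measures carried by an auxiliary space -/

/-- Data `(μ, φ, τ)` representing the push-forward under `τ ≥ 0` of the bounded complex
measure `φ · μ`. -/
structure IsRep {Ω : Type*} [MeasurableSpace Ω] (μ : Measure Ω) (φ : Ω → ℂ) (τ : Ω → ℝ) :
    Prop where
  integrable : Integrable φ μ
  measurable : Measurable τ
  nonneg : ∀ᵐ ω ∂μ, 0 ≤ τ ω

/-- The push-forward under `τ` of the positive part of `h · μ`. -/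
def partMeasure {Ω : Type*} [MeasurableSpace Ω] (μ : Measure Ω) (h : Ω → ℝ) (τ : Ω → ℝ) :
    Measure ℝ :=
  (μ.withDensity (fun ω => ENNReal.ofReal (h ω))).map τ

section PartMeasure

variable {Ω : Type*} [MeasurableSpace Ω] {μ : Measure Ω} {h : Ω → ℝ} {τ : Ω → ℝ}
  {E : Type*} [NormedAddCommGroup E] [NormedSpace ℝ E]

theorem partMeasure_isFinite (hh : Integrable h μ) : IsFiniteMeasure (partMeasure μ h τ) := by
  have : IsFiniteMeasure (μ.withDensity (fun ω => ENNReal.ofReal (h ω))) :=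
    isFiniteMeasure_withDensity_ofReal hh.2
  unfold partMeasure
  infer_instance

theorem partMeasure_nonneg (hτ : Measurable τ) (h0 : ∀ᵐ ω ∂μ, 0 ≤ τ ω) :
    ∀ᵐ s ∂partMeasure μ h τ, 0 ≤ s := by
  unfold partMeasure
  rw [ae_map_iff hτ.aemeasurable measurableSet_Ici]
  exact (withDensity_absolutelyContinuous _ _).ae_le h0

theorem integral_partMeasure (hh : Integrable h μ) (hτ : Measurable τ) {F : ℝ → E}
    (hF : Continuous F) :
    ∫ s, F s ∂partMeasure μ h τ = ∫ ω, (max (h ω) 0) • F (τ ω) ∂μ := by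
  unfold partMeasure
  rw [integral_map hτ.aemeasurable hF.aestronglyMeasurable]
  rw [integral_withDensity_eq_integral_toReal_smul₀ hh.1.aemeasurable.ennreal_ofReal
    (ae_of_all _ fun _ => ENNReal.ofReal_lt_top)]
  simp [ENNReal.toReal_ofReal']

theorem integrable_smul_comp (hh : Integrable h μ) (hτ : Measurable τ) {F : ℝ → E}
    (hF : Continuous F) {K : ℝ} (hK : ∀ s, ‖F s‖ ≤ K) :
    Integrable (fun ω => h ω • F (τ ω)) μ :=
  hh.smul_bdd K (hF.comp_aestronglyMeasurable hτ.aestronglyMeasurable)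
    (ae_of_all _ fun _ => hK _)

/-- From `h = h⁺ - h⁻`; questions about a signed density become questions about two finite positive
measures on the line. -/
theorem integral_smul_comp_eq (hh : Integrable h μ) (hτ : Measurable τ) {F : ℝ → E}
    (hF : Continuous F) {K : ℝ} (hK : ∀ s, ‖F s‖ ≤ K) :
    ∫ ω, h ω • F (τ ω) ∂μ =
      (∫ s, F s ∂partMeasure μ h τ) - ∫ s, F s ∂partMeasure μ (fun ω => -h ω) τ := by
  rw [integral_partMeasure hh hτ hF, integral_partMeasure (h := fun ω => -h ω) hh.neg hτ hF, ← integral_sub]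
  · refine integral_congr_ae (ae_of_all _ fun ω => ?_)
    simp only [← sub_smul]
    congr 1
    rcases le_total 0 (h ω) with h0 | h0
    · rw [max_eq_left h0, max_eq_right (by simpa using h0)]; ring
    · rw [max_eq_right h0, max_eq_left (by simpa using h0)]; ring
  · exact integrable_smul_comp hh.pos_part hτ hF hK
  · exact integrable_smul_comp hh.neg.pos_part hτ hF hK

end PartMeasure

/-! ### Uniqueness of Laplace transforms -/

theorem Continuous.integrable_of_bound {ν : Measure ℝ} [IsFiniteMeasure ν] {E : Type*}
    [NormedAddCommGroup E] {F : ℝ → E} (hF : Continuous F) {K : ℝ} (hK : ∀ s, ‖F s‖ ≤ K) :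
    Integrable F ν :=
  Integrable.of_bound hF.aestronglyMeasurable K (ae_of_all _ hK)

/-- Finite measures on `[0, ∞)` are determined by their Laplace transform on the open right
half-plane. -/
theorem measure_ext_of_laplace {P Q : Measure ℝ} [IsFiniteMeasure P] [IsFiniteMeasure Q]
    (hP : ∀ᵐ s ∂P, 0 ≤ s) (hQ : ∀ᵐ s ∂Q, 0 ≤ s)
    (hPQ : ∀ z : ℂ, 0 < z.re → ∫ s : ℝ, Complex.exp (-(((max s 0 : ℝ) : ℂ) * z)) ∂P =
      ∫ s : ℝ, Complex.exp (-(((max s 0 : ℝ) : ℂ) * z)) ∂Q) : P = Q := by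
  -- Only `Re z > 0` is available, so the characteristic function is reached as the boundary limit
  -- along `z = 1/(k+1) - it`.
  have key : ∀ (ν : Measure ℝ) [IsFiniteMeasure ν], (∀ᵐ s ∂ν, 0 ≤ s) → ∀ t : ℝ,
      Tendsto (fun k : ℕ => ∫ s : ℝ, Complex.exp (-(((max s 0 : ℝ) : ℂ) *
        ((1 / ((k : ℝ) + 1) : ℝ) - t * Complex.I))) ∂ν) atTop (𝓝 (charFun ν t)) := by
    intro ν _ hR t
    rw [charFun_apply_real]
    refine tendsto_integral_of_dominated_convergence (fun _ => 1) ?_ (integrable_const _) ?_ ?_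
    · intro k
      exact Continuous.aestronglyMeasurable (by fun_prop)
    · intro k
      refine ae_of_all _ fun s => ?_
      rw [Complex.norm_exp, Real.exp_le_one_iff]
      simp only [Complex.neg_re, Complex.mul_re, Complex.ofReal_re, Complex.sub_re,
        Complex.ofReal_im, Complex.I_re, Complex.I_im]
      have : 0 ≤ max s 0 * (1 / ((k : ℝ) + 1)) := by positivity
      simp only [zero_mul, mul_zero, sub_zero, sub_self]
      linarith
    · filter_upwards [hR] with s hs
      rw [max_eq_left hs]
      have h1 : Tendsto (fun k : ℕ => (((1 / ((k : ℝ) + 1) : ℝ)) : ℂ)) atTop (𝓝 ((0 : ℝ) : ℂ)) :=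
        (Complex.continuous_ofReal.tendsto _).comp tendsto_one_div_add_atTop_nhds_zero_nat
      have h2 : Continuous fun w : ℂ => Complex.exp (-((s : ℂ) * (w - t * Complex.I))) := by
        fun_prop
      have := (h2.tendsto _).comp h1
      simp only [Complex.ofReal_zero, Function.comp_def] at this
      convert this using 2
      ring_nf
  apply Measure.ext_of_charFun
  funext t
  refine tendsto_nhds_unique (key P hP t) ((key Q hQ t).congr fun k => ?_)
  refine (hPQ _ ?_).symm
  simp only [Complex.sub_re, Complex.ofReal_re, Complex.mul_re, Complex.I_re, Complex.I_im,
    Complex.ofReal_im]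
  have : 0 < 1 / ((k : ℝ) + 1) := by positivity
  linarith

theorem norm_exp_neg_max_mul_le {z : ℂ} (hz : 0 < z.re) (s : ℝ) :
    ‖Complex.exp (-(((max s 0 : ℝ) : ℂ) * z))‖ ≤ 1 := by
  rw [Complex.norm_exp, Real.exp_le_one_iff]
  simp only [Complex.neg_re, Complex.mul_re, Complex.ofReal_re, Complex.ofReal_im]
  have : 0 ≤ max s 0 * z.re := by positivity
  linarith

/-- With `max s 0` the exponential is bounded and continuous on all of `ℝ` when `Re w > 0`, and so
is an admissible test function. -/
theorem IsRep.integral_exp_max {Ω : Type*} [MeasurableSpace Ω] {μ : Measure Ω} {φ : Ω → ℂ}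
    {τ : Ω → ℝ} (hr : IsRep μ φ τ) (w : ℂ) :
    ∫ ω, φ ω * Complex.exp (-(τ ω * w)) ∂μ =
      ∫ ω, φ ω * Complex.exp (-(((max (τ ω) 0 : ℝ) : ℂ) * w)) ∂μ := by
  refine integral_congr_ae ?_
  filter_upwards [hr.nonneg] with ω h
  rw [max_eq_left h]

section Uniqueness

variable {Ω Ω' : Type*} [MeasurableSpace Ω] [MeasurableSpace Ω'] {μ : Measure Ω}
  {μ' : Measure Ω'} {τ : Ω → ℝ} {τ' : Ω' → ℝ}
  {E : Type*} [NormedAddCommGroup E] [NormedSpace ℂ E]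

theorem integral_smul_comp_unique_real {h : Ω → ℝ} {h' : Ω' → ℝ}
    (hh : Integrable h μ) (hh' : Integrable h' μ')
    (hτ : Measurable τ) (hτ' : Measurable τ')
    (h0 : ∀ᵐ ω ∂μ, 0 ≤ τ ω) (h0' : ∀ᵐ ω ∂μ', 0 ≤ τ' ω)
    (heq : ∀ z : ℂ, 0 < z.re → ∫ ω, h ω • Complex.exp (-(((max (τ ω) 0 : ℝ) : ℂ) * z)) ∂μ =
      ∫ ω, h' ω • Complex.exp (-(((max (τ' ω) 0 : ℝ) : ℂ) * z)) ∂μ')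
    {F : ℝ → E} (hF : Continuous F) {K : ℝ} (hK : ∀ s, ‖F s‖ ≤ K) :
    ∫ ω, h ω • F (τ ω) ∂μ = ∫ ω, h' ω • F (τ' ω) ∂μ' := by
  have := partMeasure_isFinite (τ := τ) hh
  have := partMeasure_isFinite (τ := τ) hh.neg
  have := partMeasure_isFinite (τ := τ') hh'
  have := partMeasure_isFinite (τ := τ') hh'.neg
  -- Moving the negative parts to the opposite sides turns equality of signed measures into equality
  -- of positive ones.
  have hPQ : partMeasure μ h τ + partMeasure μ' (fun ω => -h' ω) τ' =
      partMeasure μ' h' τ' + partMeasure μ (fun ω => -h ω) τ := by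
    refine measure_ext_of_laplace ?_ ?_ ?_
    · rw [ae_add_measure_iff]
      exact ⟨partMeasure_nonneg hτ h0, partMeasure_nonneg hτ' h0'⟩
    · rw [ae_add_measure_iff]
      exact ⟨partMeasure_nonneg hτ' h0', partMeasure_nonneg hτ h0⟩
    · intro z hz
      have hc : Continuous fun s : ℝ => Complex.exp (-(((max s 0 : ℝ) : ℂ) * z)) := by fun_prop
      have hb := norm_exp_neg_max_mul_le hz
      have e := heq z hz
      rw [integral_smul_comp_eq hh hτ hc hb, integral_smul_comp_eq hh' hτ' hc hb] at e
      rw [integral_add_measure (hc.integrable_of_bound hb) (hc.integrable_of_bound hb),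
        integral_add_measure (hc.integrable_of_bound hb) (hc.integrable_of_bound hb)]
      linear_combination e
  have e : ∫ s, F s ∂(partMeasure μ h τ + partMeasure μ' (fun ω => -h' ω) τ') =
      ∫ s, F s ∂(partMeasure μ' h' τ' + partMeasure μ (fun ω => -h ω) τ) := by rw [hPQ]
  rw [integral_add_measure (hF.integrable_of_bound hK) (hF.integrable_of_bound hK),
    integral_add_measure (hF.integrable_of_bound hK) (hF.integrable_of_bound hK)] at e
  rw [integral_smul_comp_eq hh hτ hF hK, integral_smul_comp_eq hh' hτ' hF hK,
    sub_eq_sub_iff_add_eq_add, e]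

theorem integrable_smul_comp_complex {φ : Ω → ℂ} (hφ : Integrable φ μ) (hτ : Measurable τ)
    {F : ℝ → E} (hF : Continuous F) {K : ℝ} (hK : ∀ s, ‖F s‖ ≤ K) :
    Integrable (fun ω => φ ω • F (τ ω)) μ :=
  hφ.smul_bdd K (hF.comp_aestronglyMeasurable hτ.aestronglyMeasurable)
    (ae_of_all _ fun _ => hK _)

/-- The half-plane is stable under conjugation, so the transform of the complex measure determines
that of its real part. -/
theorem IsRep.integral_re {φ : Ω → ℂ} (hr : IsRep μ φ τ) (z : ℂ) (hz : 0 < z.re) :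
    ∫ ω, (φ ω).re • Complex.exp (-(((max (τ ω) 0 : ℝ) : ℂ) * z)) ∂μ =
      ((∫ ω, φ ω * Complex.exp (-(τ ω * z)) ∂μ) + (starRingEnd ℂ)
        (∫ ω, φ ω * Complex.exp (-(τ ω * (starRingEnd ℂ) z)) ∂μ)) / 2 := by
  rw [hr.integral_exp_max, hr.integral_exp_max, ← integral_conj, ← integral_add, ← integral_div]
  · refine integral_congr_ae (ae_of_all _ fun ω => ?_)
    simp only [map_mul, ← Complex.exp_conj, map_neg, Complex.conj_conj, Complex.conj_ofReal]
    rw [← add_mul, Complex.add_conj, Complex.real_smul]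
    push_cast
    ring
  · exact integrable_smul_comp_complex hr.integrable hr.measurable
      (F := fun s : ℝ => Complex.exp (-(((max s 0 : ℝ) : ℂ) * z))) (by fun_prop)
      (norm_exp_neg_max_mul_le hz)
  · have := integrable_smul_comp_complex hr.integrable hr.measurable
      (F := fun s : ℝ => Complex.exp (-(((max s 0 : ℝ) : ℂ) * (starRingEnd ℂ) z))) (by fun_prop)
      (norm_exp_neg_max_mul_le (by simpa using hz))
    exact (Complex.conjLIE.integrable_comp_iff).2 this

theorem integral_smul_comp_re_im {φ : Ω → ℂ} (hφ : Integrable φ μ) (hτ : Measurable τ)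
    {F : ℝ → E} (hF : Continuous F) {K : ℝ} (hK : ∀ s, ‖F s‖ ≤ K) :
    ∫ ω, φ ω • F (τ ω) ∂μ =
      (∫ ω, (φ ω).re • F (τ ω) ∂μ) + Complex.I • ∫ ω, (φ ω).im • F (τ ω) ∂μ := by
  rw [← integral_smul, ← integral_add]
  · refine integral_congr_ae (ae_of_all _ fun ω => ?_)
    simp only [← Complex.coe_smul, smul_smul, ← add_smul]
    rw [mul_comm Complex.I, Complex.re_add_im]
  · exact integrable_smul_comp hφ.re hτ hF hK
  · exact (integrable_smul_comp hφ.im hτ hF hK).smul _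

theorem IsRep.unique {φ : Ω → ℂ} {φ' : Ω' → ℂ} (hr : IsRep μ φ τ) (hr' : IsRep μ' φ' τ')
    (heq : ∀ z : ℂ, 0 < z.re → ∫ ω, φ ω * Complex.exp (-(τ ω * z)) ∂μ =
      ∫ ω, φ' ω * Complex.exp (-(τ' ω * z)) ∂μ')
    {F : ℝ → E} (hF : Continuous F) {K : ℝ} (hK : ∀ s, ‖F s‖ ≤ K) :
    ∫ ω, φ ω • F (τ ω) ∂μ = ∫ ω, φ' ω • F (τ' ω) ∂μ' := by
  have hre : ∀ {φ : Ω → ℂ} {φ' : Ω' → ℂ} (_ : IsRep μ φ τ) (_ : IsRep μ' φ' τ')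
      (_ : ∀ z : ℂ, 0 < z.re → ∫ ω, φ ω * Complex.exp (-(τ ω * z)) ∂μ =
        ∫ ω, φ' ω * Complex.exp (-(τ' ω * z)) ∂μ'),
      ∫ ω, (φ ω).re • F (τ ω) ∂μ = ∫ ω, (φ' ω).re • F (τ' ω) ∂μ' := by
    intro φ φ' hr hr' heq
    refine integral_smul_comp_unique_real hr.integrable.re hr'.integrable.re hr.measurable
      hr'.measurable hr.nonneg hr'.nonneg (fun z hz => ?_) hF hK
    have := hr.integral_re z hz
    have := hr'.integral_re z hz
    simp only [RCLike.re_to_complex] at *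
    rw [hr.integral_re z hz, hr'.integral_re z hz, heq z hz, heq _ (by simpa using hz)]
  rw [integral_smul_comp_re_im hr.integrable hr.measurable hF hK,
    integral_smul_comp_re_im hr'.integrable hr'.measurable hF hK, hre hr hr' heq]
  -- The real part of `-iφ` is the imaginary part of `φ`.
  have := hre (φ := fun ω => -Complex.I * φ ω) (φ' := fun ω => -Complex.I * φ' ω)
    ⟨hr.integrable.const_mul _, hr.measurable, hr.nonneg⟩
    ⟨hr'.integrable.const_mul _, hr'.measurable, hr'.nonneg⟩ (fun z hz => by
      simp only [mul_assoc, integral_const_mul, heq z hz])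
  simp only [neg_mul, Complex.neg_re, Complex.mul_re, Complex.I_re, Complex.I_im, zero_mul,
    one_mul, zero_sub, neg_neg] at this
  rw [this]

end Uniqueness

/-! ### The algebra of Laplace transforms of bounded measures -/

/-- A bounded complex measure given by `(μ, φ, τ)` has a density with respect to a finite
positive measure on `[0, ∞)`. -/
theorem IsRep.exists_density {Ω : Type*} [MeasurableSpace Ω] {μ : Measure Ω} {φ : Ω → ℂ}
    {τ : Ω → ℝ} (hr : IsRep μ φ τ) :
    ∃ (m : Measure ℝ) (ψ : ℝ → ℂ), IsFiniteMeasure m ∧ (∀ᵐ s ∂m, 0 ≤ s) ∧ Integrable ψ m ∧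
      ∀ (F : ℝ → ℂ), Continuous F → ∀ K : ℝ, (∀ s, ‖F s‖ ≤ K) →
        ∫ s, ψ s * F s ∂m = ∫ ω, φ ω * F (τ ω) ∂μ := by
  set a := partMeasure μ (fun ω => (φ ω).re) τ with ha
  set b := partMeasure μ (fun ω => -(φ ω).re) τ with hb
  set c := partMeasure μ (fun ω => (φ ω).im) τ with hc
  set d := partMeasure μ (fun ω => -(φ ω).im) τ with hd
  have hre : Integrable (fun ω => (φ ω).re) μ := hr.integrable.re
  have him : Integrable (fun ω => (φ ω).im) μ := hr.integrable.im
  have : IsFiniteMeasure a := partMeasure_isFinite hre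
  have : IsFiniteMeasure b := partMeasure_isFinite hre.neg
  have : IsFiniteMeasure c := partMeasure_isFinite him
  have : IsFiniteMeasure d := partMeasure_isFinite him.neg
  -- The sum dominates all four Jordan parts, so their Radon-Nikodym derivatives assemble into one
  -- complex density.
  set m := a + b + c + d with hm
  have : IsFiniteMeasure m := by rw [hm]; infer_instance
  have acA : a ≪ m := by
    refine Measure.absolutelyContinuous_of_le ?_
    rw [hm, add_assoc, add_assoc]; exact Measure.le_add_right le_rfl
  have acB : b ≪ m := by
    refine Measure.absolutelyContinuous_of_le ?_
    rw [hm, add_assoc, add_assoc]; exact Measure.le_add_left (Measure.le_add_right le_rfl)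
  have acC : c ≪ m := by
    refine Measure.absolutelyContinuous_of_le ?_
    rw [hm]; exact Measure.le_add_right (Measure.le_add_left le_rfl)
  have acD : d ≪ m := by
    refine Measure.absolutelyContinuous_of_le ?_
    rw [hm]; exact Measure.le_add_left le_rfl
  have iR : ∀ (ν : Measure ℝ) [IsFiniteMeasure ν],
      Integrable (fun s => (((ν.rnDeriv m s).toReal : ℝ) : ℂ)) m := fun ν _ =>
    Measure.integrable_toReal_rnDeriv.ofReal
  refine ⟨m, fun s => (((a.rnDeriv m s).toReal : ℂ) - (b.rnDeriv m s).toReal) +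
    Complex.I * ((c.rnDeriv m s).toReal - (d.rnDeriv m s).toReal), inferInstance, ?_, ?_, ?_⟩
  · rw [hm]
    simp only [ae_add_measure_iff]
    exact ⟨⟨⟨partMeasure_nonneg hr.measurable hr.nonneg,
      partMeasure_nonneg hr.measurable hr.nonneg⟩,
      partMeasure_nonneg hr.measurable hr.nonneg⟩, partMeasure_nonneg hr.measurable hr.nonneg⟩
  · exact ((iR a).sub (iR b)).add (((iR c).sub (iR d)).const_mul _)
  · intro F hF K hK
    have e : ∀ (ν : Measure ℝ) [IsFiniteMeasure ν], ν ≪ m →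
        ∫ s, ((ν.rnDeriv m s).toReal : ℂ) * F s ∂m = ∫ s, F s ∂ν := by
      intro ν hν h
      have : ν.HaveLebesgueDecomposition m :=
        Measure.haveLebesgueDecomposition_of_sigmaFinite ν m
      rw [← integral_rnDeriv_smul h]
      simp only [Complex.real_smul]
    have i2 : ∀ (ν : Measure ℝ) [IsFiniteMeasure ν],
        Integrable (fun s => ((ν.rnDeriv m s).toReal : ℂ) * F s) m := fun ν _ =>
      (iR ν).mul_bdd hF.aestronglyMeasurable (ae_of_all _ hK)
    have split := integral_smul_comp_re_im hr.integrable hr.measurable hF hK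
    rw [integral_smul_comp_eq hre hr.measurable hF hK,
      integral_smul_comp_eq him hr.measurable hF hK] at split
    simp only [smul_eq_mul] at split
    rw [split, ← ha, ← hb, ← hc, ← hd, ← e a acA, ← e b acB, ← e c acC, ← e d acD,
      ← integral_sub (i2 a) (i2 b), ← integral_sub (i2 c) (i2 d), ← integral_const_mul]
    refine Eq.trans ?_ (integral_add ((i2 a).sub (i2 b)) (((i2 c).sub (i2 d)).const_mul _))
    refine integral_congr_ae (ae_of_all _ fun s => ?_)
    ring

/-- `g` is the Laplace transform of a bounded complex measure on `[0, ∞)`. -/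
def IsLap (g : ℂ → ℂ) : Prop := ∃ (μ : Measure ℝ) (φ : ℝ → ℂ), IsLaplaceTransformOf μ φ g

theorem IsLaplaceTransformOf.isRep {μ : Measure ℝ} {φ : ℝ → ℂ} {g : ℂ → ℂ}
    (h : IsLaplaceTransformOf μ φ g) : IsRep μ φ id :=
  ⟨h.2.2.1, measurable_id, by
    rw [ae_iff]
    have : {a : ℝ | ¬0 ≤ id a} = Iio 0 := by ext; simp
    rw [this]
    exact h.2.1⟩

theorem IsRep.isLap {Ω : Type*} [MeasurableSpace Ω] {μ : Measure Ω} {φ : Ω → ℂ}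
    {τ : Ω → ℝ} (hr : IsRep μ φ τ) {g : ℂ → ℂ}
    (hg : ∀ z : ℂ, 0 < z.re → g z = ∫ ω, φ ω * Complex.exp (-(τ ω * z)) ∂μ) : IsLap g := by
  obtain ⟨m, ψ, h1, h2, h3, h4⟩ := hr.exists_density
  refine ⟨m, ψ, h1, ?_, h3, fun z hz => ?_⟩
  · rw [ae_iff] at h2
    have : {a : ℝ | ¬0 ≤ a} = Iio 0 := by ext; simp
    rwa [this] at h2
  · have hr' : IsRep m ψ id := ⟨h3, measurable_id, h2⟩
    rw [hg z hz, hr.integral_exp_max, ← h4 (fun s => Complex.exp (-(((max s 0 : ℝ) : ℂ) * z)))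
      (by fun_prop) 1 (norm_exp_neg_max_mul_le hz)]
    exact (hr'.integral_exp_max z).symm

theorem IsLaplaceTransformOf.of_isRep {μ : Measure ℝ} [hμ : IsFiniteMeasure μ] {φ : ℝ → ℂ}
    {g : ℂ → ℂ} (hr : IsRep μ φ id)
    (hg : ∀ z : ℂ, 0 < z.re → g z = ∫ s, φ s * Complex.exp (-(s * z)) ∂μ) :
    IsLaplaceTransformOf μ φ g := by
  refine ⟨hμ, ?_, hr.integrable, hg⟩
  have := hr.nonneg
  rw [ae_iff] at this
  have e : {a : ℝ | ¬0 ≤ id a} = Iio 0 := by ext; simp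
  rwa [e] at this

namespace IsLap

theorem congr {g g' : ℂ → ℂ} (h : IsLap g) (e : ∀ z : ℂ, 0 < z.re → g' z = g z) : IsLap g' := by
  obtain ⟨μ, φ, h1, h2, h3, h4⟩ := h
  exact ⟨μ, φ, h1, h2, h3, fun z hz => (e z hz).trans (h4 z hz)⟩

end IsLap

/-- This is convolution, kept on the product space where the times add; products of transforms then
follow from Fubini. -/
theorem IsRep.mul {Ω Ω' : Type*} [MeasurableSpace Ω] [MeasurableSpace Ω'] {μ : Measure Ω}
    {μ' : Measure Ω'} [SFinite μ] [SFinite μ'] {φ : Ω → ℂ} {φ' : Ω' → ℂ} {τ : Ω → ℝ} {τ' : Ω' → ℝ}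
    (hr : IsRep μ φ τ) (hr' : IsRep μ' φ' τ') :
    IsRep (μ.prod μ') (fun p => φ p.1 * φ' p.2) (fun p => τ p.1 + τ' p.2) where
  integrable := hr.integrable.mul_prod hr'.integrable
  measurable := (hr.measurable.comp measurable_fst).add (hr'.measurable.comp measurable_snd)
  nonneg := by
    filter_upwards [Measure.quasiMeasurePreserving_fst.ae hr.nonneg,
      Measure.quasiMeasurePreserving_snd.ae hr'.nonneg] with p h h'
    exact add_nonneg h h'

theorem integral_exp_add_prod {Ω Ω' : Type*} [MeasurableSpace Ω] [MeasurableSpace Ω']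
    {μ : Measure Ω} {μ' : Measure Ω'} [SFinite μ] [SFinite μ'] {φ : Ω → ℂ} {φ' : Ω' → ℂ}
    {τ : Ω → ℝ} {τ' : Ω' → ℝ} (z : ℂ) :
    ∫ p : Ω × Ω', φ p.1 * φ' p.2 * Complex.exp (-(((τ p.1 + τ' p.2 : ℝ) : ℂ) * z)) ∂(μ.prod μ') =
      (∫ ω, φ ω * Complex.exp (-(τ ω * z)) ∂μ) * ∫ ω, φ' ω * Complex.exp (-(τ' ω * z)) ∂μ' := by
  rw [← integral_prod_mul]
  refine integral_congr_ae (ae_of_all _ fun p => ?_)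
  simp only
  rw [Complex.ofReal_add, add_mul, neg_add, Complex.exp_add]
  ring

theorem IsLap.mul {g g' : ℂ → ℂ} (h : IsLap g) (h' : IsLap g') : IsLap (fun z => g z * g' z) := by
  obtain ⟨μ, φ, h⟩ := h
  obtain ⟨μ', φ', h'⟩ := h'
  have := h.1
  have := h'.1
  refine (h.isRep.mul h'.isRep).isLap fun z hz => ?_
  rw [h.2.2.2 z hz, h'.2.2.2 z hz]
  exact (integral_exp_add_prod (τ := id) (τ' := id) z).symm

theorem isRep_dirac : IsRep (Measure.dirac ()) (fun _ : Unit => (1 : ℂ)) (fun _ => (0 : ℝ)) :=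
  ⟨integrable_const _, measurable_const, ae_of_all _ fun _ => le_rfl⟩

theorem isLap_one : IsLap (fun _ => 1) :=
  isRep_dirac.isLap fun z _ => by simp

theorem IsRep.const_mul {Ω : Type*} [MeasurableSpace Ω] {μ : Measure Ω} {φ : Ω → ℂ} {τ : Ω → ℝ}
    (hr : IsRep μ φ τ) (c : ℂ) : IsRep μ (fun ω => c * φ ω) τ :=
  ⟨hr.integrable.const_mul c, hr.measurable, hr.nonneg⟩

theorem IsLap.const_mul {g : ℂ → ℂ} (h : IsLap g) (c : ℂ) : IsLap (fun z => c * g z) := by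
  obtain ⟨μ, φ, h⟩ := h
  refine (h.isRep.const_mul c).isLap fun z hz => ?_
  simp only [mul_assoc, integral_const_mul]
  rw [h.2.2.2 z hz]
  rfl

theorem IsRep.scale {Ω : Type*} [MeasurableSpace Ω] {μ : Measure Ω} {φ : Ω → ℂ} {τ : Ω → ℝ}
    (hr : IsRep μ φ τ) {c : ℝ} (hc : 0 ≤ c) : IsRep μ φ (fun ω => c * τ ω) :=
  ⟨hr.integrable, hr.measurable.const_mul c, by
    filter_upwards [hr.nonneg] with ω h using mul_nonneg hc h⟩

/-- The density of `φ · μ + φ' · μ'` with respect to `μ + μ'`. -/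
def addDensity (μ μ' : Measure ℝ) (φ φ' : ℝ → ℂ) (s : ℝ) : ℂ :=
  (μ.rnDeriv (μ + μ') s).toReal • φ s + (μ'.rnDeriv (μ + μ') s).toReal • φ' s

theorem isRep_add {μ μ' : Measure ℝ} [IsFiniteMeasure μ] [IsFiniteMeasure μ'] {φ φ' : ℝ → ℂ}
    (hr : IsRep μ φ id) (hr' : IsRep μ' φ' id) : IsRep (μ + μ') (addDensity μ μ' φ φ') id where
  integrable :=
    ((integrable_rnDeriv_smul_iff (Measure.absolutelyContinuous_of_le
      (Measure.le_add_right le_rfl))).2 hr.integrable).add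
    ((integrable_rnDeriv_smul_iff (Measure.absolutelyContinuous_of_le
      (Measure.le_add_left le_rfl))).2 hr'.integrable)
  measurable := measurable_id
  nonneg := by
    rw [ae_add_measure_iff]
    exact ⟨hr.nonneg, hr'.nonneg⟩

theorem integral_addDensity {μ μ' : Measure ℝ} [IsFiniteMeasure μ] [IsFiniteMeasure μ']
    {φ φ' : ℝ → ℂ} (hr : IsRep μ φ id) (hr' : IsRep μ' φ' id) {E : Type*} [NormedAddCommGroup E]
    [NormedSpace ℂ E] {F : ℝ → E} (hF : Continuous F) {K : ℝ} (hK : ∀ s, ‖F s‖ ≤ K) :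
    ∫ s, addDensity μ μ' φ φ' s • F s ∂(μ + μ') =
      (∫ s, φ s • F s ∂μ) + ∫ s, φ' s • F s ∂μ' := by
  have ac : μ ≪ μ + μ' := Measure.absolutelyContinuous_of_le (Measure.le_add_right le_rfl)
  have ac' : μ' ≪ μ + μ' := Measure.absolutelyContinuous_of_le (Measure.le_add_left le_rfl)
  have i : Integrable (fun s => φ s • F s) μ :=
    integrable_smul_comp_complex hr.integrable measurable_id hF hK
  have i' : Integrable (fun s => φ' s • F s) μ' :=
    integrable_smul_comp_complex hr'.integrable measurable_id hF hK
  rw [← integral_rnDeriv_smul ac, ← integral_rnDeriv_smul ac', ← integral_add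
    ((integrable_rnDeriv_smul_iff ac).2 i) ((integrable_rnDeriv_smul_iff ac').2 i')]
  refine integral_congr_ae (ae_of_all _ fun s => ?_)
  simp only [addDensity, add_smul, smul_assoc]

theorem IsLap.exists_add {g g' : ℂ → ℂ} {μ μ' : Measure ℝ} {φ φ' : ℝ → ℂ}
    (h : IsLaplaceTransformOf μ φ g) (h' : IsLaplaceTransformOf μ' φ' g') :
    IsLaplaceTransformOf (μ + μ') (addDensity μ μ' φ φ') (fun z => g z + g' z) := by
  have := h.1
  have := h'.1
  refine .of_isRep (isRep_add h.isRep h'.isRep) fun z hz => ?_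
  have e := (isRep_add h.isRep h'.isRep).integral_exp_max z
  have e1 := h.isRep.integral_exp_max z
  have e2 := h'.isRep.integral_exp_max z
  simp only [id] at e e1 e2
  rw [h.2.2.2 z hz, h'.2.2.2 z hz, e, e1, e2]
  exact (integral_addDensity h.isRep h'.isRep (F := fun s : ℝ => Complex.exp
    (-(((max s 0 : ℝ) : ℂ) * z))) (by fun_prop) (norm_exp_neg_max_mul_le hz)).symm

theorem IsLap.add {g g' : ℂ → ℂ} (h : IsLap g) (h' : IsLap g') : IsLap (fun z => g z + g' z) := by
  obtain ⟨μ, φ, h⟩ := h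
  obtain ⟨μ', φ', h'⟩ := h'
  exact ⟨_, _, IsLap.exists_add h h'⟩

/-! ### The Hille-Phillips calculus as an algebra homomorphism -/

namespace C0Semigroup

variable {X : Type u} [NormedAddCommGroup X] [NormedSpace ℂ X]

/-- `‖T(t)‖ ≤ K` for all `t ≥ 0`. -/
def BoundedBy (T : C0Semigroup X) (K : ℝ) : Prop := ∀ t : ℝ, 0 ≤ t → ‖T.toFun t‖ ≤ K

theorem continuous_max (T : C0Semigroup X) (x : X) :
    Continuous fun s : ℝ => T.toFun (max s 0) x :=
  (T.strongCont x).comp_continuous (continuous_id.max continuous_const) fun s => le_max_right s 0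

theorem BoundedBy.nonneg {T : C0Semigroup X} {K : ℝ} (hK : T.BoundedBy K) : 0 ≤ K :=
  (norm_nonneg _).trans (hK 0 le_rfl)

theorem BoundedBy.norm_max_le {T : C0Semigroup X} {K : ℝ} (hK : T.BoundedBy K) (x : X) (s : ℝ) :
    ‖T.toFun (max s 0) x‖ ≤ K * ‖x‖ :=
  (T.toFun (max s 0)).le_of_opNorm_le (hK _ (le_max_right s 0)) x

section Rep

variable {T : C0Semigroup X} {K : ℝ} {Ω : Type*} [MeasurableSpace Ω] {μ : Measure Ω} {φ : Ω → ℂ}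
  {τ : Ω → ℝ}

theorem integral_max (T : C0Semigroup X) (hr : IsRep μ φ τ) (x : X) :
    ∫ ω, φ ω • T.toFun (τ ω) x ∂μ = ∫ ω, φ ω • T.toFun (max (τ ω) 0) x ∂μ := by
  refine integral_congr_ae ?_
  filter_upwards [hr.nonneg] with ω h
  rw [max_eq_left h]

theorem integral_max_id (T : C0Semigroup X) {μ : Measure ℝ} {φ : ℝ → ℂ} (hr : IsRep μ φ id)
    (x : X) : ∫ s, φ s • T.toFun s x ∂μ = ∫ s, φ s • T.toFun (max s 0) x ∂μ :=
  T.integral_max hr x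

theorem BoundedBy.integrable (hK : T.BoundedBy K) (hr : IsRep μ φ τ) (x : X) :
    Integrable (fun ω => φ ω • T.toFun (τ ω) x) μ := by
  refine (integrable_smul_comp_complex hr.integrable hr.measurable (T.continuous_max x)
    (hK.norm_max_le x)).congr ?_
  filter_upwards [hr.nonneg] with ω h
  rw [max_eq_left h]

theorem BoundedBy.exists_clm (hK : T.BoundedBy K) (hr : IsRep μ φ τ) :
    ∃ L : X →L[ℂ] X, (∀ x, L x = ∫ ω, φ ω • T.toFun (τ ω) x ∂μ) ∧ ‖L‖ ≤ (∫ ω, ‖φ ω‖ ∂μ) * K := by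
  refine ⟨LinearMap.mkContinuous
    { toFun := fun x => ∫ ω, φ ω • T.toFun (τ ω) x ∂μ
      map_add' := fun x y => ?_
      map_smul' := fun c x => ?_ } ((∫ ω, ‖φ ω‖ ∂μ) * K) fun x => ?_, fun x => rfl, ?_⟩
  · rw [← integral_add (hK.integrable hr x) (hK.integrable hr y)]
    simp only [_root_.map_add, smul_add]
  · rw [RingHom.id_apply, ← integral_smul]
    simp only [map_smul, smul_comm c]
  · refine (norm_integral_le_of_norm_le (hr.integrable.norm.mul_const (K * ‖x‖)) ?_).trans ?_
    · filter_upwards [hr.nonneg] with ω h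
      rw [norm_smul]
      gcongr
      exact (T.toFun (τ ω)).le_of_opNorm_le (hK _ h) x
    · rw [integral_mul_const, mul_assoc]
  · refine LinearMap.mkContinuous_norm_le _ (mul_nonneg ?_ hK.nonneg) _
    exact integral_nonneg fun _ => norm_nonneg _

end Rep

/-- The operator `g(A)` given by the Hille-Phillips calculus. -/
def hpc (T : C0Semigroup X) (g : ℂ → ℂ) : X →L[ℂ] X :=
  open Classical in
  if h : ∃ L : X →L[ℂ] X, ∀ x, T.HillePhillips g x (L x) then h.choose else 0

section Calc

variable {T : C0Semigroup X} {K : ℝ} {Ω : Type*} [MeasurableSpace Ω] {μ : Measure Ω} {φ : Ω → ℂ}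
  {τ : Ω → ℝ} {g g' : ℂ → ℂ}

theorem BoundedBy.hpc_spec (hK : T.BoundedBy K) (hg : IsLap g) (x : X) :
    T.HillePhillips g x (T.hpc g x) := by
  obtain ⟨μ, φ, h⟩ := hg
  obtain ⟨L, hL, -⟩ := hK.exists_clm h.isRep
  have hex : ∃ L : X →L[ℂ] X, ∀ x, T.HillePhillips g x (L x) := ⟨L, fun x => ⟨μ, φ, h, hL x⟩⟩
  rw [hpc, dif_pos hex]
  exact hex.choose_spec x

/-- The value does not depend on the representing measure: uniqueness is applied to the bounded
continuous function `s ↦ T(max s 0)x`. -/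
theorem BoundedBy.hillePhillips_eq (hK : T.BoundedBy K) (hr : IsRep μ φ τ)
    (hg : ∀ z : ℂ, 0 < z.re → g z = ∫ ω, φ ω * Complex.exp (-(τ ω * z)) ∂μ) {x y : X}
    (h : T.HillePhillips g x y) : y = ∫ ω, φ ω • T.toFun (τ ω) x ∂μ := by
  obtain ⟨μ', φ', h', rfl⟩ := h
  rw [T.integral_max_id h'.isRep, T.integral_max hr]
  exact h'.isRep.unique hr (fun z hz => (h'.2.2.2 z hz).symm.trans (hg z hz)) (T.continuous_max x)
    (hK.norm_max_le x)

theorem BoundedBy.hpc_apply (hK : T.BoundedBy K) (hr : IsRep μ φ τ)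
    (hg : ∀ z : ℂ, 0 < z.re → g z = ∫ ω, φ ω * Complex.exp (-(τ ω * z)) ∂μ) (x : X) :
    T.hpc g x = ∫ ω, φ ω • T.toFun (τ ω) x ∂μ :=
  hK.hillePhillips_eq hr hg (hK.hpc_spec (hr.isLap hg) x)

theorem BoundedBy.hpc_apply_id (hK : T.BoundedBy K) {μ : Measure ℝ} {φ : ℝ → ℂ}
    (h : IsLaplaceTransformOf μ φ g) (x : X) : T.hpc g x = ∫ s, φ s • T.toFun s x ∂μ :=
  hK.hpc_apply h.isRep h.2.2.2 x

theorem BoundedBy.norm_hpc_le (hK : T.BoundedBy K) (hr : IsRep μ φ τ)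
    (hg : ∀ z : ℂ, 0 < z.re → g z = ∫ ω, φ ω * Complex.exp (-(τ ω * z)) ∂μ) :
    ‖T.hpc g‖ ≤ (∫ ω, ‖φ ω‖ ∂μ) * K := by
  obtain ⟨L, hL, hL'⟩ := hK.exists_clm hr
  have : T.hpc g = L := by
    ext x
    rw [hK.hpc_apply hr hg, hL]
  rwa [this]

theorem BoundedBy.hillePhillips_iff (hK : T.BoundedBy K) {x y : X} :
    T.HillePhillips g x y ↔ IsLap g ∧ y = T.hpc g x := by
  constructor
  · intro h
    obtain ⟨μ, φ, h1, h2⟩ := h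
    refine ⟨⟨μ, φ, h1⟩, ?_⟩
    rw [h2, hK.hpc_apply_id h1]
  · rintro ⟨h, rfl⟩
    exact hK.hpc_spec h x

theorem BoundedBy.hpc_congr (hK : T.BoundedBy K) (hg : IsLap g)
    (e : ∀ z : ℂ, 0 < z.re → g' z = g z) : T.hpc g' = T.hpc g := by
  obtain ⟨μ, φ, h⟩ := hg
  ext x
  rw [hK.hpc_apply_id h, hK.hpc_apply h.isRep fun z hz => (e z hz).trans (h.2.2.2 z hz)]
  rfl

theorem BoundedBy.hpc_const_mul (hK : T.BoundedBy K) (hg : IsLap g) (c : ℂ) :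
    T.hpc (fun z => c * g z) = c • T.hpc g := by
  obtain ⟨μ, φ, h⟩ := hg
  ext x
  rw [_root_.smul_apply, hK.hpc_apply_id h,
    hK.hpc_apply (h.isRep.const_mul c), ← integral_smul]
  · simp only [mul_smul, id]
  · intro z hz
    simp only [mul_assoc, integral_const_mul]
    rw [h.2.2.2 z hz]
    rfl

theorem BoundedBy.hpc_add (hK : T.BoundedBy K) (hg : IsLap g) (hg' : IsLap g') :
    T.hpc (fun z => g z + g' z) = T.hpc g + T.hpc g' := by
  obtain ⟨μ, φ, h⟩ := hg
  obtain ⟨μ', φ', h'⟩ := hg'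
  have := h.1
  have := h'.1
  have hs := IsLap.exists_add h h'
  ext x
  rw [_root_.add_apply, hK.hpc_apply_id h,
    hK.hpc_apply_id h', hK.hpc_apply_id hs, T.integral_max_id h.isRep,
    T.integral_max_id h'.isRep, T.integral_max_id hs.isRep]
  exact integral_addDensity h.isRep h'.isRep (T.continuous_max x) (hK.norm_max_le x)

theorem BoundedBy.hpc_one [CompleteSpace X] (hK : T.BoundedBy K) : T.hpc (fun _ => 1) = 1 := by
  ext x
  rw [hK.hpc_apply isRep_dirac fun z _ => by simp]
  simp [T.map_zero]

/-- The convolution integral splits by Fubini and `T(s + s') = T(s)T(s')`. -/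
theorem BoundedBy.hpc_mul [CompleteSpace X] (hK : T.BoundedBy K) (hg : IsLap g)
    (hg' : IsLap g') : T.hpc (fun z => g z * g' z) = T.hpc g * T.hpc g' := by
  obtain ⟨μ, φ, h⟩ := hg
  obtain ⟨μ', φ', h'⟩ := hg'
  have := h.1
  have := h'.1
  ext x
  have hr := h.isRep.mul h'.isRep
  change _ = T.hpc g (T.hpc g' x)
  rw [hK.hpc_apply_id h, hK.hpc_apply hr fun z hz => by
    rw [h.2.2.2 z hz, h'.2.2.2 z hz]
    exact (integral_exp_add_prod (τ := id) (τ' := id) z).symm]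
  rw [integral_prod _ (hK.integrable hr x)]
  refine integral_congr_ae ?_
  filter_upwards [h.isRep.nonneg] with s hs
  have e := (T.toFun s).integral_comp_comm (hK.integrable h'.isRep x)
  simp only [id] at e
  rw [hK.hpc_apply_id h', ← e, ← integral_smul]
  refine integral_congr_ae ?_
  filter_upwards [h'.isRep.nonneg] with s' hs'
  simp only [id] at *
  rw [T.map_add _ _ hs hs', map_smul, smul_smul]
  rfl

theorem BoundedBy.hpc_exp [CompleteSpace X] (hK : T.BoundedBy K) {t : ℝ} (ht : 0 ≤ t) :
    IsLap (fun z => Complex.exp (-(t * z))) ∧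
      T.hpc (fun z => Complex.exp (-(t * z))) = T.toFun t := by
  have hr : IsRep (Measure.dirac ()) (fun _ : Unit => (1 : ℂ)) (fun _ => t) :=
    ⟨integrable_const _, measurable_const, ae_of_all _ fun _ => ht⟩
  refine ⟨hr.isLap fun z _ => by simp, ?_⟩
  ext x
  rw [hK.hpc_apply hr fun z _ => by simp]
  simp

theorem BoundedBy.hpc_commute [CompleteSpace X] (hK : T.BoundedBy K) (hg : IsLap g)
    (hg' : IsLap g') : Commute (T.hpc g) (T.hpc g') := by
  rw [Commute, SemiconjBy, ← hK.hpc_mul hg hg', ← hK.hpc_mul hg' hg]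
  simp only [mul_comm]

theorem BoundedBy.hpc_commute_toFun [CompleteSpace X] (hK : T.BoundedBy K) (hg : IsLap g) {t : ℝ}
    (ht : 0 ≤ t) : Commute (T.hpc g) (T.toFun t) := by
  rw [← (hK.hpc_exp ht).2]
  exact hK.hpc_commute hg (hK.hpc_exp ht).1

end Calc

end C0Semigroup

/-! ### Gamma laws and negative powers of `1 + z` -/

open ProbabilityTheory in
/-- The standard Gamma distribution with shape parameter `a`. -/
abbrev stdGamma (a : ℝ) : Measure ℝ := gammaMeasure a 1

section Gamma

open ProbabilityTheory

variable {a : ℝ} {E : Type*} [NormedAddCommGroup E] [NormedSpace ℝ E]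

theorem isProbabilityMeasure_stdGamma (ha : 0 < a) : IsProbabilityMeasure (stdGamma a) :=
  isProbabilityMeasure_gammaMeasure ha one_pos

/-- The density of the standard Gamma distribution on `(0, ∞)`. -/
def gammaWeight (a s : ℝ) : ℝ := (Real.Gamma a)⁻¹ * (s ^ (a - 1) * Real.exp (-s))

theorem gammaPDFReal_one (s : ℝ) (hs : 0 ≤ s) : gammaPDFReal a 1 s = gammaWeight a s := by
  rw [gammaPDFReal, if_pos hs, gammaWeight, Real.one_rpow, one_mul, one_div, mul_assoc]

theorem stdGamma_eq : stdGamma a =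
    volume.withDensity (fun s => ENNReal.ofReal (gammaPDFReal a 1 s)) := rfl

theorem ae_nonneg_stdGamma : ∀ᵐ s ∂stdGamma a, 0 < s := by
  have h0 : ∀ᵐ s : ℝ, s ≠ 0 := by simp [ae_iff]
  rw [stdGamma_eq, ae_withDensity_iff (measurable_gammaPDFReal a 1).ennreal_ofReal]
  filter_upwards [h0] with s hs h
  by_contra hneg
  refine h ?_
  have : ¬ 0 ≤ s := fun h => hneg (lt_of_le_of_ne h hs.symm)
  rw [gammaPDFReal, if_neg this, ENNReal.ofReal_zero]

theorem integral_stdGamma (ha : 0 < a) (f : ℝ → E) :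
    ∫ s, f s ∂stdGamma a = ∫ s in Ioi 0, gammaWeight a s • f s := by
  rw [stdGamma_eq, integral_withDensity_eq_integral_toReal_smul
    (measurable_gammaPDFReal a 1).ennreal_ofReal (ae_of_all _ fun _ => ENNReal.ofReal_lt_top),
    ← integral_indicator measurableSet_Ioi]
  have h0 : ∀ᵐ s : ℝ, s ≠ 0 := by simp [ae_iff]
  refine integral_congr_ae ?_
  filter_upwards [h0] with s hs
  rw [ENNReal.toReal_ofReal (gammaPDFReal_nonneg ha one_pos s)]
  by_cases h : 0 < s
  · rw [indicator_of_mem (mem_Ioi.2 h), gammaPDFReal_one s h.le]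
  · rw [indicator_of_notMem (by simpa using h), gammaPDFReal,
      if_neg fun h' => h (lt_of_le_of_ne h' hs.symm), zero_smul]

theorem integrable_stdGamma_iff (ha : 0 < a) (f : ℝ → E) :
    Integrable f (stdGamma a) ↔ IntegrableOn (fun s => gammaWeight a s • f s) (Ioi 0) := by
  rw [stdGamma_eq, integrable_withDensity_iff_integrable_smul'
    (measurable_gammaPDFReal a 1).ennreal_ofReal (ae_of_all _ fun _ => ENNReal.ofReal_lt_top),
    ← integrable_indicator_iff measurableSet_Ioi]
  have h0 : ∀ᵐ s : ℝ, s ≠ 0 := by simp [ae_iff]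
  refine integrable_congr ?_
  filter_upwards [h0] with s hs
  rw [ENNReal.toReal_ofReal (gammaPDFReal_nonneg ha one_pos s)]
  by_cases h : 0 < s
  · rw [indicator_of_mem (mem_Ioi.2 h), gammaPDFReal_one s h.le]
  · rw [indicator_of_notMem (by simpa using h), gammaPDFReal,
      if_neg fun h' => h (lt_of_le_of_ne h' hs.symm), zero_smul]

theorem integrableOn_rpow_mul_exp (ha : 0 < a) {r : ℝ} (hr : 0 < r) :
    IntegrableOn (fun s => s ^ (a - 1) * Real.exp (-(r * s))) (Ioi 0) := by
  have := integrableOn_rpow_mul_exp_neg_mul_rpow (p := 1) (s := a - 1) (b := r) (by linarith)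
    one_pos hr
  simpa using this

theorem gammaWeight_smul_exp (x s : ℝ) :
    gammaWeight a s • Real.exp (x * s) =
      (Real.Gamma a)⁻¹ * (s ^ (a - 1) * Real.exp (-((1 - x) * s))) := by
  rw [gammaWeight, smul_eq_mul, mul_assoc, mul_assoc, ← Real.exp_add]
  ring_nf

theorem integrable_exp_stdGamma (ha : 0 < a) {x : ℝ} (hx : x < 1) :
    Integrable (fun s => Real.exp (x * s)) (stdGamma a) := by
  rw [integrable_stdGamma_iff ha]
  simp only [gammaWeight_smul_exp]
  exact (integrableOn_rpow_mul_exp ha (sub_pos.2 hx)).const_mul _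

theorem mgf_stdGamma (ha : 0 < a) {x : ℝ} (hx : x < 1) :
    mgf id (stdGamma a) x = (1 - x) ^ (-a) := by
  rw [mgf, integral_stdGamma ha]
  simp only [id, gammaWeight_smul_exp]
  rw [integral_const_mul, Real.integral_rpow_mul_exp_neg_mul_Ioi ha (sub_pos.2 hx), one_div,
    Real.inv_rpow (sub_pos.2 hx).le, Real.rpow_neg (sub_pos.2 hx).le]
  field_simp [(Real.Gamma_pos_of_pos ha).ne']

/-- Both sides, as functions of `w = -z`, are analytic on `Re w < 1`. The real moment generating
function gives equality at the points `-1/(k+1)`, which accumulate at `0`. -/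
theorem integral_exp_stdGamma (ha : 0 < a) {z : ℂ} (hz : 0 < z.re) :
    ∫ s : ℝ, Complex.exp (-(s * z)) ∂stdGamma a = (1 + z) ^ (-(a : ℂ)) := by
  set U : Set ℂ := {w | w.re < 1} with hU
  have hUo : IsOpen U := isOpen_lt Complex.continuous_re continuous_const
  have hUc : IsPreconnected U := (convex_halfSpace_re_lt 1).isPreconnected
  have h1 : AnalyticOnNhd ℂ (complexMGF id (stdGamma a)) U := by
    intro w hw
    refine analyticAt_complexMGF ?_
    refine mem_interior.2 ⟨Iio 1, fun x hx => ?_, isOpen_Iio, hw⟩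
    exact integrable_exp_stdGamma ha hx
  have h2 : AnalyticOnNhd ℂ (fun w : ℂ => (1 - w) ^ (-(a : ℂ))) U := by
    refine DifferentiableOn.analyticOnNhd (fun w hw => ?_) hUo
    refine (DifferentiableAt.cpow (by fun_prop) (by fun_prop) (Or.inl ?_)).differentiableWithinAt
    have : w.re < 1 := hw
    simpa using this
  have h3 := h1.eqOn_of_preconnected_of_frequently_eq h2 hUc (z₀ := 0) (by simp [hU]) ?_
  · have := h3 (x := -z) (by simp [hU]; linarith)
    simp only [complexMGF, sub_neg_eq_add, id] at this
    rw [← this]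
    simp only [neg_mul, mul_comm z]
  · have ht : Tendsto (fun k : ℕ => (((-(1 / ((k : ℝ) + 1)) : ℝ)) : ℂ)) atTop (𝓝[≠] 0) := by
      rw [tendsto_nhdsWithin_iff]
      constructor
      · have h1 := (tendsto_one_div_add_atTop_nhds_zero_nat (𝕜 := ℝ)).neg
        have := (Complex.continuous_ofReal.tendsto _).comp h1
        rwa [neg_zero, Complex.ofReal_zero] at this
      · refine Eventually.of_forall fun k => ?_
        have : -(1 / ((k : ℝ) + 1)) ≠ 0 := by
          have : (0 : ℝ) < 1 / ((k : ℝ) + 1) := by positivity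
          linarith
        exact Complex.ofReal_ne_zero.2 this
    refine ht.frequently (Frequently.of_forall fun k => ?_)
    have hk : -(1 / ((k : ℝ) + 1)) < 1 := by
      have : (0 : ℝ) < 1 / ((k : ℝ) + 1) := by positivity
      linarith
    rw [complexMGF_ofReal, mgf_stdGamma ha hk, Complex.ofReal_cpow (by linarith)]
    push_cast
    rfl

theorem isRep_stdGamma (ha : 0 < a) : IsRep (stdGamma a) (fun _ => 1) id := by
  have := isProbabilityMeasure_stdGamma ha
  exact ⟨integrable_const _, measurable_id, ae_nonneg_stdGamma.mono fun s hs => hs.le⟩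

theorem isLap_one_add_cpow_neg (ha : 0 ≤ a) : IsLap (fun z => (1 + z) ^ (-(a : ℂ))) := by
  rcases ha.eq_or_lt with rfl | ha
  · exact isLap_one.congr fun z _ => by simp
  · exact (isRep_stdGamma ha).isLap fun z hz => by
      simp only [one_mul, id, integral_exp_stdGamma ha hz]

end Gamma

/-! ### The binomial series and powers of `z/(1+z)` -/

section Binomial

/-- The coefficients of the power series of `(1 - w) ^ γ`. -/
def binomCoeff (γ : ℝ) (k : ℕ) : ℝ := (-1) ^ k * Ring.choose γ k

variable {γ : ℝ}

theorem binomCoeff_zero : binomCoeff γ 0 = 1 := by simp [binomCoeff]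

theorem binomCoeff_succ (k : ℕ) :
    (k + 1) * binomCoeff γ (k + 1) = binomCoeff γ k * (k - γ) := by
  have := Ring.choose_smul_choose γ (Nat.le_succ k)
  simp only [Nat.succ_eq_add_one, Nat.choose_succ_self_right, add_tsub_cancel_left,
    Ring.choose_one_right, nsmul_eq_mul] at this
  push_cast at this
  rw [binomCoeff, binomCoeff, pow_succ]
  linear_combination (-(-1) ^ k) * this

theorem binomCoeff_nonpos (h0 : 0 ≤ γ) (h1 : γ ≤ 1) (k : ℕ) : binomCoeff γ (k + 1) ≤ 0 := by
  induction k with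
  | zero =>
    have := binomCoeff_succ (γ := γ) 0
    rw [binomCoeff_zero] at this
    simp only [Nat.cast_zero, zero_add, one_mul, zero_sub] at this
    linarith
  | succ k ih =>
    have := binomCoeff_succ (γ := γ) (k + 1)
    push_cast at this
    have hk : (0 : ℝ) < k + 1 + 1 := by positivity
    have : (k + 1 + 1 : ℝ) * binomCoeff γ (k + 1 + 1) ≤ 0 := by
      rw [this]
      exact mul_nonpos_of_nonpos_of_nonneg ih (by
        have : (0 : ℝ) ≤ k := by positivity
        linarith)
    exact nonpos_of_mul_nonpos_right this hk

/-- The recursion telescopes. Since all coefficients after the first are nonpositive, it shows that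
the partial sums stay nonnegative, whence absolute summability. -/
theorem sum_binomCoeff (n : ℕ) :
    γ * ∑ k ∈ Finset.range (n + 1), binomCoeff γ k = -((n + 1) * binomCoeff γ (n + 1)) := by
  induction n with
  | zero =>
    have := binomCoeff_succ (γ := γ) 0
    rw [binomCoeff_zero] at this
    simp only [Nat.cast_zero] at this
    simp [binomCoeff_zero]
    linarith
  | succ n ih =>
    rw [Finset.sum_range_succ, mul_add, ih]
    have := binomCoeff_succ (γ := γ) (n + 1)
    push_cast at this ⊢
    linear_combination this

theorem summable_binomCoeff (h0 : 0 < γ) (h1 : γ ≤ 1) :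
    Summable (fun k => -binomCoeff γ (k + 1)) := by
  refine summable_of_sum_range_le (c := 1)
    (fun k => neg_nonneg.2 (binomCoeff_nonpos h0.le h1 k)) fun n => ?_
  have h := sum_binomCoeff (γ := γ) n
  rw [Finset.sum_range_succ', binomCoeff_zero] at h
  rw [Finset.sum_neg_distrib]
  have h2 : 0 ≤ -((n + 1 : ℝ) * binomCoeff γ (n + 1)) := by
    have := binomCoeff_nonpos h0.le h1 n
    have hn : (0 : ℝ) ≤ n + 1 := by positivity
    nlinarith
  rw [← h] at h2
  have := nonneg_of_mul_nonneg_right h2 h0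
  linarith

theorem hasSum_binomCoeff {w : ℂ} (hw : ‖w‖ < 1) :
    HasSum (fun k => (binomCoeff γ k : ℂ) * w ^ k) ((1 - w) ^ (γ : ℂ)) := by
  have h := (Complex.one_add_cpow_hasFPowerSeriesOnBall_zero (a := γ)).hasSum (y := -w)
    (by
      rw [← ENNReal.ofReal_one, Metric.eball_ofReal]
      simpa using hw)
  rw [zero_add, ← sub_eq_add_neg] at h
  have e : (fun k => (binomCoeff γ k : ℂ) * w ^ k) =
      fun k => (binomialSeries ℂ (γ : ℂ) k) fun _ => -w := by
    funext k
    rw [binomialSeries_apply]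
    simp [binomCoeff, neg_pow w, Complex.ofReal_choose]
    ring
  rw [e]
  exact h

/-- Expand in powers of `w = (1+z)⁻¹`. Each `wᵏ` with `k ≥ 1` is the transform of a Gamma law of
shape `k`, and the coefficients are nonpositive and summable, so the function is `1` minus the
transform of a finite positive mixture. -/
theorem isLap_one_sub_cpow (h0 : 0 < γ) (h1 : γ ≤ 1) :
    IsLap (fun z => (1 - (1 + z)⁻¹) ^ (γ : ℂ)) := by
  set μ : Measure ℝ := Measure.sum
    (fun k : ℕ => ENNReal.ofReal (-binomCoeff γ (k + 1)) • stdGamma ((k + 1 : ℕ) : ℝ)) with hμ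
  have hpos : ∀ k : ℕ, (0 : ℝ) < ((k + 1 : ℕ) : ℝ) := fun k => by positivity
  have hfin : IsFiniteMeasure μ := by
    refine ⟨?_⟩
    rw [hμ, Measure.sum_apply _ MeasurableSet.univ]
    have : ∀ k : ℕ, (ENNReal.ofReal (-binomCoeff γ (k + 1)) • stdGamma ((k + 1 : ℕ) : ℝ)) univ =
        ENNReal.ofReal (-binomCoeff γ (k + 1)) := fun k => by
      have := isProbabilityMeasure_stdGamma (hpos k)
      rw [Measure.smul_apply, measure_univ, smul_eq_mul, mul_one]
    simp only [this]
    exact (summable_binomCoeff h0 h1).tsum_ofReal_lt_top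
  have hnn : ∀ᵐ s ∂μ, 0 ≤ s := by
    rw [hμ, Measure.ae_sum_iff]
    intro k
    exact Measure.ae_smul_measure (ae_nonneg_stdGamma.mono fun s hs => hs.le) _
  have hr : IsRep μ (fun _ => 1) id := ⟨integrable_const _, measurable_id, hnn⟩
  have hint : ∀ z : ℂ, 0 < z.re →
      1 - (1 - (1 + z)⁻¹) ^ (γ : ℂ) = ∫ s, (1 : ℂ) * Complex.exp (-((id s : ℝ) * z)) ∂μ := by
    intro z hz
    have hz1 : 1 + z ≠ 0 := fun h => by
      have := congrArg Complex.re h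
      simp at this
      linarith
    have hw : ‖(1 + z)⁻¹‖ < 1 := by
      rw [norm_inv]
      refine inv_lt_one_of_one_lt₀ (lt_of_lt_of_le ?_ (Complex.re_le_norm _))
      simpa using hz
    have hs := (hasSum_nat_add_iff' 1).2 (hasSum_binomCoeff (γ := γ) hw)
    simp only [Finset.range_one, Finset.sum_singleton, binomCoeff_zero, pow_zero, mul_one,
      Complex.ofReal_one] at hs
    have hi : Integrable (fun s : ℝ => (1 : ℂ) * Complex.exp (-((id s : ℝ) * z))) μ := by
      refine Integrable.of_bound (Continuous.aestronglyMeasurable (by simp only [id]; fun_prop)) 1 ?_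
      filter_upwards [hnn] with s hs
      have := norm_exp_neg_max_mul_le hz s
      rwa [max_eq_left hs, ← one_mul (Complex.exp _)] at this
    have h2 := hasSum_integral_measure hi
    refine (neg_sub _ (1 : ℂ)).symm.trans (HasSum.unique hs.neg ?_)
    convert h2 using 2 with k
    rw [integral_smul_measure]
    simp only [one_mul, id]
    rw [integral_exp_stdGamma (hpos k) hz, ENNReal.toReal_ofReal
      (neg_nonneg.2 (binomCoeff_nonpos h0.le h1 k)), Complex.ofReal_natCast, Complex.cpow_neg,
      Complex.cpow_natCast, inv_pow, Complex.real_smul]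
    push_cast
    ring
  refine (isLap_one.add ((hr.isLap hint).const_mul (-1))).congr fun z hz => ?_
  ring

end Binomial

/-! ### The symbols of regularized fractional powers -/

section FractionalPowers

theorem one_add_ne_zero_of_re_pos {z : ℂ} (hz : 0 < z.re) : 1 + z ≠ 0 := fun h => by
  have := congrArg Complex.re h
  simp at this
  linarith

theorem ne_zero_of_re_pos {z : ℂ} (hz : 0 < z.re) : z ≠ 0 := fun h => by
  rw [h] at hz
  simp at hz

theorem abs_arg_lt_of_re_pos {z : ℂ} (hz : 0 < z.re) : |z.arg| < Real.pi / 2 :=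
  Complex.abs_arg_lt_pi_div_two_iff.2 (Or.inl hz)

theorem one_sub_inv_one_add {z : ℂ} (hz : 0 < z.re) : 1 - (1 + z)⁻¹ = z * (1 + z)⁻¹ := by
  field_simp [one_add_ne_zero_of_re_pos hz]
  ring

theorem one_sub_inv_cpow (γ : ℂ) {z : ℂ} (hz : 0 < z.re) :
    (1 - (1 + z)⁻¹) ^ γ = (1 + z) ^ (-γ) * z ^ γ := by
  have h1 := one_add_ne_zero_of_re_pos hz
  have h0 := ne_zero_of_re_pos hz
  have hu0 : 1 - (1 + z)⁻¹ ≠ 0 := by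
    rw [one_sub_inv_one_add hz]
    exact mul_ne_zero h0 (inv_ne_zero h1)
  have hure : 0 < (1 - (1 + z)⁻¹).re := by
    have hw : ‖(1 + z)⁻¹‖ < 1 := by
      rw [norm_inv]
      refine inv_lt_one_of_one_lt₀ (lt_of_lt_of_le ?_ (Complex.re_le_norm _))
      simpa using hz
    have := (Complex.re_le_norm _).trans_lt hw
    simpa using this
  have hmul : z = (1 - (1 + z)⁻¹) * (1 + z) := by
    rw [one_sub_inv_one_add hz, mul_assoc, inv_mul_cancel₀ h1, mul_one]
  -- Both factors have positive real part, so their arguments add up without crossing the branch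
  -- cut.
  have hlog : Complex.log z = Complex.log (1 - (1 + z)⁻¹) + Complex.log (1 + z) := by
    conv_lhs => rw [hmul]
    refine Complex.log_mul hu0 h1 ?_
    have ha := abs_lt.1 (abs_arg_lt_of_re_pos hure)
    have hb := abs_lt.1 (abs_arg_lt_of_re_pos (z := 1 + z) (by simp; linarith))
    constructor <;> linarith
  rw [Complex.cpow_def_of_ne_zero hu0, Complex.cpow_def_of_ne_zero h1,
    Complex.cpow_def_of_ne_zero h0, ← Complex.exp_add, hlog]
  ring_nf

theorem IsLap.pow {g : ℂ → ℂ} (h : IsLap g) (n : ℕ) : IsLap (fun z => g z ^ n) := by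
  induction n with
  | zero => exact isLap_one.congr fun z _ => by simp
  | succ n ih => exact (ih.mul h).congr fun z _ => pow_succ _ _

theorem isLap_one_add_cpow_neg_mul_cpow {β : ℝ} (hβ : 0 ≤ β) :
    IsLap (fun z => (1 + z) ^ (-(β : ℂ)) * z ^ (β : ℂ)) := by
  rcases hβ.eq_or_lt with rfl | hβ
  · exact isLap_one.congr fun z _ => by simp
  -- The binomial argument covers exponents in `(0, 1]`; a general one is the `N`-th power of the
  -- case `β/N`.
  set N : ℕ := ⌈β⌉₊ with hN
  have hN0 : (0 : ℝ) < N := by exact_mod_cast Nat.ceil_pos.2 hβ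
  have hle : β / N ≤ 1 := (div_le_one hN0).2 (Nat.le_ceil β)
  refine ((isLap_one_sub_cpow (div_pos hβ hN0) hle).pow N).congr fun z hz => ?_
  rw [← Complex.cpow_mul_nat, ← one_sub_inv_cpow _ hz]
  congr 1
  push_cast
  field_simp [Complex.ofReal_ne_zero.2 hN0.ne']
  rw [mul_div_cancel_right₀ _ (by exact_mod_cast hN0.ne')]

theorem isLap_cpow_mul_inv_pow {β : ℝ} (hβ : 0 ≤ β) {n : ℕ} (hn : β ≤ n) :
    IsLap (fun z => z ^ (β : ℂ) * ((1 + z)⁻¹) ^ n) := by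
  refine ((isLap_one_add_cpow_neg_mul_cpow hβ).mul
    (isLap_one_add_cpow_neg (sub_nonneg.2 hn))).congr fun z hz => ?_
  have h1 := one_add_ne_zero_of_re_pos hz
  rw [mul_right_comm, ← Complex.cpow_add _ _ h1, mul_comm, inv_pow, ← Complex.cpow_natCast,
    ← Complex.cpow_neg]
  congr 2
  push_cast
  ring

theorem ofReal_mul_cpow {t : ℝ} (ht : 0 < t) {z : ℂ} (hz : z ≠ 0) (β : ℝ) :
    ((t : ℂ) * z) ^ (β : ℂ) = ((t ^ β : ℝ) : ℂ) * z ^ (β : ℂ) := by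
  have ht' : (t : ℂ) ≠ 0 := Complex.ofReal_ne_zero.2 ht.ne'
  rw [Complex.cpow_def_of_ne_zero (mul_ne_zero ht' hz), Complex.log_ofReal_mul ht hz, add_mul,
    Complex.exp_add, ← Complex.cpow_def_of_ne_zero hz, Complex.ofReal_cpow ht.le,
    Complex.cpow_def_of_ne_zero ht', Complex.ofReal_log ht.le]

theorem IsRep.integral_exp_scale {Ω : Type*} [MeasurableSpace Ω] {μ : Measure Ω} {φ : Ω → ℂ}
    {τ : Ω → ℝ} {g : ℂ → ℂ}
    (hg : ∀ z : ℂ, 0 < z.re → g z = ∫ ω, φ ω * Complex.exp (-(τ ω * z)) ∂μ) {c : ℝ} (hc : 0 < c)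
    (z : ℂ) (hz : 0 < z.re) :
    g (c * z) = ∫ ω, φ ω * Complex.exp (-(((c * τ ω : ℝ) : ℂ) * z)) ∂μ := by
  rw [hg _ (by simpa using mul_pos hc hz)]
  refine integral_congr_ae (ae_of_all _ fun ω => ?_)
  simp only [Complex.ofReal_mul]
  ring_nf

theorem IsLap.scale {g : ℂ → ℂ} (h : IsLap g) {t : ℝ} (ht : 0 < t) :
    IsLap (fun z => g (t * z)) := by
  obtain ⟨μ, φ, h⟩ := h
  exact (h.isRep.scale ht.le).isLap fun z hz =>
    IsRep.integral_exp_scale (τ := id) h.2.2.2 ht z hz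

theorem cpow_mul_inv_pow_scale {β t : ℝ} (ht : 0 < t) (n : ℕ) {z : ℂ} (hz : 0 < z.re) :
    z ^ (β : ℂ) * ((1 + t * z)⁻¹) ^ n =
      ((t ^ (-β) : ℝ) : ℂ) * ((t * z) ^ (β : ℂ) * ((1 + t * z)⁻¹) ^ n) := by
  rw [ofReal_mul_cpow ht (ne_zero_of_re_pos hz), ← mul_assoc, ← mul_assoc, ← Complex.ofReal_mul,
    ← Real.rpow_add ht, neg_add_cancel, Real.rpow_zero, Complex.ofReal_one, one_mul]

theorem isLap_cpow_mul_inv_pow_scale {β : ℝ} (hβ : 0 ≤ β) {n : ℕ} (hn : β ≤ n) {t : ℝ}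
    (ht : 0 < t) : IsLap (fun z => z ^ (β : ℂ) * ((1 + t * z)⁻¹) ^ n) :=
  (((isLap_cpow_mul_inv_pow hβ hn).scale ht).const_mul _).congr fun _ hz =>
    cpow_mul_inv_pow_scale ht n hz

theorem isLap_inv_one_add {t : ℝ} (ht : 0 < t) : IsLap (fun z => (1 + t * z)⁻¹) := by
  simpa using isLap_cpow_mul_inv_pow_scale le_rfl (n := 1) (by simp) ht

end FractionalPowers

namespace C0Semigroup

variable {X : Type u} [NormedAddCommGroup X] [NormedSpace ℂ X] {T : C0Semigroup X} {K : ℝ}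

/-- Dilating a measure preserves its total variation; the factor `t^(-β)` comes from writing `z^β`
as `t^(-β)(tz)^β`. -/
theorem BoundedBy.exists_norm_hpc_scale_le (hK : T.BoundedBy K) {β : ℝ} (hβ : 0 ≤ β) {n : ℕ}
    (hn : β ≤ n) : ∃ V : ℝ, ∀ t : ℝ, 0 < t →
      ‖T.hpc (fun z => z ^ (β : ℂ) * ((1 + t * z)⁻¹) ^ n)‖ ≤ t ^ (-β) * V := by
  obtain ⟨μ, φ, h⟩ := isLap_cpow_mul_inv_pow hβ hn
  refine ⟨(∫ s, ‖φ s‖ ∂μ) * K, fun t ht => ?_⟩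
  have hl := (isLap_cpow_mul_inv_pow hβ hn).scale ht
  rw [hK.hpc_congr (hl.const_mul ((t ^ (-β) : ℝ) : ℂ)) fun z hz => cpow_mul_inv_pow_scale ht n hz,
    hK.hpc_const_mul hl, norm_smul, Complex.norm_real, Real.norm_of_nonneg (Real.rpow_nonneg ht.le _)]
  gcongr
  exact hK.norm_hpc_le (h.isRep.scale ht.le) fun z hz =>
    IsRep.integral_exp_scale (τ := id) (h.2.2.2) ht z hz

end C0Semigroup

/-! ### The generator and its resolvent -/

namespace C0Semigroup

variable {X : Type u} [NormedAddCommGroup X] [NormedSpace ℂ X] {T : C0Semigroup X} {K : ℝ}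

theorem hasNegDeriv_of_hasDerivAt {u : ℝ → X} {x y : X} (hu : HasDerivAt u y 0)
    (h : ∀ t : ℝ, 0 ≤ t → u t = T.toFun t x) : T.HasNegDeriv x (-y) := by
  have h1 := (hasDerivAt_iff_tendsto_slope_zero.1 hu).mono_left
    (nhdsWithin_mono _ fun t (ht : t ∈ Ioi (0 : ℝ)) => (ne_of_gt ht : t ≠ 0))
  refine h1.neg.congr' ?_
  filter_upwards [self_mem_nhdsWithin] with t ht
  rw [zero_add, h t (le_of_lt ht), h 0 le_rfl, T.map_zero, ← smul_neg, neg_sub,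
    ← Complex.ofReal_inv, Complex.coe_smul]
  rfl

theorem HasNegDeriv.mem_domain {x y : X} (h : T.HasNegDeriv x y) : x ∈ T.negGenerator.domain :=
  ⟨y, h⟩

theorem HasNegDeriv.negGenerator_eq {x y : X} (h : T.HasNegDeriv x y) :
    T.negGenerator ⟨x, h.mem_domain⟩ = y :=
  HasNegDeriv.unique (T := T) (Exists.choose_spec (h.mem_domain : ∃ y, T.HasNegDeriv x y)) h

theorem hasNegDeriv_negGenerator (x : T.negGenerator.domain) :
    T.HasNegDeriv x (T.negGenerator x) :=
  Exists.choose_spec x.2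

theorem HasNegDeriv.map {x y : X} (h : T.HasNegDeriv x y) {L : X →L[ℂ] X}
    (hL : ∀ t : ℝ, 0 ≤ t → Commute L (T.toFun t)) : T.HasNegDeriv (L x) (L y) := by
  refine ((L.continuous.tendsto y).comp h).congr' ?_
  filter_upwards [self_mem_nhdsWithin] with t ht
  have : L (T.toFun t x) = T.toFun t (L x) := congrArg (fun S : X →L[ℂ] X => S x)
    (hL t (le_of_lt ht)).eq
  rw [Function.comp_apply, map_smul, map_sub, this]

/-- The resolvent `(1 + c A)⁻¹`. -/
def resolvent (T : C0Semigroup X) (c : ℝ) : X →L[ℂ] X := T.hpc (fun z => (1 + c * z)⁻¹)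

theorem inv_one_add_pow_eq_integral {c : ℝ} (hc : 0 < c) {n : ℕ} (hn : 1 ≤ n) {z : ℂ}
    (hz : 0 < z.re) : ((1 + c * z)⁻¹) ^ n =
      ∫ s, (1 : ℂ) * Complex.exp (-(((c * id s : ℝ) : ℂ) * z)) ∂stdGamma (n : ℝ) := by
  have hn' : (0 : ℝ) < n := by exact_mod_cast hn
  refine IsRep.integral_exp_scale (τ := id) (g := fun z => ((1 + z)⁻¹) ^ n) (fun z hz => ?_) hc z hz
  simp only [one_mul, id]
  rw [integral_exp_stdGamma hn' hz, Complex.ofReal_natCast, Complex.cpow_neg,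
    Complex.cpow_natCast, inv_pow]

theorem BoundedBy.hpc_inv_one_add_pow [CompleteSpace X] (hK : T.BoundedBy K) {c : ℝ} (hc : 0 < c)
    (n : ℕ) : T.hpc (fun z => ((1 + c * z)⁻¹) ^ n) = T.resolvent c ^ n := by
  induction n with
  | zero => simpa using hK.hpc_one
  | succ n ih =>
    simp only [pow_succ]
    rw [hK.hpc_mul ((isLap_inv_one_add hc).pow n) (isLap_inv_one_add hc), ih]
    rfl

theorem BoundedBy.resolvent_pow_apply [CompleteSpace X] (hK : T.BoundedBy K) {c : ℝ} (hc : 0 < c)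
    {n : ℕ} (hn : 1 ≤ n) (x : X) :
    (T.resolvent c ^ n) x = ∫ s, T.toFun (c * s) x ∂stdGamma (n : ℝ) := by
  have hn' : (0 : ℝ) < n := by exact_mod_cast hn
  rw [← hK.hpc_inv_one_add_pow hc, hK.hpc_apply ((isRep_stdGamma hn').scale hc.le) fun z hz =>
    inv_one_add_pow_eq_integral hc hn hz]
  simp

theorem BoundedBy.integrable_stdGamma (hK : T.BoundedBy K) {c : ℝ} (hc : 0 < c)
    {n : ℕ} (hn : 1 ≤ n) (x : X) : Integrable (fun s => T.toFun (c * s) x) (stdGamma (n : ℝ)) := by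
  have hn' : (0 : ℝ) < n := by exact_mod_cast hn
  simpa using hK.integrable ((isRep_stdGamma hn').scale hc.le) x

theorem BoundedBy.hasNegDeriv_resolvent [CompleteSpace X] (hK : T.BoundedBy K) {c : ℝ} (hc : 0 < c)
    (x : X) : T.HasNegDeriv (T.resolvent c x) (((c⁻¹ : ℝ) : ℂ) • (x - T.resolvent c x)) := by
  set f : ℝ → X := fun s => Real.exp (-s) • T.toFun (max (c * s) 0) x with hf
  have hfc : Continuous f :=
    (by fun_prop : Continuous fun s : ℝ => Real.exp (-s)).smul
      ((T.continuous_max x).comp (by fun_prop : Continuous fun s => c * s))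
  have hw : ∀ s : ℝ, gammaWeight ((1 : ℕ) : ℝ) s = Real.exp (-s) := fun s => by
    simp [gammaWeight]
  have hfI : IntegrableOn f (Ioi 0) := by
    have := (integrable_stdGamma_iff (by norm_num) _).1 (hK.integrable_stdGamma hc le_rfl x)
    refine this.congr_fun (fun s hs => ?_) measurableSet_Ioi
    simp only [hw, hf, max_eq_left (mul_pos hc (mem_Ioi.1 hs)).le]
  have hR : T.resolvent c x = ∫ s in Ioi 0, f s := by
    rw [← pow_one (T.resolvent c), hK.resolvent_pow_apply hc le_rfl, integral_stdGamma (by norm_num)]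
    refine setIntegral_congr_fun measurableSet_Ioi fun s hs => ?_
    simp only [hw, hf, max_eq_left (mul_pos hc (mem_Ioi.1 hs)).le]
  set G : ℝ → X := fun a => ∫ s in (0 : ℝ)..a, f s with hG
  have hGd : HasDerivAt G (f 0) 0 :=
    intervalIntegral.integral_hasDerivAt_right (by simp)
      (hfc.stronglyMeasurableAtFilter _ _) hfc.continuousAt
  have hf0 : f 0 = x := by simp [hf, T.map_zero]
  -- Shifting the variable in `∫₀^∞ e^(-s) T(cs)x ds` shows that `T(h)` applied to it is `u(h)` for
  -- `h ≥ 0`. The formula makes sense for negative `h` too, so a two-sided derivative at `0` can be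
  -- taken.
  set u : ℝ → X := fun h => Real.exp (c⁻¹ * h) • (T.resolvent c x - G (c⁻¹ * h)) with hu
  have hlin : HasDerivAt (fun h : ℝ => c⁻¹ * h) c⁻¹ 0 := by
    simpa using (hasDerivAt_id (0 : ℝ)).const_mul c⁻¹
  have hud : HasDerivAt u (c⁻¹ • (T.resolvent c x - x)) 0 := by
    have h1 : HasDerivAt (fun h => Real.exp (c⁻¹ * h)) c⁻¹ 0 := by
      simpa using hlin.exp
    have h2 : HasDerivAt (fun h => G (c⁻¹ * h)) (c⁻¹ • x) 0 := by
      rw [← hf0]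
      have : HasDerivAt G (f 0) (c⁻¹ * 0) := by simpa using hGd
      exact HasDerivAt.scomp 0 this hlin
    have h3 := h1.smul (h2.const_sub (T.resolvent c x))
    refine h3.congr_deriv ?_
    have hG0 : G 0 = 0 := by simp [hG]
    simp only [mul_zero, Real.exp_zero, one_smul, hG0, sub_zero]
    rw [smul_sub]
    abel
  have := hasNegDeriv_of_hasDerivAt (T := T) (x := T.resolvent c x) hud fun h hh => ?_
  · convert this using 1
    rw [Complex.coe_smul, ← smul_neg, neg_sub]
  · have hb : 0 ≤ c⁻¹ * h := by positivity
    have e1 : T.resolvent c x - G (c⁻¹ * h) = ∫ s in Ioi (c⁻¹ * h), f s := by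
      rw [hR, hG, sub_eq_iff_eq_add', intervalIntegral.integral_interval_add_Ioi hfI
        (hfI.mono_set (Ioi_subset_Ioi hb))]
    have e2 : ∫ s in Ioi (c⁻¹ * h), f s = ∫ s in Ioi 0, f (s + c⁻¹ * h) := by
      rw [← (measurePreserving_add_right volume (c⁻¹ * h)).setIntegral_preimage_emb
        (measurableEmbedding_addRight _)]
      congr 2
      ext s
      simp
    simp only [hu]
    rw [e1, e2, ← integral_smul, hR, ← ContinuousLinearMap.integral_comp_comm _ hfI]
    refine setIntegral_congr_fun measurableSet_Ioi fun s hs => ?_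
    have hs : 0 < s := hs
    have hcs : 0 ≤ c * s := by positivity
    have e3 : c * (s + c⁻¹ * h) = h + c * s := by field_simp; ring
    simp only [hf]
    rw [e3, max_eq_left hcs, max_eq_left (add_nonneg hh hcs), T.map_add _ _ hh hcs, smul_smul,
      ← Real.exp_add, ← Complex.coe_smul (Real.exp (-s)), map_smul, Complex.coe_smul]
    have e5 : c⁻¹ * h + -(s + c⁻¹ * h) = -s := by ring
    simp only [e5]
    rfl

theorem BoundedBy.resolvent_commute [CompleteSpace X] (hK : T.BoundedBy K) {c : ℝ} (hc : 0 < c)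
    {t : ℝ} (ht : 0 ≤ t) : Commute (T.resolvent c) (T.toFun t) :=
  hK.hpc_commute_toFun (isLap_inv_one_add hc) ht

/-- `(1 + c A)⁻¹ (x + c A x) = x`. -/
theorem BoundedBy.resolvent_add_smul [CompleteSpace X] (hK : T.BoundedBy K) {c : ℝ} (hc : 0 < c)
    {x y : X} (h : T.HasNegDeriv x y) : T.resolvent c (x + (c : ℂ) • y) = x := by
  -- With `R` the resolvent, `ARx` is computed twice: as `RAx`, since `R` commutes with the
  -- semigroup, and as `c⁻¹(x - Rx)`.
  have h1 := h.map fun t ht => hK.resolvent_commute hc ht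
  have h2 := h1.unique (hK.hasNegDeriv_resolvent hc x)
  rw [_root_.map_add, map_smul, h2, smul_smul, ← Complex.ofReal_mul, mul_inv_cancel₀ hc.ne',
    Complex.ofReal_one, one_smul, add_sub_cancel]

theorem BoundedBy.isInvOneAdd [CompleteSpace X] (hK : T.BoundedBy K) {c : ℝ} (hc : 0 < c) :
    IsInvOneAdd T.negGenerator c (T.resolvent c) := by
  constructor
  · intro x
    have h := hK.hasNegDeriv_resolvent hc x
    refine ⟨h.mem_domain, ?_⟩
    rw [h.negGenerator_eq, smul_smul, ← Complex.ofReal_mul, mul_inv_cancel₀ hc.ne',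
      Complex.ofReal_one, one_smul, add_sub_cancel]
  · intro x
    exact hK.resolvent_add_smul hc (hasNegDeriv_negGenerator x)

theorem BoundedBy.resolvent_injective [CompleteSpace X] (hK : T.BoundedBy K) {c : ℝ} (hc : 0 < c) :
    Function.Injective (T.resolvent c) := by
  refine (injective_iff_map_eq_zero _).2 fun x hx => ?_
  have h := hK.hasNegDeriv_resolvent hc x
  rw [hx, sub_zero] at h
  have h2 := h.unique T.hasNegDeriv_zero
  exact (smul_eq_zero.1 h2).resolve_left (by exact_mod_cast (inv_pos.2 hc).ne')

theorem BoundedBy.resolvent_pow_injective [CompleteSpace X] (hK : T.BoundedBy K) {c : ℝ}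
    (hc : 0 < c) (n : ℕ) : Function.Injective (T.resolvent c ^ n) := by
  induction n with
  | zero => exact fun x y h => h
  | succ n ih =>
    rw [pow_succ]
    exact ih.comp (hK.resolvent_injective hc)

/-- The operator `A (1 + A)⁻¹` of the calculus is `1 - (1 + A)⁻¹`. -/
theorem BoundedBy.hpc_mul_inv_pow [CompleteSpace X] (hK : T.BoundedBy K) (n : ℕ) :
    IsLap (fun z => (z * (1 + z)⁻¹) ^ n) ∧
      T.hpc (fun z => (z * (1 + z)⁻¹) ^ n) = (1 - T.resolvent 1) ^ n := by
  have hl1 : IsLap (fun z => (1 + ((1 : ℝ) : ℂ) * z)⁻¹) := isLap_inv_one_add one_pos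
  have hs := isLap_one.add (hl1.const_mul (-1))
  have hc : ∀ z : ℂ, 0 < z.re →
      z * (1 + z)⁻¹ = 1 + -1 * (1 + ((1 : ℝ) : ℂ) * z)⁻¹ := fun z hz => by
    rw [← one_sub_inv_one_add hz, Complex.ofReal_one, one_mul]
    ring
  have h1 : IsLap (fun z => z * (1 + z)⁻¹) := hs.congr hc
  have e1 : T.hpc (fun z => z * (1 + z)⁻¹) = 1 - T.resolvent 1 := by
    rw [hK.hpc_congr hs hc, hK.hpc_add isLap_one (hl1.const_mul (-1)), hK.hpc_one,
      hK.hpc_const_mul hl1, neg_one_smul, ← sub_eq_add_neg]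
    rfl
  refine ⟨h1.pow n, ?_⟩
  induction n with
  | zero => simpa using hK.hpc_one
  | succ n ih =>
    simp only [pow_succ]
    rw [hK.hpc_mul (h1.pow n) h1, ih, e1]

end C0Semigroup

/-! ### Bounded analytic semigroups and the operators `AᵏT(t)` -/

open scoped ContDiff

theorem re_pos_of_mem_openSector {θ : ℝ} (hθ : θ ≤ Real.pi / 2) {z : ℂ} (hz : z ∈ openSector θ) :
    0 < z.re :=
  (Complex.abs_arg_lt_pi_div_two_iff.1 (hz.2.trans_le hθ)).resolve_right hz.1

theorem isOpen_openSector {θ : ℝ} (hθ : θ ≤ Real.pi / 2) : IsOpen (openSector θ) := by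
  refine isOpen_iff_mem_nhds.2 fun z hz => ?_
  have hs : z ∈ Complex.slitPlane := Or.inl (re_pos_of_mem_openSector hθ hz)
  filter_upwards [isOpen_ne.mem_nhds hz.1,
    (Complex.continuousAt_arg hs).abs.eventually (Iio_mem_nhds hz.2)] with w h1 h2
  exact ⟨h1, h2⟩

theorem ofReal_mem_openSector {θ : ℝ} (hθ : 0 < θ) {t : ℝ} (ht : 0 < t) :
    (t : ℂ) ∈ openSector θ :=
  ⟨Complex.ofReal_ne_zero.2 ht.ne', by rwa [Complex.arg_ofReal_of_nonneg ht.le, abs_zero]⟩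

theorem ofReal_mul_mem_openSector {θ : ℝ} {t : ℝ} (ht : 0 < t) {z : ℂ} (hz : z ∈ openSector θ) :
    (t : ℂ) * z ∈ openSector θ :=
  ⟨mul_ne_zero (Complex.ofReal_ne_zero.2 ht.ne') hz.1, by rw [Complex.arg_real_mul _ ht]; exact hz.2⟩

theorem zero_mem_closure_openSector {θ : ℝ} (hθ : 0 < θ) : (0 : ℂ) ∈ closure (openSector θ) := by
  have h : Tendsto (fun t : ℝ => (t : ℂ)) (𝓝[>] 0) (𝓝 0) :=
    (Complex.continuous_ofReal.tendsto' 0 0 Complex.ofReal_zero).mono_left nhdsWithin_le_nhds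
  exact mem_closure_of_tendsto h
    (eventually_nhdsWithin_of_forall fun t ht => ofReal_mem_openSector hθ ht)

namespace C0Semigroup

variable {X : Type u} [NormedAddCommGroup X] [NormedSpace ℂ X] {T : C0Semigroup X} {K : ℝ}

/-- The operator `A ^ k T(t)`, as a derivative of the semigroup. -/
def genPow (T : C0Semigroup X) (k : ℕ) (t : ℝ) : X →L[ℂ] X :=
  (-1 : ℝ) ^ k • iteratedDeriv k T.toFun t

/-- `T` is bounded by `K`, smooth on `(0, ∞)` in operator norm, and `‖t A T(t)‖ ≤ C`. -/
structure IsBoundedAnalytic (T : C0Semigroup X) (K C : ℝ) : Prop where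
  bound : T.BoundedBy K
  contDiffAt : ∀ t : ℝ, 0 < t → ContDiffAt ℝ ∞ T.toFun t
  norm_genPow_one_le : ∀ t : ℝ, 0 < t → t * ‖T.genPow 1 t‖ ≤ C

theorem genPow_zero (t : ℝ) : T.genPow 0 t = T.toFun t := by simp [genPow]

/-- Sectors are invariant under dilation, so a disc of radius `r` about `1` scales to one of radius
`rt` about `t`. Cauchy's estimate there gives `‖AT(t)‖ ≤ K/(rt)`. -/
theorem IsSectoriallyBoundedHolomorphic.exists_isBoundedAnalytic [CompleteSpace X]
    (hT : T.IsSectoriallyBoundedHolomorphic) : ∃ K C : ℝ, T.IsBoundedAnalytic K C := by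
  obtain ⟨θ, hθ0, hθ, S, hS, hd, hb⟩ := hT
  set ξ := θ / 2 with hξ
  have hξ0 : 0 < ξ := by positivity
  have hξθ : ξ < θ := by rw [hξ]; linarith
  obtain ⟨⟨K, hK⟩, -⟩ := hb ξ hξ0 hξθ
  have hopen : IsOpen (openSector θ) := isOpen_openSector hθ
  have hsub : openSector ξ ⊆ openSector θ := fun z hz => ⟨hz.1, hz.2.trans hξθ⟩
  have hev : ∀ t : ℝ, 0 < t → T.toFun =ᶠ[𝓝 t] fun s : ℝ => S (s : ℂ) := fun t ht => by
    filter_upwards [lt_mem_nhds ht] with s hs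
    exact (hS s hs.le).symm
  have hbK : T.BoundedBy K := fun t ht => by
    rw [← hS t ht]
    refine hK _ ?_
    rcases ht.eq_or_lt with rfl | ht
    · simpa using zero_mem_closure_openSector hξ0
    · exact subset_closure (ofReal_mem_openSector hξ0 ht)
  have h1 : openSector ξ ∈ 𝓝 (1 : ℂ) := (isOpen_openSector (hξθ.le.trans hθ)).mem_nhds (by
    simpa using ofReal_mem_openSector hξ0 one_pos)
  obtain ⟨r, hr, hball⟩ := Metric.nhds_basis_closedBall.mem_iff.1 h1
  refine ⟨K, K / r, hbK, fun t ht => ?_, fun t ht => ?_⟩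
  · have hA : ContDiffAt ℂ ∞ S (t : ℂ) :=
      (hd.analyticAt (hopen.mem_nhds (ofReal_mem_openSector hθ0 ht))).contDiffAt
    have h2 : ContDiffAt ℝ ∞ (fun s : ℝ => S (s : ℂ)) t :=
      (hA.restrict_scalars ℝ).comp t Complex.ofRealCLM.contDiff.contDiffAt
    exact h2.congr_of_eventuallyEq (hev t ht)
  · have hdt : HasDerivAt S (deriv S t) (t : ℂ) :=
      (hd.differentiableAt (hopen.mem_nhds (ofReal_mem_openSector hθ0 ht))).hasDerivAt
    have e : deriv T.toFun t = deriv S (t : ℂ) :=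
      by
      have h2 : HasDerivAt (fun s : ℝ => S (s : ℂ)) ((1 : ℂ) • deriv S t) t :=
        HasDerivAt.scomp t hdt Complex.ofRealCLM.hasDerivAt
      rw [one_smul] at h2
      exact (h2.congr_of_eventuallyEq (hev t ht)).deriv
    have hcl : Metric.closedBall (t : ℂ) (r * t) ⊆ openSector ξ := fun z hz => by
      have ht' : (t : ℂ) ≠ 0 := Complex.ofReal_ne_zero.2 ht.ne'
      have hz1 : (t : ℂ)⁻¹ * z ∈ openSector ξ := hball (by
        rw [mem_closedBall_iff_norm] at hz ⊢
        have : (t : ℂ)⁻¹ * z - 1 = (t : ℂ)⁻¹ * (z - t) := by field_simp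
        rw [this, norm_mul, norm_inv, Complex.norm_real, Real.norm_of_nonneg ht.le,
          inv_mul_le_iff₀ ht, mul_comm t]
        exact hz)
      have := ofReal_mul_mem_openSector ht hz1
      rwa [mul_inv_cancel_left₀ ht'] at this
    have hc := Complex.norm_deriv_le_of_forall_mem_sphere_norm_le (c := (t : ℂ)) (R := r * t)
      (C := K) (f := S) (by positivity)
      ((hd.mono (hcl.trans hsub)).diffContOnCl_ball subset_rfl)
      fun z hz => hK z (subset_closure (hcl (Metric.sphere_subset_closedBall hz)))
    have : ‖T.genPow 1 t‖ = ‖deriv S (t : ℂ)‖ := by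
      rw [genPow, iteratedDeriv_one, e]
      simp
    rw [this]
    calc t * ‖deriv S (t : ℂ)‖ ≤ t * (K / (r * t)) := by gcongr
      _ = K / r := by field_simp

theorem toFun_pow (T : C0Semigroup X) (s : ℝ) (hs : 0 ≤ s) (n : ℕ) : T.toFun s ^ n = T.toFun (n * s) := by
  induction n with
  | zero => simp [T.map_zero]
  | succ n ih =>
    rw [pow_succ, ih, ← T.map_add _ _ (by positivity) hs]
    congr 1
    push_cast
    ring

namespace IsBoundedAnalytic

variable {C : ℝ}

theorem hasDerivAt_genPow (h : T.IsBoundedAnalytic K C) (k : ℕ) {t : ℝ} (ht : 0 < t) :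
    HasDerivAt (T.genPow k) (-T.genPow (k + 1) t) t := by
  have h1 : DifferentiableAt ℝ (iteratedDeriv k T.toFun) t :=
    (ContDiffAt.differentiableAt_iteratedFDeriv (h.contDiffAt t ht)
      (by exact_mod_cast ENat.natCast_lt_top k)).continuousMultilinear_apply_const (fun _ => 1)
  have h2 := h1.hasDerivAt.const_smul ((-1 : ℝ) ^ k)
  refine h2.congr_deriv ?_
  rw [genPow, iteratedDeriv_succ, pow_succ]
  simp

/-- Obtained by differentiating the semigroup law repeatedly in `t`. -/
theorem toFun_mul_genPow (h : T.IsBoundedAnalytic K C) (k : ℕ) {s t : ℝ} (hs : 0 ≤ s)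
    (ht : 0 < t) : T.toFun s * T.genPow k t = T.genPow k (s + t) := by
  induction k generalizing t with
  | zero => simp only [genPow_zero, T.map_add s t hs ht.le]
  | succ k ih =>
    have h1 : HasDerivAt (fun r => T.toFun s * T.genPow k r) (T.toFun s * -T.genPow (k + 1) t) t :=
      (h.hasDerivAt_genPow k ht).const_mul _
    have h2 : HasDerivAt (fun r => T.genPow k (s + r)) (-T.genPow (k + 1) (s + t)) t :=
      (h.hasDerivAt_genPow k (add_pos_of_nonneg_of_pos hs ht)).comp_const_add s t
    have h3 := h1.unique (h2.congr_of_eventuallyEq (by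
      filter_upwards [lt_mem_nhds ht] with r hr using ih hr))
    rw [mul_neg, neg_inj] at h3
    exact h3

theorem hasDerivAt_genPow_apply (h : T.IsBoundedAnalytic K C) (k : ℕ) {t : ℝ} (ht : 0 < t)
    (x : X) : HasDerivAt (fun s => T.genPow k s x) (-T.genPow (k + 1) t x) t := by
  have := ((ContinuousLinearMap.apply ℂ X x).restrictScalars ℝ).hasFDerivAt.comp_hasDerivAt t
    (h.hasDerivAt_genPow k ht)
  simpa [Function.comp_def] using this

theorem hasNegDeriv_genPow (h : T.IsBoundedAnalytic K C) (k : ℕ) {t : ℝ} (ht : 0 < t) (x : X) :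
    T.HasNegDeriv (T.genPow k t x) (T.genPow (k + 1) t x) := by
  have h1 : HasDerivAt (fun s => T.genPow k (s + t) x) (-T.genPow (k + 1) t x) 0 := by
    have h2 : HasDerivAt (fun s => T.genPow k s x) (-T.genPow (k + 1) t x) (0 + t) := by
      rw [zero_add]; exact h.hasDerivAt_genPow_apply k ht x
    exact h2.comp_add_const 0 t
  have := hasNegDeriv_of_hasDerivAt (T := T) (x := T.genPow k t x) h1 fun s hs => by
    rw [← h.toFun_mul_genPow k hs ht]
    rfl
  rwa [neg_neg] at this

theorem isSquareOf (h : T.IsBoundedAnalytic K C) {t : ℝ} (ht : 0 < t) (x : X) :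
    IsSquareOf T.negGenerator (T.toFun t x) (T.genPow 2 t x) := by
  have h0 := h.hasNegDeriv_genPow 0 ht x
  have h1 := h.hasNegDeriv_genPow 1 ht x
  rw [genPow_zero] at h0
  refine ⟨h0.mem_domain, ?_, ?_⟩
  · rw [h0.negGenerator_eq]
    exact h1.mem_domain
  · have : ∀ (y : X) (hy : y ∈ T.negGenerator.domain), y = T.genPow 1 t x →
        T.negGenerator ⟨y, hy⟩ = T.genPow 2 t x := by
      rintro y hy rfl
      exact h1.negGenerator_eq
    exact (this _ _ h0.negGenerator_eq).symm

variable [CompleteSpace X]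

/-- Iterates `(1+A)⁻¹A = 1 - (1+A)⁻¹`. This is the bridge between derivatives of the semigroup and
the functional calculus. -/
theorem resolvent_pow_mul_genPow (h : T.IsBoundedAnalytic K C) (k : ℕ) {t : ℝ} (ht : 0 < t) :
    T.resolvent 1 ^ k * T.genPow k t = (1 - T.resolvent 1) ^ k * T.toFun t := by
  have hstep : ∀ k, T.resolvent 1 * T.genPow (k + 1) t = (1 - T.resolvent 1) * T.genPow k t := by
    intro k
    ext x
    have := h.bound.resolvent_add_smul one_pos (h.hasNegDeriv_genPow k ht x)
    rw [Complex.ofReal_one, one_smul, _root_.map_add] at this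
    change T.resolvent 1 (T.genPow (k + 1) t x) = T.genPow k t x - T.resolvent 1 (T.genPow k t x)
    rw [eq_sub_iff_add_eq', this]
  induction k with
  | zero => simp [genPow_zero]
  | succ k ih =>
    have hcomm : Commute (T.resolvent 1 ^ k) (1 - T.resolvent 1) :=
      ((Commute.one_right _).sub_right (Commute.refl _)).pow_left k
    rw [pow_succ, mul_assoc, hstep, ← mul_assoc, hcomm.eq, mul_assoc, ih, ← mul_assoc, ← pow_succ']

/-- `(1 + t A)⁻¹ (1 + t A) T(s) = T(s)`. -/
theorem resolvent_mul (h : T.IsBoundedAnalytic K C) {t s : ℝ} (ht : 0 < t) (hs : 0 < s) :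
    T.resolvent t * (T.toFun s + (t : ℂ) • T.genPow 1 s) = T.toFun s := by
  ext x
  have := h.hasNegDeriv_genPow 0 hs x
  rw [genPow_zero] at this
  exact h.bound.resolvent_add_smul ht this

/-- Taken with `s = t/n`, this factors `T(t)` through `(1+tA)⁻ⁿ` with a cofactor bounded uniformly
in `t`. -/
theorem resolvent_pow_mul_pow (h : T.IsBoundedAnalytic K C) {t s : ℝ} (ht : 0 < t) (hs : 0 < s)
    (n : ℕ) : T.resolvent t ^ n * (T.toFun s + (t : ℂ) • T.genPow 1 s) ^ n = T.toFun s ^ n := by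
  induction n with
  | zero => simp
  | succ n ih =>
    have hc : Commute (T.resolvent t ^ n) (T.toFun s) :=
      (h.bound.resolvent_commute ht hs.le).pow_left n
    rw [pow_succ, pow_succ', mul_assoc, ← mul_assoc (T.resolvent t), h.resolvent_mul ht hs,
      ← mul_assoc, hc.eq, mul_assoc, ih, ← pow_succ']

end IsBoundedAnalytic

/-! ### Fractional powers and the smoothing constants -/

section FractionalPowers

theorem BoundedBy.isFracPow_iff (hK : T.BoundedBy K) {β : ℝ} (hβ : 0 ≤ β) {x y : X} :
    T.IsFracPow β x y ↔ T.hpc (fun z => (1 + z) ^ (-(β : ℂ))) y =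
      T.hpc (fun z => (1 + z) ^ (-(β : ℂ)) * z ^ (β : ℂ)) x := by
  constructor
  · rintro ⟨w, h1, h2⟩
    exact (hK.hillePhillips_iff.1 h1).2.symm.trans (hK.hillePhillips_iff.1 h2).2
  · intro h
    exact ⟨_, hK.hillePhillips_iff.2 ⟨isLap_one_add_cpow_neg hβ, rfl⟩,
      hK.hillePhillips_iff.2 ⟨isLap_one_add_cpow_neg_mul_cpow hβ, h⟩⟩

variable [CompleteSpace X]

theorem BoundedBy.hpc_cpow_neg_mul (hK : T.BoundedBy K) {α β : ℝ} (hα : 0 ≤ α) (hβ : 0 ≤ β)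
    {n : ℕ} (h : α + β = n) :
    T.hpc (fun z => (1 + z) ^ (-(α : ℂ))) * T.hpc (fun z => (1 + z) ^ (-(β : ℂ))) =
      T.resolvent 1 ^ n := by
  rw [← hK.hpc_mul (isLap_one_add_cpow_neg hα) (isLap_one_add_cpow_neg hβ),
    ← hK.hpc_inv_one_add_pow one_pos]
  refine hK.hpc_congr ((isLap_inv_one_add one_pos).pow n) fun z hz => ?_
  rw [← Complex.cpow_add _ _ (one_add_ne_zero_of_re_pos hz), ← neg_add, ← Complex.ofReal_add, h,
    Complex.ofReal_natCast, Complex.cpow_neg, Complex.cpow_natCast, Complex.ofReal_one, one_mul,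
    inv_pow]

theorem BoundedBy.hpc_cpow_mul (hK : T.BoundedBy K) {α β : ℝ} (hα : 0 ≤ α) (hβ : 0 ≤ β)
    {n : ℕ} (h : α + β = n) :
    T.hpc (fun z => (1 + z) ^ (-(α : ℂ)) * z ^ (α : ℂ)) *
      T.hpc (fun z => (1 + z) ^ (-(β : ℂ)) * z ^ (β : ℂ)) = (1 - T.resolvent 1) ^ n := by
  rw [← hK.hpc_mul (isLap_one_add_cpow_neg_mul_cpow hα) (isLap_one_add_cpow_neg_mul_cpow hβ),
    ← (hK.hpc_mul_inv_pow n).2]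
  refine hK.hpc_congr (hK.hpc_mul_inv_pow n).1 fun z hz => ?_
  rw [mul_mul_mul_comm, ← Complex.cpow_add _ _ (one_add_ne_zero_of_re_pos hz), ← neg_add,
    ← Complex.cpow_add _ _ (ne_zero_of_re_pos hz), ← Complex.ofReal_add, h,
    Complex.ofReal_natCast, Complex.cpow_neg, Complex.cpow_natCast, Complex.cpow_natCast, mul_pow,
    inv_pow, mul_comm]

/-- Multiplying the regularizer by `(1+A)^(-(n-β))` completes it to an integer resolvent power,
which is injective. -/
theorem BoundedBy.isFracPow_unique (hK : T.BoundedBy K) {β : ℝ} (hβ : 0 ≤ β) {x y y' : X}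
    (h : T.IsFracPow β x y) (h' : T.IsFracPow β x y') : y = y' := by
  rw [hK.isFracPow_iff hβ] at h h'
  set n := ⌈β⌉₊
  have hn : β ≤ n := Nat.le_ceil β
  refine hK.resolvent_pow_injective one_pos n ?_
  rw [← hK.hpc_cpow_neg_mul (sub_nonneg.2 hn) hβ (sub_add_cancel _ _)]
  exact congrArg (T.hpc fun z => (1 + z) ^ (-((n - β : ℝ) : ℂ))) (h.trans h'.symm)

variable {C : ℝ}

/-- Write `A^βT(t)` as `A^β(1+tA)⁻ⁿ` times `((1+tA)T(t/n))ⁿ`. The first factor is `O(t^(-β))` by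
scaling, and the second is bounded because `‖sAT(s)‖ ≤ C` at `s = t/n`. -/
theorem IsBoundedAnalytic.exists_isFracPow (h : T.IsBoundedAnalytic K C) {β : ℝ} (hβ : 0 ≤ β) :
    ∃ M : ℝ, ∀ t : ℝ, 0 < t → ∃ B : X →L[ℂ] X,
      (∀ x, T.IsFracPow β (T.toFun t x) (B x)) ∧ t ^ β * ‖B‖ ≤ M := by
  -- The extra `1` keeps `n` positive when `β = 0`, so that `t/n` is a genuine subdivision.
  set n := ⌈β⌉₊ + 1 with hn
  have hβn : β ≤ n := (Nat.le_ceil β).trans (by exact_mod_cast Nat.le_succ _)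
  have hn0 : (0 : ℝ) < n := by positivity
  obtain ⟨V, hV⟩ := h.bound.exists_norm_hpc_scale_le hβ hβn
  refine ⟨V * (K + n * C) ^ n, fun t ht => ?_⟩
  set s := t / n with hs
  have hs0 : 0 < s := by positivity
  set Q := T.toFun s + (t : ℂ) • T.genPow 1 s with hQ
  have hQn : ‖Q‖ ≤ K + n * C := by
    refine (norm_add_le _ _).trans (add_le_add (h.bound s hs0.le) ?_)
    rw [norm_smul, Complex.norm_real, Real.norm_of_nonneg ht.le]
    calc t * ‖T.genPow 1 s‖ = n * (s * ‖T.genPow 1 s‖) := by rw [hs]; field_simp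
      _ ≤ n * C := by gcongr; exact h.norm_genPow_one_le s hs0
  have hg := isLap_cpow_mul_inv_pow_scale hβ hβn ht
  refine ⟨T.hpc (fun z => z ^ (β : ℂ) * ((1 + t * z)⁻¹) ^ n) * Q ^ n, fun x => ?_, ?_⟩
  · rw [h.bound.isFracPow_iff hβ]
    have key : T.hpc (fun z => (1 + z) ^ (-(β : ℂ))) *
        (T.hpc (fun z => z ^ (β : ℂ) * ((1 + t * z)⁻¹) ^ n) * Q ^ n) =
        T.hpc (fun z => (1 + z) ^ (-(β : ℂ)) * z ^ (β : ℂ)) * T.toFun t := by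
      have hT : T.toFun t = T.resolvent t ^ n * Q ^ n := by
        rw [h.resolvent_pow_mul_pow ht hs0, T.toFun_pow s hs0.le, hs,
          mul_div_cancel₀ _ hn0.ne']
      rw [hT, ← mul_assoc, ← mul_assoc, ← h.bound.hpc_inv_one_add_pow ht,
        ← h.bound.hpc_mul (isLap_one_add_cpow_neg hβ) hg,
        ← h.bound.hpc_mul (isLap_one_add_cpow_neg_mul_cpow hβ) ((isLap_inv_one_add ht).pow n)]
      simp only [mul_assoc]
    exact congrArg (fun L : X →L[ℂ] X => L x) key
  · have hV' := hV t ht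
    calc t ^ β * ‖T.hpc (fun z => z ^ (β : ℂ) * ((1 + t * z)⁻¹) ^ n) * Q ^ n‖
        ≤ t ^ β * ((t ^ (-β) * V) * (K + n * C) ^ n) := by
          refine mul_le_mul_of_nonneg_left ?_ (Real.rpow_nonneg ht.le _)
          refine (norm_mul_le _ _).trans (mul_le_mul hV' ?_ (norm_nonneg _)
            ((norm_nonneg _).trans hV'))
          exact (norm_pow_le' _ (by positivity)).trans (pow_le_pow_left₀ (norm_nonneg _) hQn n)
      _ = V * (K + n * C) ^ n := by
          rw [← mul_assoc, ← mul_assoc, ← Real.rpow_add ht, add_neg_cancel, Real.rpow_zero, one_mul]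

/-- A real `sSup` bounds its set only if the set is bounded above; existence of one uniformly
bounded choice and uniqueness of `A^β` provide that. -/
theorem IsBoundedAnalytic.le_smoothingConst (h : T.IsBoundedAnalytic K C) {β : ℝ} (hβ : 0 ≤ β)
    {t : ℝ} (ht : 0 < t) {B : X →L[ℂ] X} (hB : ∀ x, T.IsFracPow β (T.toFun t x) (B x)) :
    ‖B‖ ≤ T.smoothingConst β * t ^ (-β) := by
  obtain ⟨M, hM⟩ := h.exists_isFracPow hβ
  have hbdd : BddAbove {r : ℝ | ∃ t : ℝ, 0 < t ∧ ∃ B : X →L[ℂ] X,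
      (∀ x : X, T.IsFracPow β (T.toFun t x) (B x)) ∧ r = ‖((t ^ β : ℝ) : ℂ) • B‖} := by
    refine ⟨M, ?_⟩
    rintro r ⟨t, ht, B, hB, rfl⟩
    obtain ⟨B', hB', hM'⟩ := hM t ht
    have : B = B' := by
      ext x
      exact h.bound.isFracPow_unique hβ (hB x) (hB' x)
    rw [this, norm_smul, Complex.norm_real, Real.norm_of_nonneg (Real.rpow_nonneg ht.le _)]
    exact hM'
  have hle := le_csSup hbdd ⟨t, ht, B, hB, rfl⟩
  rw [norm_smul, Complex.norm_real, Real.norm_of_nonneg (Real.rpow_nonneg ht.le _)] at hle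
  rw [Real.rpow_neg ht.le, ← div_eq_mul_inv, le_div_iff₀' (Real.rpow_pos_of_pos ht _)]
  exact hle

/-- `‖A ^ k T(t) x‖ ≤ M_{k - α} t ^ (α - k) ‖A ^ α x‖`. -/
theorem IsBoundedAnalytic.norm_genPow_apply_le (h : T.IsBoundedAnalytic K C) {α : ℝ} (hα : 0 ≤ α)
    {k : ℕ} (hk : α ≤ k) {t : ℝ} (ht : 0 < t) {x y : X} (hxy : T.IsFracPow α x y) :
    ‖T.genPow k t x‖ ≤ T.smoothingConst (k - α) * t ^ (α - k) * ‖y‖ := by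
  have hβ : 0 ≤ (k : ℝ) - α := sub_nonneg.2 hk
  have hsum : α + ((k : ℝ) - α) = k := by ring
  have hsum' : ((k : ℝ) - α) + α = k := by ring
  obtain ⟨M, hM⟩ := h.exists_isFracPow hβ
  obtain ⟨B, hB, -⟩ := hM t ht
  have hBle := h.le_smoothingConst hβ ht hB
  have hx := (h.bound.isFracPow_iff hα).1 hxy
  have hy := (h.bound.isFracPow_iff hβ).1 (hB y)
  set eα := T.hpc (fun z => (1 + z) ^ (-(α : ℂ))) with heα
  set eβ := T.hpc (fun z => (1 + z) ^ (-(((k : ℝ) - α : ℝ) : ℂ))) with heβ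
  set pα := T.hpc (fun z => (1 + z) ^ (-(α : ℂ)) * z ^ (α : ℂ)) with hpα
  set pβ := T.hpc (fun z => (1 + z) ^ (-(((k : ℝ) - α : ℝ) : ℂ)) * z ^ (((k : ℝ) - α : ℝ) : ℂ))
    with hpβ
  have hc : eα * (pβ * T.toFun t) = pβ * T.toFun t * eα :=
    (h.bound.hpc_commute (isLap_one_add_cpow_neg hα) (isLap_one_add_cpow_neg_mul_cpow hβ)).mul_right
      (h.bound.hpc_commute_toFun (isLap_one_add_cpow_neg hα) ht.le)
  have hc' : pβ * T.toFun t * pα = (1 - T.resolvent 1) ^ k * T.toFun t := by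
    rw [mul_assoc, ← (h.bound.hpc_commute_toFun (isLap_one_add_cpow_neg_mul_cpow hα) ht.le).eq,
      ← mul_assoc, hpβ, h.bound.hpc_cpow_mul hβ hα hsum']
  -- That is, `A^(k-α)T(t)A^αx = AᵏT(t)x`. After applying the injective `(1+A)⁻ᵏ`, both sides become
  -- `(1-(1+A)⁻¹)ᵏT(t)x`.
  have key : B y = T.genPow k t x := by
    refine h.bound.resolvent_pow_injective one_pos k ?_
    calc (T.resolvent 1 ^ k) (B y) = (eα * eβ) (B y) := by
          rw [heα, heβ, h.bound.hpc_cpow_neg_mul hα hβ hsum]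
      _ = (eα * (pβ * T.toFun t)) y := congrArg eα hy
      _ = (pβ * T.toFun t) (eα y) := by rw [hc]; rfl
      _ = (pβ * T.toFun t * pα) x := by rw [hx]; rfl
      _ = (T.resolvent 1 ^ k * T.genPow k t) x := by rw [hc', h.resolvent_pow_mul_genPow k ht]
      _ = (T.resolvent 1 ^ k) (T.genPow k t x) := rfl
  rw [← key, ← neg_sub (k : ℝ) α]
  exact B.le_of_opNorm_le hBle y

end FractionalPowers

end C0Semigroup

/-! ### Power and logarithmic moments of Gamma laws -/

section Moments

theorem integrable_rpow_stdGamma {a p : ℝ} (ha : 0 < a) (hp : 0 < a + p) :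
    Integrable (fun s : ℝ => s ^ p) (stdGamma a) := by
  rw [integrable_stdGamma_iff ha]
  have h : IntegrableOn (fun s => (Real.Gamma a)⁻¹ * (s ^ (a + p - 1) * Real.exp (-(1 * s))))
    (Ioi 0) := (integrableOn_rpow_mul_exp hp one_pos).const_mul _
  refine h.congr_fun (fun s hs => ?_) measurableSet_Ioi
  have hs : 0 < s := hs
  simp only [gammaWeight, smul_eq_mul, one_mul]
  rw [show a + p - 1 = (a - 1) + p by ring, Real.rpow_add hs]
  ring

theorem integral_rpow_stdGamma {a p : ℝ} (ha : 0 < a) (hp : 0 < a + p) :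
    ∫ s : ℝ, s ^ p ∂stdGamma a = Real.Gamma (a + p) / Real.Gamma a := by
  rw [integral_stdGamma ha, Real.Gamma_eq_integral hp, div_eq_inv_mul, ← integral_const_mul]
  refine setIntegral_congr_fun measurableSet_Ioi fun s hs => ?_
  have hs : 0 < s := hs
  simp only [gammaWeight, smul_eq_mul]
  rw [show a + p - 1 = (a - 1) + p by ring, Real.rpow_add hs]
  ring

theorem integrable_pow_stdGamma {a : ℝ} (ha : 0 < a) (k : ℕ) :
    Integrable (fun s : ℝ => s ^ k) (stdGamma a) := by
  simpa using integrable_rpow_stdGamma ha (p := k) (by positivity)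

theorem integral_pow_succ_stdGamma {a : ℝ} (ha : 0 < a) (k : ℕ) :
    ∫ s : ℝ, s ^ (k + 1) ∂stdGamma a = (a + k) * ∫ s : ℝ, s ^ k ∂stdGamma a := by
  have h := fun k : ℕ => integral_rpow_stdGamma ha (p := k) (by positivity)
  simp only [Real.rpow_natCast] at h
  have hk : a + k ≠ 0 := by positivity
  rw [h, h, Nat.cast_succ, ← add_assoc, Real.Gamma_add_one hk]
  ring

/-- `log y ≤ y - 1` is used at `s` and at `s^(-1/2)`; the exponent `-1/2` remains integrable near
`0` for every shape `a ≥ 1`. -/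
theorem abs_log_le {s : ℝ} (hs : 0 < s) : |Real.log s| ≤ s + 2 * s ^ (-(1 / 2) : ℝ) := by
  have h1 := Real.log_le_sub_one_of_pos hs
  have hp : 0 < s ^ (-(1 / 2) : ℝ) := Real.rpow_pos_of_pos hs _
  have h2 := Real.log_le_sub_one_of_pos hp
  rw [Real.log_rpow hs] at h2
  rw [abs_le]
  constructor <;> linarith

theorem integrable_log_stdGamma {a : ℝ} (ha : 1 ≤ a) : Integrable Real.log (stdGamma a) := by
  have ha0 : 0 < a := by linarith
  have h1 := (integrable_rpow_stdGamma ha0 (p := 1) (by linarith)).add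
    ((integrable_rpow_stdGamma ha0 (p := -(1 / 2)) (by linarith)).const_mul 2)
  refine h1.mono' Real.measurable_log.aestronglyMeasurable ?_
  filter_upwards [ae_nonneg_stdGamma] with s hs
  simpa using abs_log_le hs

theorem gammaWeight_mul_self {a s : ℝ} (ha : 0 < a) (hs : 0 < s) :
    gammaWeight a s * s = a * gammaWeight (a + 1) s := by
  rw [gammaWeight, gammaWeight, Real.Gamma_add_one ha.ne', add_sub_cancel_right]
  have h := (Real.Gamma_pos_of_pos ha).ne'
  have e : s ^ a = s ^ (a - 1) * s := by
    rw [← Real.rpow_add_one hs.ne', sub_add_cancel]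
  rw [e]
  field_simp

/-- Size-biasing a Gamma law raises its shape by one, which reduces moments of `s log s` to those of
`log s`. -/
theorem integrable_mul_self_stdGamma_iff {a : ℝ} (ha : 0 < a) (f : ℝ → ℝ) :
    Integrable (fun s => s * f s) (stdGamma a) ↔ Integrable f (stdGamma (a + 1)) := by
  rw [integrable_stdGamma_iff ha, integrable_stdGamma_iff (by linarith)]
  have e : ∀ s ∈ Ioi (0 : ℝ), gammaWeight a s • (s * f s) = a * (gammaWeight (a + 1) s • f s) := by
    intro s hs
    rw [smul_eq_mul, smul_eq_mul, ← mul_assoc, gammaWeight_mul_self ha hs, mul_assoc]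
  rw [integrableOn_congr_fun e measurableSet_Ioi]
  exact integrable_const_mul_iff (IsUnit.mk0 _ ha.ne') _

theorem integral_mul_self_stdGamma {a : ℝ} (ha : 0 < a) (f : ℝ → ℝ) :
    ∫ s, s * f s ∂stdGamma a = a * ∫ s, f s ∂stdGamma (a + 1) := by
  rw [integral_stdGamma ha, integral_stdGamma (by linarith), ← integral_const_mul]
  refine setIntegral_congr_fun measurableSet_Ioi fun s hs => ?_
  simp only [smul_eq_mul]
  rw [← mul_assoc, gammaWeight_mul_self ha hs, mul_assoc]

/-- The mean is `Γ'(n+1)/Γ(n+1)`, by differentiating Euler's integral under the integral sign. -/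
theorem integral_log_stdGamma (n : ℕ) :
    ∫ s, Real.log s ∂stdGamma (n + 1) = harmonic n - Real.eulerMascheroniConstant := by
  have hn : (0 : ℝ) < n + 1 := by positivity
  have h1 := Complex.hasDerivAt_GammaIntegral (s := n + 1) (by simpa using hn)
  have h2 : HasDerivAt Complex.GammaIntegral
      (n.factorial * (-Real.eulerMascheroniConstant + harmonic n)) (n + 1) := by
    refine (Complex.hasDerivAt_Gamma_nat n).congr_of_eventuallyEq ?_
    have : ∀ᶠ s : ℂ in 𝓝 ((n : ℂ) + 1), 0 < s.re :=
      (isOpen_lt continuous_const Complex.continuous_re).mem_nhds (by simpa using hn)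
    filter_upwards [this] with s hs using (Complex.Gamma_eq_integral hs).symm
  have h3 := h1.unique h2
  have h4 : ∫ s in Ioi (0 : ℝ), s ^ (n : ℝ) * (Real.log s * Real.exp (-s)) =
      n.factorial * (-Real.eulerMascheroniConstant + harmonic n) := by
    rw [← Complex.ofReal_inj, ← integral_complex_ofReal]
    push_cast
    rw [← h3]
    refine setIntegral_congr_fun measurableSet_Ioi fun s hs => ?_
    simp only [add_sub_cancel_right, Complex.cpow_natCast, Real.rpow_natCast]
    push_cast
    rfl
  rw [integral_stdGamma hn]
  have h5 : ∀ s : ℝ, gammaWeight (n + 1) s • Real.log s =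
      (n.factorial : ℝ)⁻¹ * (s ^ (n : ℝ) * (Real.log s * Real.exp (-s))) := fun s => by
    rw [gammaWeight, Real.Gamma_nat_eq_factorial, add_sub_cancel_right, smul_eq_mul]
    ring
  simp only [h5]
  rw [integral_const_mul, h4, inv_mul_cancel_left₀ (by exact_mod_cast n.factorial_ne_zero)]
  ring

end Moments

/-! ### Two-sided bounds for `H_n - log n - γ` -/

section Harmonic

/-- At `u = 1/n` this is the trapezoidal rule for `1/x` on `[n, n+1]`; the derivative of the
difference is half a square. -/
theorem log_one_add_le {u : ℝ} (hu : 0 ≤ u) :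
    Real.log (1 + u) ≤ (u + 1 - (1 + u)⁻¹) / 2 := by
  have hd : ∀ x : ℝ, 0 ≤ x → HasDerivAt (fun x : ℝ => (x + 1 - (1 + x)⁻¹) / 2 - Real.log (1 + x))
      ((1 - (1 + x)⁻¹) ^ 2 / 2) x := fun x hx => by
    have h1 : HasDerivAt (fun x : ℝ => 1 + x) 1 x := (hasDerivAt_id x).const_add 1
    have h0 : (1 + x) ≠ 0 := by positivity
    have := (((((hasDerivAt_id x).add_const (1 : ℝ)).sub (h1.inv h0)).div_const 2).sub (h1.log h0))
    refine this.congr_deriv ?_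
    field_simp
    ring
  have hm : MonotoneOn (fun x : ℝ => (x + 1 - (1 + x)⁻¹) / 2 - Real.log (1 + x)) (Ici 0) := by
    refine monotoneOn_of_hasDerivWithinAt_nonneg (convex_Ici 0)
      (fun x hx => (hd x hx).continuousAt.continuousWithinAt)
      (fun x hx => (hd x (interior_subset hx)).hasDerivWithinAt) fun x _ => by positivity
  have := hm (self_mem_Ici) hu hu
  simp at this
  linarith

/-- The trapezoidal rule with its first Euler-Maclaurin correction, which at `u = 1/n` telescopes as
`(1/n² - 1/(n+1)²)/12`. -/
theorem le_log_one_add {u : ℝ} (hu : 0 ≤ u) :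
    (u + 1 - (1 + u)⁻¹) / 2 - (u ^ 2 - (1 - (1 + u)⁻¹) ^ 2) / 12 ≤ Real.log (1 + u) := by
  have hd : ∀ x : ℝ, 0 ≤ x → HasDerivAt (fun x : ℝ => Real.log (1 + x) -
      ((x + 1 - (1 + x)⁻¹) / 2 - (x ^ 2 - (1 - (1 + x)⁻¹) ^ 2) / 12))
      ((1 - (1 + x)⁻¹) ^ 4 * (1 + x) / 6) x := fun x hx => by
    have h1 : HasDerivAt (fun x : ℝ => 1 + x) 1 x := (hasDerivAt_id x).const_add 1
    have h0 : (1 + x) ≠ 0 := by positivity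
    have := (h1.log h0).sub (((((hasDerivAt_id x).add_const (1 : ℝ)).sub (h1.inv h0)).div_const 2).sub
      ((((hasDerivAt_id x).pow 2).sub (((h1.inv h0).const_sub 1).pow 2)).div_const 12))
    refine this.congr_deriv ?_
    norm_num
    field_simp
    ring
  have hm : MonotoneOn (fun x : ℝ => Real.log (1 + x) -
      ((x + 1 - (1 + x)⁻¹) / 2 - (x ^ 2 - (1 - (1 + x)⁻¹) ^ 2) / 12)) (Ici 0) := by
    refine monotoneOn_of_hasDerivWithinAt_nonneg (convex_Ici 0)
      (fun x hx => (hd x hx).continuousAt.continuousWithinAt)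
      (fun x hx => (hd x (interior_subset hx)).hasDerivWithinAt) fun x hx => ?_
    have : 0 ≤ x := interior_subset hx
    positivity
  have := hm (self_mem_Ici) hu hu
  simp at this
  linarith

/-- `H_n - log n - γ`. -/
def harmonicError (n : ℕ) : ℝ := harmonic n - Real.log n - Real.eulerMascheroniConstant

theorem tendsto_harmonicError : Tendsto harmonicError atTop (𝓝 0) := by
  have := Real.tendsto_harmonic_sub_log.sub_const Real.eulerMascheroniConstant
  rwa [sub_self] at this

theorem harmonicError_succ (n : ℕ) (hn : 1 ≤ n) :
    harmonicError (n + 1) = harmonicError n + 1 / (n + 1) - Real.log (1 + 1 / n) := by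
  have hn' : (0 : ℝ) < n := by exact_mod_cast hn
  have : Real.log (1 + 1 / n) = Real.log (n + 1) - Real.log n := by
    rw [← Real.log_div (by positivity) hn'.ne']
    congr 1
    field_simp
  rw [harmonicError, harmonicError, this, harmonic_succ]
  push_cast
  ring

/-- By the trapezoidal bound, the difference of the two sides increases in `n` to the limit `0`. -/
theorem harmonicError_le (n : ℕ) (hn : 1 ≤ n) : harmonicError n ≤ 1 / (2 * n) := by
  have hm : Monotone (fun k : ℕ => harmonicError (k + 1) - 1 / (2 * ((k + 1 : ℕ) : ℝ))) := by
    refine monotone_nat_of_le_succ fun k => ?_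
    rw [harmonicError_succ (k + 1) (by omega)]
    have hk : (0 : ℝ) < ((k + 1 : ℕ) : ℝ) := by positivity
    have h := log_one_add_le (u := 1 / ((k + 1 : ℕ) : ℝ)) (by positivity)
    have e : (1 / ((k + 1 : ℕ) : ℝ) + 1 - (1 + 1 / ((k + 1 : ℕ) : ℝ))⁻¹) / 2 =
      1 / (((k + 1 : ℕ) : ℝ) + 1) + 1 / (2 * ((k + 1 : ℕ) : ℝ)) -
        1 / (2 * (((k + 1 : ℕ) : ℝ) + 1)) := by
      field_simp
      ring
    rw [e] at h
    push_cast at h ⊢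
    linarith
  have ht : Tendsto (fun k : ℕ => harmonicError (k + 1) - 1 / (2 * ((k + 1 : ℕ) : ℝ))) atTop
      (𝓝 0) := by
    have h1 := tendsto_harmonicError.comp (tendsto_add_atTop_nat 1)
    have h2 := (tendsto_one_div_add_atTop_nhds_zero_nat (𝕜 := ℝ)).const_mul (1 / 2)
    have := h1.sub h2
    simp only [mul_zero, sub_zero] at this
    refine this.congr fun k => ?_
    simp only [Function.comp_apply]
    push_cast
    field_simp
  obtain ⟨k, rfl⟩ : ∃ k, n = k + 1 := ⟨n - 1, by omega⟩
  have := hm.ge_of_tendsto ht k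
  linarith

/-- By the corrected trapezoidal bound, the error minus its lower estimate decreases to `0`. -/
theorem le_harmonicError (n : ℕ) (hn : 1 ≤ n) :
    1 / (2 * n) - 1 / (12 * (n : ℝ) ^ 2) ≤ harmonicError n := by
  have hm : Antitone (fun k : ℕ => harmonicError (k + 1) - (1 / (2 * ((k + 1 : ℕ) : ℝ)) -
      1 / (12 * ((k + 1 : ℕ) : ℝ) ^ 2))) := by
    refine antitone_nat_of_succ_le fun k => ?_
    rw [harmonicError_succ (k + 1) (by omega)]
    have hk : (0 : ℝ) < ((k + 1 : ℕ) : ℝ) := by positivity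
    have h := le_log_one_add (u := 1 / ((k + 1 : ℕ) : ℝ)) (by positivity)
    have e : (1 / ((k + 1 : ℕ) : ℝ) + 1 - (1 + 1 / ((k + 1 : ℕ) : ℝ))⁻¹) / 2 -
        ((1 / ((k + 1 : ℕ) : ℝ)) ^ 2 - (1 - (1 + 1 / ((k + 1 : ℕ) : ℝ))⁻¹) ^ 2) / 12 =
      1 / (((k + 1 : ℕ) : ℝ) + 1) + (1 / (2 * ((k + 1 : ℕ) : ℝ)) -
        1 / (12 * ((k + 1 : ℕ) : ℝ) ^ 2)) -
        (1 / (2 * (((k + 1 : ℕ) : ℝ) + 1)) - 1 / (12 * (((k + 1 : ℕ) : ℝ) + 1) ^ 2)) := by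
      field_simp
      ring
    rw [e] at h
    push_cast at h ⊢
    linarith
  have ht : Tendsto (fun k : ℕ => harmonicError (k + 1) - (1 / (2 * ((k + 1 : ℕ) : ℝ)) -
      1 / (12 * ((k + 1 : ℕ) : ℝ) ^ 2))) atTop (𝓝 0) := by
    have h1 := tendsto_harmonicError.comp (tendsto_add_atTop_nat 1)
    have h0 := tendsto_one_div_add_atTop_nhds_zero_nat (𝕜 := ℝ)
    have := h1.sub ((h0.const_mul (1 / 2)).sub ((h0.pow 2).const_mul (1 / 12)))
    simp only [mul_zero, sub_zero, ne_eq, OfNat.ofNat_ne_zero, not_false_eq_true, zero_pow] at this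
    refine this.congr fun k => ?_
    simp only [Function.comp_apply]
    push_cast
    field_simp
  obtain ⟨k, rfl⟩ : ∃ k, n = k + 1 := ⟨n - 1, by omega⟩
  have := hm.le_of_tendsto ht k
  linarith

end Harmonic

/-! ### Means under the normalized Gamma law of `s/n` -/

section GammaMean

variable {n : ℕ}

theorem integral_one_stdGamma (hn : 1 ≤ n) : ∫ _, (1 : ℝ) ∂stdGamma n = 1 := by
  have := isProbabilityMeasure_stdGamma (a := n) (by exact_mod_cast hn)
  simp

theorem integrable_div_pow (hn : 1 ≤ n) (k : ℕ) :
    Integrable (fun s : ℝ => (s / n) ^ k) (stdGamma n) := by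
  simp only [div_pow]
  exact (integrable_pow_stdGamma (by exact_mod_cast hn) k).div_const _

theorem integral_div_pow_succ (hn : 1 ≤ n) (k : ℕ) :
    ∫ s : ℝ, (s / n) ^ (k + 1) ∂stdGamma n =
      (1 + k / n) * ∫ s : ℝ, (s / n) ^ k ∂stdGamma n := by
  have hn' : (0 : ℝ) < n := by exact_mod_cast hn
  simp only [div_pow, integral_div]
  rw [integral_pow_succ_stdGamma hn']
  field_simp
  rw [pow_succ]
  ring

theorem integral_div_pow (hn : 1 ≤ n) :
    ∫ s : ℝ, s / n ∂stdGamma n = 1 ∧ ∫ s : ℝ, (s / n) ^ 2 ∂stdGamma n = 1 + 1 / n ∧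
      ∫ s : ℝ, (s / n) ^ 3 ∂stdGamma n = (1 + 2 / n) * (1 + 1 / n) := by
  have h0 : ∫ s : ℝ, (s / n) ^ 0 ∂stdGamma n = 1 := by
    simpa using integral_one_stdGamma hn
  have h1 := integral_div_pow_succ hn 0
  have h2 := integral_div_pow_succ hn 1
  have h3 := integral_div_pow_succ hn 2
  rw [h0] at h1
  simp only [zero_add] at h1
  rw [h1] at h2
  norm_num at h1 h2 h3
  rw [h2] at h3
  refine ⟨h1, ?_, ?_⟩
  · rw [h2]; simp
  · rw [h3]; simp

theorem integrable_log_div (hn : 1 ≤ n) :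
    Integrable (fun s : ℝ => Real.log (s / n)) (stdGamma n) := by
  have hn' : (0 : ℝ) < n := by exact_mod_cast hn
  have := isProbabilityMeasure_stdGamma hn'
  refine ((integrable_log_stdGamma (a := n) (by exact_mod_cast hn)).sub
    (integrable_const (Real.log n))).congr ?_
  filter_upwards [ae_nonneg_stdGamma] with s hs
  rw [Pi.sub_apply, Real.log_div hs.ne' hn'.ne']

theorem integral_log_div (hn : 1 ≤ n) :
    ∫ s : ℝ, Real.log (s / n) ∂stdGamma n = harmonicError n - 1 / n := by
  have hn' : (0 : ℝ) < n := by exact_mod_cast hn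
  have := isProbabilityMeasure_stdGamma hn'
  have e : ∫ s : ℝ, Real.log (s / n) ∂stdGamma n =
      ∫ s : ℝ, (Real.log s - Real.log n) ∂stdGamma n := by
    refine integral_congr_ae ?_
    filter_upwards [ae_nonneg_stdGamma] with s hs
    rw [Real.log_div hs.ne' hn'.ne']
  rw [e, integral_sub (integrable_log_stdGamma (by exact_mod_cast hn)) (integrable_const _),
    integral_const, probReal_univ, one_smul]
  obtain ⟨k, rfl⟩ : ∃ k, n = k + 1 := ⟨n - 1, by omega⟩
  have h := integral_log_stdGamma k
  push_cast at h ⊢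
  rw [h, harmonicError, harmonic_succ]
  push_cast
  field_simp
  ring

theorem integrable_mul_log_div (hn : 1 ≤ n) :
    Integrable (fun s : ℝ => s / n * Real.log (s / n)) (stdGamma n) := by
  have hn' : (0 : ℝ) < n := by exact_mod_cast hn
  have hn1 : (1 : ℝ) ≤ n := by exact_mod_cast hn
  have h1 := ((integrable_mul_self_stdGamma_iff hn' Real.log).2
    (integrable_log_stdGamma (a := n + 1) (by linarith))).div_const n
  have h2 := (integrable_div_pow hn 1).mul_const (Real.log n)
  refine (h1.sub h2).congr ?_
  filter_upwards [ae_nonneg_stdGamma] with s hs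
  rw [Pi.sub_apply, Real.log_div hs.ne' hn'.ne']
  ring

theorem integral_mul_log_div (hn : 1 ≤ n) :
    ∫ s : ℝ, s / n * Real.log (s / n) ∂stdGamma n = harmonicError n := by
  have hn' : (0 : ℝ) < n := by exact_mod_cast hn
  have hn1 : (1 : ℝ) ≤ n := by exact_mod_cast hn
  have h1 := ((integrable_mul_self_stdGamma_iff hn' Real.log).2
    (integrable_log_stdGamma (a := n + 1) (by linarith))).div_const n
  have h2 := (integrable_div_pow hn 1).mul_const (Real.log n)
  have e : ∫ s : ℝ, s / n * Real.log (s / n) ∂stdGamma n =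
      ∫ s : ℝ, (s * Real.log s / n - (s / n) ^ 1 * Real.log n) ∂stdGamma n := by
    refine integral_congr_ae ?_
    filter_upwards [ae_nonneg_stdGamma] with s hs
    rw [Real.log_div hs.ne' hn'.ne']
    ring
  rw [e, integral_sub h1 h2, integral_div, integral_mul_const, integral_mul_self_stdGamma hn',
    integral_log_stdGamma]
  simp only [pow_one]
  rw [(integral_div_pow hn).1, harmonicError]
  field_simp
  ring

theorem integrable_sqrt_div (hn : 1 ≤ n) :
    Integrable (fun s : ℝ => Real.sqrt (s / n)) (stdGamma n) := by
  have hn' : (0 : ℝ) < n := by exact_mod_cast hn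
  have := (integrable_rpow_stdGamma hn' (p := 1 / 2) (by positivity)).div_const (Real.sqrt n)
  refine this.congr ?_
  filter_upwards [ae_nonneg_stdGamma] with s hs
  rw [Real.sqrt_div hs.le, Real.sqrt_eq_rpow s]

/-- The square of the mean of the square root of the normalized Gamma distribution. -/
theorem integral_sqrt_div_sq (hn : 1 ≤ n) :
    (∫ s : ℝ, Real.sqrt (s / n) ∂stdGamma n) ^ 2 =
      (Real.Gamma (n + 1 / 2) / Real.Gamma n) ^ 2 / n := by
  have hn' : (0 : ℝ) < n := by exact_mod_cast hn
  have e : ∫ s : ℝ, Real.sqrt (s / n) ∂stdGamma n =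
      ∫ s : ℝ, s ^ (1 / 2 : ℝ) / Real.sqrt n ∂stdGamma n := by
    refine integral_congr_ae ?_
    filter_upwards [ae_nonneg_stdGamma] with s hs
    rw [Real.sqrt_div hs.le, Real.sqrt_eq_rpow s]
  rw [e, integral_div, integral_rpow_stdGamma hn' (by positivity), div_pow _ (Real.sqrt n),
    Real.sq_sqrt hn'.le]

/-- Integrates `(3y - y²)/2 ≤ √y ≤ (1 + y)/2`. The lower bound is too weak for the rate and only
identifies the limit `1` as `n → ∞`. -/
theorem integral_sqrt_div_bounds (hn : 1 ≤ n) :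
    1 - 1 / (2 * n) ≤ ∫ s : ℝ, Real.sqrt (s / n) ∂stdGamma n ∧
      ∫ s : ℝ, Real.sqrt (s / n) ∂stdGamma n ≤ 1 := by
  have hn' : (0 : ℝ) < n := by exact_mod_cast hn
  have := isProbabilityMeasure_stdGamma hn'
  obtain ⟨h1, h2, -⟩ := integral_div_pow hn
  have hi0 : Integrable (fun _ : ℝ => (1 : ℝ)) (stdGamma n) := integrable_const _
  have hi1 : Integrable (fun s : ℝ => s / n) (stdGamma n) := by simpa using integrable_div_pow hn 1
  have hi2 := integrable_div_pow hn 2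
  constructor
  · have hle : ∫ s : ℝ, ((3 / 2) * (s / n) - (s / n) ^ 2 / 2) ∂stdGamma n ≤
        ∫ s : ℝ, Real.sqrt (s / n) ∂stdGamma n := by
      refine integral_mono_ae ((hi1.const_mul _).sub (hi2.div_const _)) (integrable_sqrt_div hn) ?_
      filter_upwards [ae_nonneg_stdGamma] with s hs
      have hy : 0 ≤ s / n := by positivity
      have hq := Real.sq_sqrt hy
      have hq0 := Real.sqrt_nonneg (s / n)
      set q := Real.sqrt (s / n)
      rw [← hq]
      have : 0 ≤ q * (q - 1) ^ 2 * (q + 2) := by positivity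
      nlinarith
    rw [integral_sub (hi1.const_mul _) (hi2.div_const _), integral_const_mul, h1,
      integral_div, h2] at hle
    refine le_trans (le_of_eq ?_) hle
    field_simp
    ring
  · have hle : ∫ s : ℝ, Real.sqrt (s / n) ∂stdGamma n ≤
        ∫ s : ℝ, ((1 / 2) * 1 + (1 / 2) * (s / n)) ∂stdGamma n := by
      refine integral_mono_ae (integrable_sqrt_div hn) ((hi0.const_mul _).add (hi1.const_mul _)) ?_
      filter_upwards [ae_nonneg_stdGamma] with s hs
      have hy : 0 ≤ s / n := by positivity
      have hq := Real.sq_sqrt hy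
      nlinarith [sq_nonneg (Real.sqrt (s / n) - 1)]
    rw [integral_add (hi0.const_mul _) (hi1.const_mul _), integral_const_mul, integral_const_mul,
      h1, integral_one_stdGamma hn] at hle
    linarith

/-- If `q_n` is the mean, `Γ(x+1) = xΓ(x)` gives `q_{n+1}² = q_n² (n+1/2)²/(n(n+1))`. Hence `(q_n/(1
- 1/(8n)))²` decreases, and its limit is `1`. -/
theorem le_integral_sqrt_div (hn : 1 ≤ n) :
    1 - 1 / (8 * n) ≤ ∫ s : ℝ, Real.sqrt (s / n) ∂stdGamma n := by
  set q : ℕ → ℝ := fun k => ∫ s : ℝ, Real.sqrt (s / (k : ℝ)) ∂stdGamma k with hq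
  set c : ℕ → ℝ := fun k => 1 - 1 / (8 * (k : ℝ)) with hc
  have hcpos : ∀ k : ℕ, 0 < c (k + 1) := fun k => by
    have : (1 : ℝ) / (8 * ((k + 1 : ℕ) : ℝ)) < 1 := by
      rw [div_lt_one (by positivity)]
      push_cast
      have : (0 : ℝ) ≤ k := k.cast_nonneg
      linarith
    simp only [hc]
    linarith
  have hqpos : ∀ k : ℕ, 0 ≤ q (k + 1) := fun k => integral_nonneg fun _ => Real.sqrt_nonneg _
  have hrec : ∀ k : ℕ, q (k + 1 + 1) ^ 2 =
      q (k + 1) ^ 2 * (((k + 1 : ℝ) + 1 / 2) ^ 2 / ((k + 1) * (k + 1 + 1))) := fun k => by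
    have e1 := integral_sqrt_div_sq (n := k + 1) (by omega)
    have e2 := integral_sqrt_div_sq (n := k + 1 + 1) (by omega)
    simp only [hq]
    rw [e1, e2]
    have hk : (0 : ℝ) < k + 1 := by positivity
    push_cast
    rw [show (k + 1 + 1 + 1 / 2 : ℝ) = (k + 1 + 1 / 2) + 1 by ring,
      Real.Gamma_add_one (by positivity), Real.Gamma_add_one hk.ne']
    have hG := (Real.Gamma_pos_of_pos hk).ne'
    field_simp
  have hm : Antitone (fun k : ℕ => (q (k + 1) / c (k + 1)) ^ 2) := by
    refine antitone_nat_of_succ_le fun k => ?_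
    rw [div_pow, div_pow, hrec, div_le_div_iff₀ (pow_pos (hcpos _) 2) (pow_pos (hcpos _) 2)]
    have hk : (0 : ℝ) ≤ k := k.cast_nonneg
    rw [mul_assoc]
    refine mul_le_mul_of_nonneg_left ?_ (sq_nonneg _)
    simp only [hc]
    push_cast
    rw [div_mul_eq_mul_div, div_le_iff₀ (by positivity)]
    have e1 : (1 : ℝ) - 1 / (8 * (k + 1)) = (8 * (k + 1) - 1) / (8 * (k + 1)) := by field_simp
    have e2 : (1 : ℝ) - 1 / (8 * (k + 1 + 1)) = (8 * (k + 1) + 7) / (8 * (k + 1 + 1)) := by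
      field_simp
      ring
    rw [e1, e2, div_pow, div_pow, mul_div_assoc', div_mul_eq_mul_div,
      div_le_div_iff₀ (by positivity) (by positivity)]
    rw [← sub_nonneg]
    have e3 : 0 ≤ 16 * ((k : ℝ) + 1 + 1) * (8 * k ^ 2 + 27 * k + 18) := by positivity
    refine e3.trans (le_of_eq ?_)
    ring
  have ht0 : Tendsto (fun k : ℕ => (1 : ℝ) / ((k + 1 : ℕ) : ℝ)) atTop (𝓝 0) := by
    simpa using tendsto_one_div_add_atTop_nhds_zero_nat (𝕜 := ℝ)
  have htq : Tendsto (fun k => q (k + 1)) atTop (𝓝 1) := by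
    refine tendsto_of_tendsto_of_tendsto_of_le_of_le (?_ : Tendsto
      (fun k : ℕ => 1 - (1 / 2) * ((1 : ℝ) / ((k + 1 : ℕ) : ℝ))) atTop (𝓝 1)) tendsto_const_nhds
      (fun k => ?_) (fun k => ?_)
    · have := (ht0.const_mul (1 / 2)).const_sub 1
      simp only [mul_zero, sub_zero] at this
      exact this
    · refine le_trans (le_of_eq ?_) (integral_sqrt_div_bounds (n := k + 1) (by omega)).1
      field_simp
    · exact (integral_sqrt_div_bounds (n := k + 1) (by omega)).2
  have htc : Tendsto (fun k => c (k + 1)) atTop (𝓝 1) := by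
    have := (ht0.const_mul (1 / 8)).const_sub 1
    simp only [mul_zero, sub_zero] at this
    refine this.congr fun k => ?_
    simp only [hc]
    field_simp
  have ht := (htq.div htc one_ne_zero).pow 2
  simp only [div_one, one_pow] at ht
  obtain ⟨k, rfl⟩ : ∃ k, n = k + 1 := ⟨n - 1, by omega⟩
  have h1 := hm.le_of_tendsto ht k
  rw [one_le_sq_iff₀ (div_nonneg (hqpos k) (hcpos k).le), one_le_div (hcpos k)] at h1
  exact h1

end GammaMean

/-! ### Gamma means of the explicit Taylor remainders -/

section Remainders

variable {n : ℕ}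

/-- The second order Taylor remainder at `1` of a second antiderivative of `s⁻²`. -/
def logRemainder (s : ℝ) : ℝ := s - 1 - Real.log s

/-- The second order Taylor remainder at `1` of a second antiderivative of `s^(-3/2)`. -/
def sqrtRemainder (s : ℝ) : ℝ := 4 * (1 - Real.sqrt s) + 2 * (s - 1)

/-- The second order Taylor remainder at `1` of a second antiderivative of `s⁻¹`. -/
def mulLogRemainder (s : ℝ) : ℝ := s * Real.log s - s + 1

/-- The fourth order Taylor remainder at `1` of a fourth antiderivative of `s⁻⁴`. -/
def logRemainder₄ (s : ℝ) : ℝ :=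
  (logRemainder s - (s - 1) ^ 2 / 2 + (s - 1) ^ 3 / 3) / 6

/-- The fourth order Taylor remainder at `1` of a fourth antiderivative of `s⁻³`. -/
def mulLogRemainder₄ (s : ℝ) : ℝ :=
  (mulLogRemainder s - (s - 1) ^ 2 / 2 + (s - 1) ^ 3 / 6) / 2

theorem integrable_sub_one_pow (hn : 1 ≤ n) (k : ℕ) :
    Integrable (fun s : ℝ => (s / n - 1) ^ k) (stdGamma n) := by
  simp only [sub_eq_add_neg, add_pow]
  exact integrable_finsetSum _ fun i _ => ((integrable_div_pow hn i).mul_const _).mul_const _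

theorem integral_sub_one (hn : 1 ≤ n) : ∫ s : ℝ, (s / n - 1) ∂stdGamma n = 0 := by
  have := isProbabilityMeasure_stdGamma (a := n) (by exact_mod_cast hn)
  have hi1 : Integrable (fun s : ℝ => s / n) (stdGamma n) := by simpa using integrable_div_pow hn 1
  rw [integral_sub hi1 (integrable_const _), (integral_div_pow hn).1, integral_one_stdGamma hn,
    sub_self]

theorem integral_sub_one_sq (hn : 1 ≤ n) :
    ∫ s : ℝ, (s / n - 1) ^ 2 ∂stdGamma n = 1 / (n : ℝ) := by
  have hi1 := integrable_sub_one_pow hn 1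
  simp only [pow_one] at hi1
  have := isProbabilityMeasure_stdGamma (a := n) (by exact_mod_cast hn)
  have e : ∀ s : ℝ, (s / n - 1) ^ 2 = (s / n) ^ 2 - 2 * (s / n - 1) - 1 := fun s => by ring
  simp only [e]
  have hi : Integrable (fun s : ℝ => (s / n) ^ 2 - 2 * (s / n - 1)) (stdGamma n) :=
    (integrable_div_pow hn 2).sub (hi1.const_mul 2)
  rw [integral_sub hi (integrable_const _), integral_sub (integrable_div_pow hn 2) (hi1.const_mul 2),
    integral_const_mul,
    integral_sub_one hn, (integral_div_pow hn).2.1, integral_one_stdGamma hn]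
  ring

theorem integral_sub_one_cube (hn : 1 ≤ n) :
    ∫ s : ℝ, (s / n - 1) ^ 3 ∂stdGamma n = 2 / (n : ℝ) ^ 2 := by
  have hi1 := integrable_sub_one_pow hn 1
  have hi2 := integrable_sub_one_pow hn 2
  simp only [pow_one] at hi1
  have := isProbabilityMeasure_stdGamma (a := n) (by exact_mod_cast hn)
  have e : ∀ s : ℝ, (s / n - 1) ^ 3 =
      (s / n) ^ 3 - 3 * (s / n - 1) ^ 2 - 3 * (s / n - 1) - 1 := fun s => by ring
  simp only [e]
  have hi' : Integrable (fun s : ℝ => (s / n) ^ 3 - 3 * (s / n - 1) ^ 2) (stdGamma n) :=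
    (integrable_div_pow hn 3).sub (hi2.const_mul 3)
  have hi : Integrable (fun s : ℝ => (s / n) ^ 3 - 3 * (s / n - 1) ^ 2 - 3 * (s / n - 1))
    (stdGamma n) := hi'.sub (hi1.const_mul 3)
  rw [integral_sub hi (integrable_const _), integral_sub hi' (hi1.const_mul 3),
    integral_sub (integrable_div_pow hn 3) (hi2.const_mul 3),
    integral_const_mul, integral_const_mul, integral_sub_one hn, integral_sub_one_sq hn,
    (integral_div_pow hn).2.2, integral_one_stdGamma hn]
  ring

theorem integrable_logRemainder (hn : 1 ≤ n) :
    Integrable (fun s : ℝ => logRemainder (s / n)) (stdGamma n) := by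
  have hi1 := integrable_sub_one_pow hn 1
  simp only [pow_one] at hi1
  exact hi1.sub (integrable_log_div hn)

theorem integrable_sqrtRemainder (hn : 1 ≤ n) :
    Integrable (fun s : ℝ => sqrtRemainder (s / n)) (stdGamma n) := by
  have := isProbabilityMeasure_stdGamma (a := n) (by exact_mod_cast hn)
  have hi1 := integrable_sub_one_pow hn 1
  simp only [pow_one] at hi1
  exact (((integrable_const 1).sub (integrable_sqrt_div hn)).const_mul 4).add (hi1.const_mul 2)

theorem integrable_mulLogRemainder (hn : 1 ≤ n) :
    Integrable (fun s : ℝ => mulLogRemainder (s / n)) (stdGamma n) := by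
  have hi1 := integrable_sub_one_pow hn 1
  simp only [pow_one] at hi1
  refine ((integrable_mul_log_div hn).sub hi1).congr (ae_of_all _ fun s => ?_)
  simp only [Pi.sub_apply, mulLogRemainder]
  ring

theorem integrable_logRemainder₄ (hn : 1 ≤ n) :
    Integrable (fun s : ℝ => logRemainder₄ (s / n)) (stdGamma n) :=
  (((integrable_logRemainder hn).sub ((integrable_sub_one_pow hn 2).div_const 2)).add
    ((integrable_sub_one_pow hn 3).div_const 3)).div_const 6

theorem integrable_mulLogRemainder₄ (hn : 1 ≤ n) :
    Integrable (fun s : ℝ => mulLogRemainder₄ (s / n)) (stdGamma n) :=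
  (((integrable_mulLogRemainder hn).sub ((integrable_sub_one_pow hn 2).div_const 2)).add
    ((integrable_sub_one_pow hn 3).div_const 6)).div_const 2

theorem integral_logRemainder (hn : 1 ≤ n) :
    ∫ s : ℝ, logRemainder (s / n) ∂stdGamma n = 1 / n - harmonicError n := by
  have hi1 := integrable_sub_one_pow hn 1
  simp only [pow_one] at hi1
  simp only [logRemainder]
  rw [integral_sub hi1 (integrable_log_div hn), integral_sub_one hn, integral_log_div hn]
  ring

theorem integral_logRemainder_le (hn : 1 ≤ n) :
    ∫ s : ℝ, logRemainder (s / n) ∂stdGamma n ≤ 1 / (2 * n) + 1 / (12 * (n : ℝ) ^ 2) := by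
  rw [integral_logRemainder hn]
  have h := le_harmonicError n hn
  have e : (1 : ℝ) / n = 1 / (2 * n) + 1 / (2 * n) := by field_simp; norm_num
  linarith

theorem integral_sqrtRemainder_le (hn : 1 ≤ n) :
    ∫ s : ℝ, sqrtRemainder (s / n) ∂stdGamma n ≤ 1 / (2 * n) := by
  have := isProbabilityMeasure_stdGamma (a := n) (by exact_mod_cast hn)
  have hi1 := integrable_sub_one_pow hn 1
  simp only [pow_one] at hi1
  simp only [sqrtRemainder]
  have hi : Integrable (fun s : ℝ => 4 * (1 - Real.sqrt (s / n))) (stdGamma n) :=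
    ((integrable_const 1).sub (integrable_sqrt_div hn)).const_mul 4
  rw [integral_add hi (hi1.const_mul 2),
    integral_const_mul, integral_const_mul,
    integral_sub (integrable_const 1) (integrable_sqrt_div hn), integral_one_stdGamma hn,
    integral_sub_one hn]
  have h := le_integral_sqrt_div hn
  have e : (1 : ℝ) / (2 * n) = 4 * (1 / (8 * n)) := by field_simp; norm_num
  linarith

theorem integral_mulLogRemainder (hn : 1 ≤ n) :
    ∫ s : ℝ, mulLogRemainder (s / n) ∂stdGamma n = harmonicError n := by
  have hi1 := integrable_sub_one_pow hn 1
  simp only [pow_one] at hi1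
  have e : ∀ s : ℝ, mulLogRemainder (s / n) = s / n * Real.log (s / n) - (s / n - 1) := fun s => by
    simp only [mulLogRemainder]
    ring
  simp only [e]
  rw [integral_sub (integrable_mul_log_div hn) hi1, integral_sub_one hn, integral_mul_log_div hn,
    sub_zero]

theorem integral_mulLogRemainder_le (hn : 1 ≤ n) :
    ∫ s : ℝ, mulLogRemainder (s / n) ∂stdGamma n ≤ 1 / (2 * n) := by
  rw [integral_mulLogRemainder hn]
  exact harmonicError_le n hn

/-- Half the variance cancels the leading `1/(2n)`. What is left is `1/(12n²)`, plus a third of the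
third moment `2/n²`, all divided by `6`. -/
theorem integral_logRemainder₄_le (hn : 1 ≤ n) :
    ∫ s : ℝ, logRemainder₄ (s / n) ∂stdGamma n ≤ 1 / (8 * (n : ℝ) ^ 2) := by
  have hi2 := (integrable_sub_one_pow hn 2).div_const 2
  have hi3 := (integrable_sub_one_pow hn 3).div_const 3
  simp only [logRemainder₄]
  have hi : Integrable (fun s : ℝ => logRemainder (s / n) - (s / n - 1) ^ 2 / 2) (stdGamma n) :=
    (integrable_logRemainder hn).sub hi2
  rw [integral_div, integral_add hi hi3,
    integral_sub (integrable_logRemainder hn) hi2, integral_div, integral_div,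
    integral_sub_one_sq hn, integral_sub_one_cube hn]
  have h := integral_logRemainder_le hn
  have hn' : (0 : ℝ) < n := by exact_mod_cast hn
  have e1 : (1 : ℝ) / n / 2 = 1 / (2 * n) := by field_simp
  have e2 : (1 : ℝ) / (8 * n ^ 2) = (1 / (12 * (n : ℝ) ^ 2) + 2 / n ^ 2 / 3) / 6 := by
    field_simp; norm_num
  rw [e1, e2]
  linarith

/-- Here too the `1/(2n)` terms cancel, leaving only the third-moment contribution. -/
theorem integral_mulLogRemainder₄_le (hn : 1 ≤ n) :
    ∫ s : ℝ, mulLogRemainder₄ (s / n) ∂stdGamma n ≤ 1 / (6 * (n : ℝ) ^ 2) := by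
  have hi2 := (integrable_sub_one_pow hn 2).div_const 2
  have hi3 := (integrable_sub_one_pow hn 3).div_const 6
  simp only [mulLogRemainder₄]
  have hi : Integrable (fun s : ℝ => mulLogRemainder (s / n) - (s / n - 1) ^ 2 / 2) (stdGamma n) :=
    (integrable_mulLogRemainder hn).sub hi2
  rw [integral_div, integral_add hi hi3,
    integral_sub (integrable_mulLogRemainder hn) hi2, integral_div, integral_div,
    integral_sub_one_sq hn, integral_sub_one_cube hn]
  have h := integral_mulLogRemainder_le hn
  have hn' : (0 : ℝ) < n := by exact_mod_cast hn
  have e1 : (1 : ℝ) / n / 2 = 1 / (2 * n) := by field_simp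
  have e2 : (1 : ℝ) / (6 * n ^ 2) = (2 / n ^ 2 / 6) / 2 := by
    field_simp
  rw [e1, e2]
  linarith

end Remainders

/-! ### Comparison of Taylor remainders -/

section Taylor

variable {E : Type*} [NormedAddCommGroup E] [NormedSpace ℝ E]

/-- `f'' = f₂` on `(0, ∞)` with `f' = f₁`, and `f(1) = f'(1) = 0`. -/
structure IsTaylorRemainder (f f₁ f₂ : ℝ → E) : Prop where
  hasDerivAt : ∀ s : ℝ, 0 < s → HasDerivAt f (f₁ s) s
  hasDerivAt_deriv : ∀ s : ℝ, 0 < s → HasDerivAt f₁ (f₂ s) s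
  zero : f 1 = 0
  deriv_zero : f₁ 1 = 0

namespace IsTaylorRemainder

variable {f f₁ f₂ : ℝ → E} {g g₁ g₂ g₃ g₄ : ℝ → E} {h h₁ h₂ h₃ h₄ : ℝ → ℝ}

theorem add (hf : IsTaylorRemainder f f₁ f₂) (hg : IsTaylorRemainder g g₁ g₂) :
    IsTaylorRemainder (fun s => f s + g s) (fun s => f₁ s + g₁ s) (fun s => f₂ s + g₂ s) where
  hasDerivAt s hs := (hf.hasDerivAt s hs).add (hg.hasDerivAt s hs)
  hasDerivAt_deriv s hs := (hf.hasDerivAt_deriv s hs).add (hg.hasDerivAt_deriv s hs)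
  zero := by rw [hf.zero, hg.zero, add_zero]
  deriv_zero := by rw [hf.deriv_zero, hg.deriv_zero, add_zero]

theorem const_mul (hh : IsTaylorRemainder h h₁ h₂) (c : ℝ) :
    IsTaylorRemainder (fun s => c * h s) (fun s => c * h₁ s) (fun s => c * h₂ s) where
  hasDerivAt s hs := (hh.hasDerivAt s hs).const_mul c
  hasDerivAt_deriv s hs := (hh.hasDerivAt_deriv s hs).const_mul c
  zero := by rw [hh.zero, mul_zero]
  deriv_zero := by rw [hh.deriv_zero, mul_zero]

/-- The derivative is increasing and vanishes at `1`, so the function has its minimum, zero, there.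
-/
theorem nonneg (hh : IsTaylorRemainder h h₁ h₂) (h0 : ∀ s : ℝ, 0 < s → 0 ≤ h₂ s) {s : ℝ}
    (hs : 0 < s) : 0 ≤ h s := by
  have hm : MonotoneOn h₁ (Ioi 0) :=
    monotoneOn_of_hasDerivWithinAt_nonneg (convex_Ioi 0)
      (fun x hx => (hh.hasDerivAt_deriv x hx).continuousAt.continuousWithinAt)
      (fun x hx => (hh.hasDerivAt_deriv x (interior_subset hx)).hasDerivWithinAt)
      fun x hx => h0 x (interior_subset hx)
  rcases le_total 1 s with h1 | h1
  · have : MonotoneOn h (Ici 1) :=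
      monotoneOn_of_hasDerivWithinAt_nonneg (convex_Ici 1)
        (fun x hx => (hh.hasDerivAt x (one_pos.trans_le hx)).continuousAt.continuousWithinAt)
        (fun x hx => (hh.hasDerivAt x (one_pos.trans_le (interior_subset hx))).hasDerivWithinAt)
        fun x hx => by
          have hx : 1 ≤ x := interior_subset hx
          rw [← hh.deriv_zero]
          exact hm (mem_Ioi.2 one_pos) (one_pos.trans_le hx) hx
    rw [← hh.zero]
    exact this self_mem_Ici h1 h1
  · have : AntitoneOn h (Ioc 0 1) :=
      antitoneOn_of_hasDerivWithinAt_nonpos (convex_Ioc 0 1)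
        (fun x hx => (hh.hasDerivAt x hx.1).continuousAt.continuousWithinAt)
        (fun x hx => (hh.hasDerivAt x (interior_subset hx).1).hasDerivWithinAt)
        fun x hx => by
          have hx := interior_subset hx
          rw [← hh.deriv_zero]
          exact hm hx.1 (mem_Ioi.2 one_pos) hx.2
    rw [← hh.zero]
    exact this ⟨hs, h1⟩ ⟨one_pos, le_rfl⟩ h1

/-- A norming functional for `f s` reduces the vector inequality to the scalar one for `h - ℓ ∘ f`.
Comparing differential inequalities avoids any integral form of the remainder. -/
theorem norm_le (hf : IsTaylorRemainder f f₁ f₂) (hh : IsTaylorRemainder h h₁ h₂)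
    (hle : ∀ s : ℝ, 0 < s → ‖f₂ s‖ ≤ h₂ s) {s : ℝ} (hs : 0 < s) : ‖f s‖ ≤ h s := by
  obtain ⟨ℓ, hℓ, hℓs⟩ := exists_dual_vector'' ℝ (f s)
  have hd : IsTaylorRemainder (fun r => h r - ℓ (f r)) (fun r => h₁ r - ℓ (f₁ r))
      (fun r => h₂ r - ℓ (f₂ r)) :=
    { hasDerivAt := fun r hr =>
        (hh.hasDerivAt r hr).sub (ℓ.hasFDerivAt.comp_hasDerivAt r (hf.hasDerivAt r hr))
      hasDerivAt_deriv := fun r hr =>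
        (hh.hasDerivAt_deriv r hr).sub (ℓ.hasFDerivAt.comp_hasDerivAt r (hf.hasDerivAt_deriv r hr))
      zero := by rw [hh.zero, hf.zero, _root_.map_zero, sub_zero]
      deriv_zero := by rw [hh.deriv_zero, hf.deriv_zero, _root_.map_zero, sub_zero] }
  have := hd.nonneg (fun r hr => sub_nonneg.2 ?_) hs
  · rw [hℓs] at this
    simpa using this
  · calc ℓ (f₂ r) ≤ ‖ℓ (f₂ r)‖ := Real.le_norm_self _
      _ ≤ 1 * ‖f₂ r‖ := ℓ.le_of_opNorm_le hℓ _
      _ ≤ h₂ r := by rw [one_mul]; exact hle r hr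

end IsTaylorRemainder

theorem hasDerivAt_inv_pow {s : ℝ} (hs : 0 < s) (k : ℕ) :
    HasDerivAt (fun s : ℝ => (s ^ k)⁻¹) (-(k * (s ^ (k + 1))⁻¹)) s := by
  refine ((hasDerivAt_pow k s).inv (pow_ne_zero k hs.ne')).congr_deriv ?_
  rcases k with _ | k
  · simp
  · rw [Nat.add_sub_cancel]
    field_simp
    ring

theorem isTaylorRemainder_logRemainder :
    IsTaylorRemainder logRemainder (fun s => 1 - (s ^ 1)⁻¹) (fun s => (s ^ 2)⁻¹) where
  hasDerivAt s hs := by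
    refine (((hasDerivAt_id s).sub_const 1).sub (Real.hasDerivAt_log hs.ne')).congr_deriv ?_
    rw [pow_one]
  hasDerivAt_deriv s hs := by
    refine ((hasDerivAt_inv_pow hs 1).const_sub 1).congr_deriv ?_
    simp
  zero := by simp [logRemainder]
  deriv_zero := by simp

theorem isTaylorRemainder_mulLogRemainder :
    IsTaylorRemainder mulLogRemainder Real.log (fun s => (s ^ 1)⁻¹) where
  hasDerivAt s hs := by
    refine (((Real.hasDerivAt_mul_log hs.ne').sub (hasDerivAt_id s)).add_const 1).congr_deriv ?_
    ring
  hasDerivAt_deriv s hs := by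
    rw [pow_one]
    exact Real.hasDerivAt_log hs.ne'
  zero := by simp [mulLogRemainder]
  deriv_zero := Real.log_one

theorem isTaylorRemainder_sqrtRemainder :
    IsTaylorRemainder sqrtRemainder (fun s => 2 - 2 * s ^ (-(1 / 2) : ℝ))
      (fun s => s ^ (-(3 / 2) : ℝ)) where
  hasDerivAt s hs := by
    refine ((((Real.hasDerivAt_sqrt hs.ne').const_sub 1).const_mul 4).add
      (((hasDerivAt_id s).sub_const 1).const_mul 2)).congr_deriv ?_
    rw [Real.rpow_neg hs.le, ← Real.sqrt_eq_rpow]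
    have := Real.sqrt_pos.2 hs
    field_simp
    ring
  hasDerivAt_deriv s hs := by
    refine (((Real.hasDerivAt_rpow_const (Or.inl hs.ne')).const_mul 2).const_sub 2).congr_deriv ?_
    norm_num
    ring
  zero := by simp [sqrtRemainder]
  deriv_zero := by simp

theorem isTaylorRemainder_sub_one_sq :
    IsTaylorRemainder (fun s : ℝ => (s - 1) ^ 2) (fun s => 2 * (s - 1)) (fun _ => 2) where
  hasDerivAt s hs := by
    refine (((hasDerivAt_id s).sub_const 1).pow 2).congr_deriv ?_
    simp
  hasDerivAt_deriv s hs := by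
    refine (((hasDerivAt_id s).sub_const 1).const_mul 2).congr_deriv ?_
    simp
  zero := by simp
  deriv_zero := by simp

theorem isTaylorRemainder_sub_one_cube :
    IsTaylorRemainder (fun s : ℝ => (s - 1) ^ 3) (fun s => 3 * (s - 1) ^ 2)
      (fun s => 6 * (s - 1)) where
  hasDerivAt s hs := by
    refine (((hasDerivAt_id s).sub_const 1).pow 3).congr_deriv ?_
    simp
  hasDerivAt_deriv s hs := by
    refine ((((hasDerivAt_id s).sub_const 1).pow 2).const_mul 3).congr_deriv ?_
    simp
    ring
  zero := by simp
  deriv_zero := by simp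

theorem exists_isTaylorRemainder_logRemainder₄ : ∃ h₁ h₂ h₃ : ℝ → ℝ,
    IsTaylorRemainder logRemainder₄ h₁ h₂ ∧ IsTaylorRemainder h₂ h₃ (fun s => (s ^ 4)⁻¹) := by
  refine ⟨fun s => 1 / 6 * (1 - (s ^ 1)⁻¹ + -1 / 2 * (2 * (s - 1)) + 1 / 3 * (3 * (s - 1) ^ 2)),
    fun s => ((s ^ 2)⁻¹ - 1 + 2 * (s - 1)) / 6, fun s => (2 - 2 * (s ^ 3)⁻¹) / 6, ?_, ?_⟩
  · have := (((isTaylorRemainder_logRemainder.add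
      (isTaylorRemainder_sub_one_sq.const_mul (-1 / 2))).add
      (isTaylorRemainder_sub_one_cube.const_mul (1 / 3))).const_mul (1 / 6))
    convert this using 1
    · funext s
      simp only [logRemainder₄]
      ring
    · funext s
      ring
  · constructor
    · intro s hs
      refine ((((hasDerivAt_inv_pow hs 2).sub_const 1).add
        (((hasDerivAt_id s).sub_const 1).const_mul 2)).div_const 6).congr_deriv ?_
      push_cast
      ring
    · intro s hs
      refine ((((hasDerivAt_inv_pow hs 3).const_mul 2).const_sub 2).div_const 6).congr_deriv ?_
      push_cast
      ring
    · norm_num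
    · norm_num

theorem exists_isTaylorRemainder_mulLogRemainder₄ : ∃ h₁ h₂ h₃ : ℝ → ℝ,
    IsTaylorRemainder mulLogRemainder₄ h₁ h₂ ∧ IsTaylorRemainder h₂ h₃ (fun s => (s ^ 3)⁻¹) := by
  refine ⟨fun s => 1 / 2 * (Real.log s + -1 / 2 * (2 * (s - 1)) + 1 / 6 * (3 * (s - 1) ^ 2)),
    fun s => ((s ^ 1)⁻¹ - 1 + (s - 1)) / 2, fun s => (1 - (s ^ 2)⁻¹) / 2, ?_, ?_⟩
  · have := (((isTaylorRemainder_mulLogRemainder.add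
      (isTaylorRemainder_sub_one_sq.const_mul (-1 / 2))).add
      (isTaylorRemainder_sub_one_cube.const_mul (1 / 6))).const_mul (1 / 2))
    convert this using 1
    · funext s
      simp only [mulLogRemainder₄]
      ring
    · funext s
      ring
  · constructor
    · intro s hs
      refine ((((hasDerivAt_inv_pow hs 1).sub_const 1).add
        ((hasDerivAt_id s).sub_const 1)).div_const 2).congr_deriv ?_
      push_cast
      ring
    · intro s hs
      refine (((hasDerivAt_inv_pow hs 2).const_sub 1).div_const 2).congr_deriv ?_
      push_cast
      ring
    · norm_num
    · norm_num

end Taylor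

/-! ### Scalar majorants by interpolation of exponents -/

section Interpolation

theorem rpow_le_interpolate {s a b p q r : ℝ} (hs : 0 < s) (ha : 0 ≤ a) (hb : 0 ≤ b)
    (hab : a + b = 1) (hr : r = a * p + b * q) : s ^ r ≤ a * s ^ p + b * s ^ q := by
  have := Real.geom_mean_le_arith_mean2_weighted ha hb (Real.rpow_pos_of_pos hs p).le
    (Real.rpow_pos_of_pos hs q).le hab
  rwa [← Real.rpow_mul hs.le, ← Real.rpow_mul hs.le, ← Real.rpow_add hs, mul_comm p, mul_comm q,
    ← hr] at this

theorem rpow_neg_natCast' {s : ℝ} (k : ℕ) {p : ℝ} (hp : p = -k) (hs : 0 < s) :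
    s ^ p = (s ^ k)⁻¹ := by
  rw [hp, Real.rpow_neg hs.le, Real.rpow_natCast]

/-- The scalar majorant of the second order Taylor remainder. -/
theorem exists_eulerRate_majorant {α : ℝ} (h0 : 0 ≤ α) (h1 : α ≤ 1) {n : ℕ} (hn : 1 ≤ n) :
    ∃ g g₁ g₂ : ℝ → ℝ, IsTaylorRemainder g g₁ g₂ ∧ (∀ s : ℝ, 0 < s → s ^ (α - 2) ≤ g₂ s) ∧
      Integrable (fun s : ℝ => g (s / n)) (stdGamma n) ∧
      ∫ s : ℝ, g (s / n) ∂stdGamma n ≤ eulerRate α n := by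
  -- The exponent `α - 2` is interpolated between `-2` and `-3/2` for `α < 1/2`, with weights `1 -
  -- 2α` and `2α`. Otherwise it is interpolated between `-3/2` and `-1`, with weights `2 - 2α` and
  -- `2α - 1`.
  rcases lt_or_ge α (1 / 2) with h | h
  · refine ⟨_, _, _, (isTaylorRemainder_logRemainder.const_mul (1 - 2 * α)).add
      (isTaylorRemainder_sqrtRemainder.const_mul (2 * α)), fun s hs => ?_,
      ((integrable_logRemainder hn).const_mul _).add ((integrable_sqrtRemainder hn).const_mul _), ?_⟩
    · rw [← rpow_neg_natCast' 2 rfl hs]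
      refine rpow_le_interpolate hs (by linarith) (by linarith) (by ring) ?_
      push_cast
      ring
    · rw [integral_add ((integrable_logRemainder hn).const_mul _)
        ((integrable_sqrtRemainder hn).const_mul _), integral_const_mul, integral_const_mul,
        eulerRate, if_pos h]
      have e1 := mul_le_mul_of_nonneg_left (integral_logRemainder_le hn)
        (by linarith : 0 ≤ 1 - 2 * α)
      have e2 := mul_le_mul_of_nonneg_left (integral_sqrtRemainder_le hn)
        (by linarith : 0 ≤ 2 * α)
      refine (add_le_add e1 e2).trans (le_of_eq ?_)
      ring
  · refine ⟨_, _, _, (isTaylorRemainder_sqrtRemainder.const_mul (2 - 2 * α)).add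
      (isTaylorRemainder_mulLogRemainder.const_mul (2 * α - 1)), fun s hs => ?_,
      ((integrable_sqrtRemainder hn).const_mul _).add
        ((integrable_mulLogRemainder hn).const_mul _), ?_⟩
    · rw [← rpow_neg_natCast' 1 rfl hs]
      refine rpow_le_interpolate hs (by linarith) (by linarith) (by ring) ?_
      push_cast
      ring
    · rw [integral_add ((integrable_sqrtRemainder hn).const_mul _)
        ((integrable_mulLogRemainder hn).const_mul _), integral_const_mul, integral_const_mul,
        eulerRate, if_neg (not_lt.2 h)]
      have e1 := mul_le_mul_of_nonneg_left (integral_sqrtRemainder_le hn)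
        (by linarith : 0 ≤ 2 - 2 * α)
      have e2 := mul_le_mul_of_nonneg_left (integral_mulLogRemainder_le hn)
        (by linarith : 0 ≤ 2 * α - 1)
      refine (add_le_add e1 e2).trans (le_of_eq ?_)
      ring

/-- The scalar majorant of the fourth order Taylor remainder. -/
theorem exists_fourth_order_majorant {α : ℝ} (h0 : 0 ≤ α) (h1 : α ≤ 1) {n : ℕ} (hn : 1 ≤ n) :
    ∃ g g₁ g₂ g₃ g₄ : ℝ → ℝ, IsTaylorRemainder g g₁ g₂ ∧ IsTaylorRemainder g₂ g₃ g₄ ∧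
      (∀ s : ℝ, 0 < s → s ^ (α - 4) ≤ g₄ s) ∧
      Integrable (fun s : ℝ => g (s / n)) (stdGamma n) ∧
      ∫ s : ℝ, g (s / n) ∂stdGamma n ≤ 1 / (6 * (n : ℝ) ^ 2) := by
  obtain ⟨p₁, p₂, p₃, hp, hp'⟩ := exists_isTaylorRemainder_logRemainder₄
  obtain ⟨q₁, q₂, q₃, hq, hq'⟩ := exists_isTaylorRemainder_mulLogRemainder₄
  refine ⟨_, _, _, _, _, (hp.const_mul (1 - α)).add (hq.const_mul α),
    (hp'.const_mul (1 - α)).add (hq'.const_mul α), fun s hs => ?_,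
    ((integrable_logRemainder₄ hn).const_mul _).add
      ((integrable_mulLogRemainder₄ hn).const_mul _), ?_⟩
  · rw [← rpow_neg_natCast' 4 rfl hs, ← rpow_neg_natCast' 3 rfl hs]
    refine rpow_le_interpolate hs (by linarith) h0 (by ring) ?_
    push_cast
    ring
  · rw [integral_add ((integrable_logRemainder₄ hn).const_mul _)
      ((integrable_mulLogRemainder₄ hn).const_mul _), integral_const_mul, integral_const_mul]
    have hn' : (0 : ℝ) < n := by exact_mod_cast hn
    -- A common bound for both endpoints suffices, since the constant here need not be sharp.
    have e0 : (1 : ℝ) / (8 * n ^ 2) ≤ 1 / (6 * n ^ 2) := by gcongr; norm_num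
    have e1 := mul_le_mul_of_nonneg_left ((integral_logRemainder₄_le hn).trans e0)
      (by linarith : 0 ≤ 1 - α)
    have e2 := mul_le_mul_of_nonneg_left (integral_mulLogRemainder₄_le hn) h0
    refine (add_le_add e1 e2).trans (le_of_eq ?_)
    ring

end Interpolation

/-! ### Taylor expansion of the orbit and the two Euler estimates -/

namespace IsTaylorRemainder

variable {E : Type*} [NormedAddCommGroup E] [NormedSpace ℝ E]

theorem smul_const {h h₁ h₂ : ℝ → ℝ} (hh : IsTaylorRemainder h h₁ h₂) (v : E) :
    IsTaylorRemainder (fun s => h s • v) (fun s => h₁ s • v) (fun s => h₂ s • v) where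
  hasDerivAt s hs := (hh.hasDerivAt s hs).smul_const v
  hasDerivAt_deriv s hs := (hh.hasDerivAt_deriv s hs).smul_const v
  zero := by rw [hh.zero, zero_smul]
  deriv_zero := by rw [hh.deriv_zero, zero_smul]

theorem of_hasDerivAt {f f₁ f₂ : ℝ → E} (h1 : ∀ s : ℝ, 0 < s → HasDerivAt f (f₁ s) s)
    (h2 : ∀ s : ℝ, 0 < s → HasDerivAt f₁ (f₂ s) s) :
    IsTaylorRemainder (fun s => f s - f 1 - (s - 1) • f₁ 1) (fun s => f₁ s - f₁ 1) f₂ where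
  hasDerivAt s hs := by
    refine (((h1 s hs).sub_const (f 1)).sub
      (((hasDerivAt_id s).sub_const 1).smul_const (f₁ 1))).congr_deriv ?_
    rw [one_smul]
  hasDerivAt_deriv s hs := (h2 s hs).sub_const _
  zero := by simp
  deriv_zero := sub_self _

end IsTaylorRemainder

theorem ae_div_pos {n : ℕ} (hn : 1 ≤ n) : ∀ᵐ s : ℝ ∂stdGamma n, 0 < s / n := by
  have hn' : (0 : ℝ) < n := by exact_mod_cast hn
  filter_upwards [ae_nonneg_stdGamma] with s hs using div_pos hs hn'

namespace C0Semigroup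

variable {X : Type u} [NormedAddCommGroup X] [NormedSpace ℂ X] {T : C0Semigroup X}

/-- The `k`-th derivative of `s ↦ T(t s) x`. -/
def orbitDeriv (T : C0Semigroup X) (t : ℝ) (x : X) (k : ℕ) (s : ℝ) : X :=
  (-t) ^ k • T.genPow k (t * s) x

theorem orbitDeriv_zero (T : C0Semigroup X) (t : ℝ) (x : X) (s : ℝ) :
    T.orbitDeriv t x 0 s = T.toFun (t * s) x := by
  rw [orbitDeriv, pow_zero, one_smul, genPow_zero]

namespace IsBoundedAnalytic

variable {K C : ℝ} {t : ℝ}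

theorem hasDerivAt_orbitDeriv (h : T.IsBoundedAnalytic K C) (ht : 0 < t) (x : X) (k : ℕ) (s : ℝ)
    (hs : 0 < s) : HasDerivAt (T.orbitDeriv t x k) (T.orbitDeriv t x (k + 1) s) s := by
  have h1 := h.hasDerivAt_genPow_apply k (mul_pos ht hs) x
  have h2 : HasDerivAt (fun s : ℝ => t * s) t s := by
    simpa using (hasDerivAt_id s).const_mul t
  refine ((h1.scomp s h2).const_smul ((-t) ^ k)).congr_deriv ?_
  rw [orbitDeriv, pow_succ]
  module

theorem smoothingConst_mul_nonneg [CompleteSpace X] (h : T.IsBoundedAnalytic K C) {α : ℝ}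
    (hα : 0 ≤ α) {k : ℕ} (hk : α ≤ k) (ht : 0 < t) {x y : X} (hxy : T.IsFracPow α x y) :
    0 ≤ T.smoothingConst (k - α) * t ^ α * ‖y‖ := by
  have := (norm_nonneg _).trans (h.norm_genPow_apply_le hα hk one_pos hxy)
  rw [Real.one_rpow, mul_one] at this
  rw [mul_right_comm]
  exact mul_nonneg this (Real.rpow_nonneg ht.le _)

/-- The powers of `t` combine as `tᵏ(ts)^(α-k) = t^α s^(α-k)`, leaving a pure power of `s` for the
scalar majorants. -/
theorem norm_orbitDeriv_le [CompleteSpace X] (h : T.IsBoundedAnalytic K C) {α : ℝ}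
    (hα : 0 ≤ α) {k : ℕ} (hk : α ≤ k) (ht : 0 < t) {x y : X} (hxy : T.IsFracPow α x y) {s : ℝ} (hs : 0 < s) :
    ‖T.orbitDeriv t x k s‖ ≤ T.smoothingConst (k - α) * t ^ α * ‖y‖ * s ^ (α - k) := by
  have h1 := h.norm_genPow_apply_le hα hk (mul_pos ht hs) hxy
  have h2 : t ^ (α - k) = t ^ α / t ^ k := Real.rpow_sub_natCast ht.ne' α k
  have h3 : 0 < t ^ k := pow_pos ht k
  rw [orbitDeriv, norm_smul, norm_pow, norm_neg, Real.norm_of_nonneg ht.le]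
  refine (mul_le_mul_of_nonneg_left h1 h3.le).trans (le_of_eq ?_)
  rw [Real.mul_rpow ht.le hs.le, h2]
  field_simp

/-- First order Euler remainder as an integral against the Gamma law. -/
theorem integral_taylor_two [CompleteSpace X] (h : T.IsBoundedAnalytic K C) (ht : 0 < t)
    {n : ℕ} (hn : 1 ≤ n) (x v : X) :
    Integrable (fun s : ℝ => T.orbitDeriv t x 0 (s / n) - T.orbitDeriv t x 0 1 - (s / n - 1) • v)
      (stdGamma n) ∧
    ∫ s : ℝ, (T.orbitDeriv t x 0 (s / n) - T.orbitDeriv t x 0 1 - (s / n - 1) • v) ∂stdGamma n =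
      (T.resolvent (t / n) ^ n) x - T.toFun t x := by
  have hn' : (0 : ℝ) < n := by exact_mod_cast hn
  have := isProbabilityMeasure_stdGamma hn'
  have e : ∀ s : ℝ, T.orbitDeriv t x 0 (s / n) = T.toFun (t / n * s) x := fun s => by
    rw [orbitDeriv_zero]
    congr 2
    ring
  simp only [e]
  rw [orbitDeriv_zero, mul_one]
  have i1 := h.bound.integrable_stdGamma (div_pos ht hn') hn x
  have i2 : Integrable (fun s : ℝ => (s / n - 1) • v) (stdGamma n) := by
    simpa using (integrable_sub_one_pow hn 1).smul_const v
  have i3 : Integrable (fun s : ℝ => T.toFun (t / n * s) x - T.toFun t x) (stdGamma n) :=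
    i1.sub (integrable_const _)
  refine ⟨i3.sub i2, ?_⟩
  -- The linear term disappears for every `v` because `s/n` has mean `1`.
  rw [integral_sub i3 i2, integral_sub i1 (integrable_const _), integral_smul_const,
    integral_sub_one hn, zero_smul, sub_zero, h.bound.resolvent_pow_apply (div_pos ht hn') hn x]
  simp

theorem norm_resolvent_pow_sub_le [CompleteSpace X] (h : T.IsBoundedAnalytic K C) {α : ℝ}
    (h0 : 0 ≤ α) (h1 : α ≤ 1) (ht : 0 < t) {n : ℕ} (hn : 1 ≤ n) {x y : X}
    (hxy : T.IsFracPow α x y) :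
    ‖(T.resolvent (t / n) ^ n) x - T.toFun t x‖ ≤
      T.smoothingConst (2 - α) * eulerRate α n * t ^ α * ‖y‖ := by
  obtain ⟨g, g₁, g₂, hg, hg2, hgi, hgle⟩ := exists_eulerRate_majorant h0 h1 hn
  have hk : α ≤ (2 : ℕ) := by push_cast; linarith
  have hN := h.smoothingConst_mul_nonneg h0 hk ht hxy
  have hF := IsTaylorRemainder.of_hasDerivAt (h.hasDerivAt_orbitDeriv ht x 0)
    (h.hasDerivAt_orbitDeriv ht x 1)
  have hle : ∀ s : ℝ, 0 < s → _ := fun s hs => hF.norm_le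
    (hg.const_mul (T.smoothingConst ((2 : ℕ) - α) * t ^ α * ‖y‖)) (fun r hr =>
      (h.norm_orbitDeriv_le h0 hk ht hxy hr).trans
        (mul_le_mul_of_nonneg_left (by simpa using hg2 r hr) hN)) hs
  obtain ⟨-, hI⟩ := h.integral_taylor_two ht hn x (T.orbitDeriv t x 1 1)
  rw [← hI]
  refine (norm_integral_le_of_norm_le (hgi.const_mul _)
    ((ae_div_pos hn).mono fun s hs => hle _ hs)).trans ?_
  rw [integral_const_mul]
  refine (mul_le_mul_of_nonneg_left hgle hN).trans (le_of_eq ?_)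
  push_cast
  ring

/-- The cubic Taylor term is already of order `n⁻²`, so it is bounded directly through `M_{3-α}`;
only the fourth-order remainder needs a majorant. -/
theorem norm_resolvent_pow_sub_sub_le [CompleteSpace X] (h : T.IsBoundedAnalytic K C) {α : ℝ}
    (h0 : 0 ≤ α) (h1 : α ≤ 1) (ht : 0 < t) {n : ℕ} (hn : 1 ≤ n) {x y : X}
    (hxy : T.IsFracPow α x y) :
    ‖(T.resolvent (t / n) ^ n) x - T.toFun t x - (t ^ 2 / (2 * (n : ℝ))) • T.genPow 2 t x‖ ≤
      (T.smoothingConst (3 - α) + T.smoothingConst (4 - α)) * (t ^ α / (n : ℝ) ^ 2) * ‖y‖ := by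
  obtain ⟨g, g₁, g₂, g₃, g₄, hg, hg', hg4, hgi, hgle⟩ := exists_fourth_order_majorant h0 h1 hn
  have hn' : (0 : ℝ) < n := by exact_mod_cast hn
  have hk : α ≤ (4 : ℕ) := by push_cast; linarith
  have hk3 : α ≤ (3 : ℕ) := by push_cast; linarith
  set u := T.orbitDeriv t x with hu
  set N := T.smoothingConst ((4 : ℕ) - α) * t ^ α * ‖y‖ with hN_def
  set N₃ := T.smoothingConst ((3 : ℕ) - α) * t ^ α * ‖y‖ with hN₃_def
  have hN : 0 ≤ N := h.smoothingConst_mul_nonneg h0 hk ht hxy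
  have hN₃ : 0 ≤ N₃ := h.smoothingConst_mul_nonneg h0 hk3 ht hxy
  have hd := h.hasDerivAt_orbitDeriv ht x
  have hF2 := IsTaylorRemainder.of_hasDerivAt (hd 2) (hd 3)
  -- The second-order comparison is used twice: here from `u⁗` to the remainder of `u''`, then from
  -- that to the fourth-order remainder of `u`.
  have hle2 : ∀ s : ℝ, 0 < s → _ := fun s hs => hF2.norm_le (hg'.const_mul N) (fun r hr =>
      (h.norm_orbitDeriv_le h0 hk ht hxy hr).trans
        (mul_le_mul_of_nonneg_left (by simpa using hg4 r hr) hN)) hs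
  have hF := ((IsTaylorRemainder.of_hasDerivAt (hd 0) (hd 1)).add
    ((isTaylorRemainder_sub_one_sq.const_mul (-1 / 2)).smul_const (u 2 1))).add
    ((isTaylorRemainder_sub_one_cube.const_mul (-1 / 6)).smul_const (u 3 1))
  have hle : ∀ s : ℝ, 0 < s → ‖u 0 s - u 0 1 - (s - 1) • u 1 1 +
      (-1 / 2 * (s - 1) ^ 2) • u 2 1 + (-1 / 6 * (s - 1) ^ 3) • u 3 1‖ ≤ N * g s := fun s hs =>
      hF.norm_le (hg.const_mul N) (fun r hr => by
    refine le_trans (le_of_eq ?_) (hle2 r hr)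
    congr 1
    simp only [← hu]
    module) hs
  obtain ⟨hi, hI⟩ := h.integral_taylor_two ht hn x (u 1 1)
  simp only [← hu] at hi hI
  have i2 : Integrable (fun s : ℝ => (-1 / 2 * (s / n - 1) ^ 2) • u 2 1) (stdGamma n) :=
    ((integrable_sub_one_pow hn 2).const_mul _).smul_const _
  have i3 : Integrable (fun s : ℝ => (-1 / 6 * (s / n - 1) ^ 3) • u 3 1) (stdGamma n) :=
    ((integrable_sub_one_pow hn 3).const_mul _).smul_const _
  have i12 : Integrable (fun s : ℝ => u 0 (s / n) - u 0 1 - (s / n - 1) • u 1 1 +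
      (-1 / 2 * (s / n - 1) ^ 2) • u 2 1) (stdGamma n) := hi.add i2
  have hint := norm_integral_le_of_norm_le (hgi.const_mul N)
    ((ae_div_pos hn).mono fun s hs => hle _ hs)
  rw [integral_const_mul, integral_add i12 i3, integral_add hi i2, hI, integral_smul_const,
    integral_smul_const, integral_const_mul, integral_const_mul, integral_sub_one_sq hn,
    integral_sub_one_cube hn] at hint
  have hu2 : u 2 1 = t ^ 2 • T.genPow 2 t x := by
    rw [hu, orbitDeriv, mul_one, neg_sq]
  have hu3 : ‖u 3 1‖ ≤ N₃ := by
    simpa [hu, hN₃_def] using h.norm_orbitDeriv_le h0 hk3 ht hxy one_pos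
  -- The mean of the quadratic term is the stated correction; that of the cubic term,
  -- `(1/6)(2/n²)u'''(1)`, is subtracted and added back.
  have hsplit : (T.resolvent (t / n) ^ n) x - T.toFun t x - (t ^ 2 / (2 * (n : ℝ))) • T.genPow 2 t x
      = ((T.resolvent (t / n) ^ n) x - T.toFun t x + (-1 / 2 * (1 / (n : ℝ))) • u 2 1 +
        (-1 / 6 * (2 / (n : ℝ) ^ 2)) • u 3 1) + (1 / (3 * (n : ℝ) ^ 2)) • u 3 1 := by
    rw [hu2]
    match_scalars <;> field_simp
    ring
  rw [hsplit]
  have hlast : ‖(1 / (3 * (n : ℝ) ^ 2)) • u 3 1‖ ≤ 1 / (3 * (n : ℝ) ^ 2) * N₃ := by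
    rw [norm_smul, Real.norm_of_nonneg (by positivity)]
    gcongr
  refine (norm_add_le_of_le (hint.trans (mul_le_mul_of_nonneg_left hgle hN)) hlast).trans ?_
  -- The factors obtained are `1/6` for `M_{4-α}` and `1/3` for `M_{3-α}`; both are enlarged to `1`,
  -- so `C = 1` is admissible.
  have e : (T.smoothingConst (3 - α) + T.smoothingConst (4 - α)) * (t ^ α / (n : ℝ) ^ 2) * ‖y‖ =
      N * (1 / (n : ℝ) ^ 2) + 1 / (n : ℝ) ^ 2 * N₃ := by
    rw [hN_def, hN₃_def]
    push_cast
    ring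
  rw [e]
  gcongr <;> linarith [sq_nonneg (n : ℝ)]

end IsBoundedAnalytic

end C0Semigroup

end

theorem theorem1p4 :
    (∀ (X : Type u) [NormedAddCommGroup X] [NormedSpace ℂ X] [CompleteSpace X]
      (T : C0Semigroup X), T.IsSectoriallyBoundedHolomorphic →
      ∀ (α t : ℝ) (n : ℕ), 0 ≤ α → α ≤ 1 → 0 < t → 1 ≤ n →
        ∃ R : X →L[ℂ] X, C0Semigroup.IsInvOneAdd T.negGenerator (t / n) R ∧
          ∀ x y : X, T.IsFracPow α x y →
            ‖(R ^ n) x - T.toFun t x‖ ≤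
              T.smoothingConst (2 - α) * eulerRate α n * t ^ α * ‖y‖) ∧
    ∃ C : ℝ, 0 < C ∧
      ∀ (X : Type u) [NormedAddCommGroup X] [NormedSpace ℂ X] [CompleteSpace X]
        (T : C0Semigroup X), T.IsSectoriallyBoundedHolomorphic →
        ∀ (α t : ℝ) (n : ℕ), 0 ≤ α → α ≤ 1 → 0 < t → 1 ≤ n →
          ∃ R : X →L[ℂ] X, C0Semigroup.IsInvOneAdd T.negGenerator (t / n) R ∧
            ∀ x y : X, T.IsFracPow α x y →
              ∃ z : X, C0Semigroup.IsSquareOf T.negGenerator (T.toFun t x) z ∧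
                ‖(R ^ n) x - T.toFun t x - ((t ^ 2 / (2 * (n : ℝ)) : ℝ) : ℂ) • z‖ ≤
                  C * (T.smoothingConst (3 - α) + T.smoothingConst (4 - α)) *
                    (t ^ α / (n : ℝ) ^ 2) * ‖y‖ := by
  refine ⟨fun X _ _ _ T hT α t n h0 h1 ht hn => ?_, 1, one_pos,
    fun X _ _ _ T hT α t n h0 h1 ht hn => ?_⟩
  all_goals
    obtain ⟨K, C, h⟩ := hT.exists_isBoundedAnalytic
    have hn' : (0 : ℝ) < n := by exact_mod_cast hn
    refine ⟨T.resolvent (t / n), h.bound.isInvOneAdd (div_pos ht hn'), fun x y hxy => ?_⟩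
  · exact h.norm_resolvent_pow_sub_le h0 h1 ht hn hxy
  · refine ⟨T.genPow 2 t x, h.isSquareOf ht x, ?_⟩
    rw [one_mul]
    exact h.norm_resolvent_pow_sub_sub_le h0 h1 ht hn hxy
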